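/- **Conventions.** A (small) Waldhausen category is a small category with a distinguished zero object $*$, cofibrations and weak equivalences satisfying Waldhausen's axioms. For a Waldhausen category $\mathcal C$ and $q\ge 0$, let $S^{(q)}[n_1,\dots,n_q]\mathcal C$ be the full subcategory of functors $A\colon \mathrm{Ar}[n_1]\times\cdots\times \mathrm{Ar}[n_q]\to\mathcal C$ (where $\mathrm{Ar}[n]$ is the poset of pairs $0\le i\le j\le n$) such that $A_{i_1,j_1;\dots;i_q,j_q}=*$ whenever some $i_k=j_k$; the diagram $(j_1,\dots,j_q)\mapsto A_{0,j_1;\dots;0,j_q}$ is cubically cofibrant (all its maps are cofibrations, and for each unit sub-cube the map from the colimit of the cube without its last vertex to the last vertex is a cofibration); and for each direction $r$ and $i\le j\le k$ the square $A_{\dots;i,j;\dots}\to A_{\dots;i,k;\dots}$, $A_{\dots;j,j;\dots}\to A_{\dots;j,k;\dots}$ (other indices fixed) is a pushout. The K-theory spectrum $K\mathcal C$ is the symmetric spectrum, in the sense of Hovey–Shipley–Smith (based on pointed simplicial sets), whose $q$-th term is the diagonal of the nerve of the multisimplicial category $wS^{(q)}\mathcal C$ of objectwise weak equivalences, with suspension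 maps induced by the projections $\mathrm{Ar}[n_1]\times\cdots\times\mathrm{Ar}[n_{q+1}]\to \mathrm{Ar}[n_1]\times\cdots\times\mathrm{Ar}[n_q]$ and with $\Sigma_q$ permuting the simplicial directions. A functor $F\colon \mathcal C_1\times\cdots\times\mathcal C_k\to\mathcal D$ is multiexact if $F(X_1,\dots,X_k)=*$ whenever some $X_i=*$, $F$ is exact in each variable, and $F$ takes each $k$-tuple of cofibrations to a cubically cofibrant $k$-cube. $\mathrm{Mult}_k(\mathcal C_1,\dots,\mathcal C_k;\mathcal D)$ is the category of multiexact functors and natural weak equivalences (for $k=0$: the category of weak equivalences of $\mathcal D$). Let $\mathcal M$ be a symmetric multicategory enriched in small categories. An $\mathcal M$-algebra $C$ in Waldhausen categories is a Waldhausen category $C(x)$ for each object $x$ and functors $\mathcal M_k(x_1,\dots,x_k;y)\to \mathrm{Mult}_k(C(x_1),\dots,C(x_k);C(y))$ strictly compatible with permutations, composition and identity objects; a map $C\to D$ of such algebras is a family of exact functors $C(x)\to D(x)$ commuting strictly with the actions. An $\mathcal M$-algebra in symmetric spectra is a symmetric spectrum $A(x)$ for each object $x$ and maps of symmetric spectra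 $$N(\mathcal M_k(x_1,\dots,x_k;y))\wedge A(x_1)\wedge\cdots\wedge A(x_k)\to A(y)$$ ($N$ is the nerve; for $k=0$ the source is $N(\mathcal M_0(;y))\wedge S$) compatible with permutations, composition and identity objects. **Theorem.** Let $\mathcal M$ be a symmetric multicategory enriched in small categories. Waldhausen's K-theory functor $K$ naturally takes $\mathcal M$-algebras in Waldhausen categories to $\mathcal M$-algebras in symmetric spectra. That is, for each $\mathcal M$-algebra $C$ in Waldhausen categories the symmetric spectra $K(C(x))$ carry the structure of an $\mathcal M$-algebra in symmetric spectra, given as follows: on an $m$-simplex $\nu=(f_0\to\cdots\to f_m)$ of $N(\mathcal M_k(x_1,\dots,x_k;y))$ and $m$-simplices $X_i$ of $K(C(x_i))(q_i)$, regarded as diagrams $X_i(t,u_i)$ in $C(x_i)$ with $t\in[m]$ and $u_i\in \mathrm{Ar}[m]^{q_i}$, the action is the diagram $$(t,u_1,\dots,u_k)\longmapsto f_t\bigl(X_1(t,u_1),\dots,X_k(t,u_k)\bigr)$$ in $C(y)$, an $m$-simplex of $K(C(y))(q_1+\cdots+q_k)$; and for each map $H\colon C\to D$ of $\mathcal M$-algebras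 in Waldhausen categories, the maps $K(H_x)\colon K(C(x))\to K(D(x))$ commute with these actions. -/

import Mathlib

open CategoryTheory CategoryTheory.Limits Opposite

universe v u

set_option linter.checkUnivs false

/-- A small Waldhausen category: a category with a distinguished zero object, cofibrations and
weak equivalences. -/
structure WaldCat : Type (u + 1) where
  carrier : Type u
  [cat : SmallCategory carrier]
  /-- the distinguished zero object `*` -/
  zero : carrier
  isZero_zero : IsZero zero
  cof : MorphismProperty carrier
  weq : MorphismProperty carrier
  cof_of_isIso : ∀ {A B : carrier} (f : A ⟶ B) [IsIso f], cof f
  cof_comp : ∀ {A B D : carrier} (f : A ⟶ B) (g : B ⟶ D), cof f → cof g → cof (f ≫ g)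
  cof_zero : ∀ {A : carrier} (f : zero ⟶ A), cof f
  hasPushout : ∀ {A B D : carrier} (f : A ⟶ B) (g : A ⟶ D), cof f → HasPushout f g
  cof_pushout : ∀ {A B D E : carrier} {f : A ⟶ B} {g : A ⟶ D} {h : B ⟶ E} {i : D ⟶ E},
    IsPushout f g h i → cof f → cof i
  weq_of_isIso : ∀ {A B : carrier} (f : A ⟶ B) [IsIso f], weq f
  weq_comp : ∀ {A B D : carrier} (f : A ⟶ B) (g : B ⟶ D), weq f → weq g → weq (f ≫ g)
  /-- the gluing axiom for weak equivalences -/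
  gluing : ∀ {A B D E A' B' D' E' : carrier}
    {f : A ⟶ B} {g : A ⟶ D} {h : B ⟶ E} {i : D ⟶ E}
    {f' : A' ⟶ B'} {g' : A' ⟶ D'} {h' : B' ⟶ E'} {i' : D' ⟶ E'}
    (a : A ⟶ A') (b : B ⟶ B') (d : D ⟶ D') (e : E ⟶ E'),
    IsPushout f g h i → IsPushout f' g' h' i' → cof f → cof f' →
    f ≫ b = a ≫ f' → g ≫ d = a ≫ g' → h ≫ e = b ≫ h' → i ≫ e = d ≫ i' →
    weq a → weq b → weq d → weq e

namespace WaldCat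

instance : CoeSort WaldCat.{u} (Type u) := ⟨WaldCat.carrier⟩

instance (C : WaldCat.{u}) : SmallCategory C := C.cat

/-- The zero morphism `A ⟶ * ⟶ B`. -/
noncomputable def zeroMap (C : WaldCat.{u}) (A B : C) : A ⟶ B :=
  C.isZero_zero.from_ A ≫ C.isZero_zero.to_ B

/-- Exact functors: they preserve the zero object, cofibrations, weak equivalences, and pushouts
along cofibrations. -/
structure IsExact {C D : WaldCat.{u}} (F : C ⥤ D) : Prop where
  map_zero : F.obj C.zero = D.zero
  map_cof : ∀ {A B : C} (f : A ⟶ B), C.cof f → D.cof (F.map f)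
  map_weq : ∀ {A B : C} (f : A ⟶ B), C.weq f → D.weq (F.map f)
  map_pushout : ∀ {A B X Y : C} {f : A ⟶ B} {g : A ⟶ X} {h : B ⟶ Y} {i : X ⟶ Y},
    C.cof f → IsPushout f g h i → IsPushout (F.map f) (F.map g) (F.map h) (F.map i)

end WaldCat

/-! ### Cubes and the iterated S-construction -/

/-- The poset `[n₁] × ⋯ × [n_q]`. -/
def Grid {q : ℕ} (n : Fin q → ℕ) : Type := ∀ k, Fin (n k + 1)

namespace Grid

variable {q : ℕ} {n : Fin q → ℕ}

noncomputable instance : DistribLattice (Grid n) :=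
  inferInstanceAs (DistribLattice (∀ k, Fin (n k + 1)))
noncomputable instance : BoundedOrder (Grid n) :=
  inferInstanceAs (BoundedOrder (∀ k, Fin (n k + 1)))
instance : Finite (Grid n) := inferInstanceAs (Finite (∀ k, Fin (n k + 1)))

end Grid

/-- The restriction of a diagram on a poset to the half-open interval `{x | i ≤ x < j}`. -/
def icoRestrict {P : Type} [PartialOrder P] {C : WaldCat.{u}} (X : P ⥤ C) (i j : P) :
    Set.Ico i j ⥤ C :=
  (Subtype.mono_coe (· ∈ Set.Ico i j)).functor ⋙ X

/-- The cocone with vertex `X j` on the restriction of `X` to `{x | i ≤ x < j}`. -/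
def icoCocone {P : Type} [PartialOrder P] {C : WaldCat.{u}} (X : P ⥤ C) (i j : P) :
    Cocone (icoRestrict X i j) where
  pt := X.obj j
  ι :=
    { app := fun x => X.map (homOfLE x.2.2.le)
      naturality := fun x y f => by
        simp only [icoRestrict, Functor.comp_map, Functor.const_obj_map, Functor.const_obj_obj, Category.comp_id]
        rw [← X.map_comp]; rfl }

/-- Cubically cofibrant diagrams `[n₁] × ⋯ × [n_q] ⥤ C`.  A pair `i ≤ j` such that each
`j r` is `i r` or `i r + 1` (that is, `i r ⩿ j r`) determines the unit sub-cube
`{x | i ≤ x ≤ j}` in the directions `{r | i r < j r}`; deleting its last vertex `j` leaves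
`{x | i ≤ x < j}`. -/
structure IsCubicallyCofibrant {C : WaldCat.{u}} {q : ℕ} {n : Fin q → ℕ} (X : Grid n ⥤ C) :
    Prop where
  cof_map : ∀ (i j : Grid n) (h : i ≤ j), C.cof (X.map (homOfLE h))
  cof_cube : ∀ i j : Grid n, (∀ r, i r ⩿ j r) →
    ∃ (c : Cocone (icoRestrict X i j)) (hc : IsColimit c), C.cof (hc.desc (icoCocone X i j))

/-! The next sections prove that cubically cofibrant diagrams, and hence the objects of the iterated
S-construction, are stable under the operations which make the K-theory of a Waldhausen category a
symmetric spectrum.  They do not enter the statements of later definitions. -/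

section CofibrantSystems

variable {C D : WaldCat.{u}} {P Q : Type} [PartialOrder P] [PartialOrder Q]

/-- Auxiliary: a functor on lower sets which takes unions to pushouts and inclusions to
cofibrations. -/
structure CofSystem (C : WaldCat.{u}) (P : Type) [PartialOrder P] where
  obj : LowerSet P → C
  m : ∀ {A B : LowerSet P}, A ≤ B → (obj A ⟶ obj B)
  m_refl : ∀ {A : LowerSet P} (h : A ≤ A), m h = 𝟙 _
  m_comp : ∀ {A B E : LowerSet P} (h : A ≤ B) (h' : B ≤ E), m h ≫ m h' = m (h.trans h')
  bot : IsZero (obj ⊥)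
  cof : ∀ {A B : LowerSet P} (h : A ≤ B), C.cof (m h)
  sup : ∀ (A B : LowerSet P), IsPushout (m (inf_le_left : A ⊓ B ≤ A)) (m inf_le_right)
    (m (le_sup_left : A ≤ A ⊔ B)) (m le_sup_right)

theorem CofSystem.m_comp_assoc (S : CofSystem C P) {D E F : LowerSet P} (h : D ≤ E) (h' : E ≤ F)
    {Z : C} (g : S.obj F ⟶ Z) : S.m h ≫ S.m h' ≫ g = S.m (h.trans h') ≫ g := by
  rw [← Category.assoc, S.m_comp]

/-- Pushout squares for unions, with flexible corners. -/
theorem CofSystem.isPushout (S : CofSystem C P) {A D E F : LowerSet P} (hA : A = D ⊓ E)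
    (hF : F = D ⊔ E) (h₁ : A ≤ D) (h₂ : A ≤ E) (h₃ : D ≤ F) (h₄ : E ≤ F) :
    IsPushout (S.m h₁) (S.m h₂) (S.m h₃) (S.m h₄) := by
  subst hA hF; exact S.sup D E

theorem iic_mono {p q : P} (h : p ≤ q) : LowerSet.Iic p ≤ LowerSet.Iic q := LowerSet.Iic_le.2 h

/-- Auxiliary: an identification of the diagram `X` with the values on principal lower sets. -/
structure CofSystem.Extends (S : CofSystem C P) (X : P ⥤ C) where
  e : ∀ p, S.obj (LowerSet.Iic p) ≅ X.obj p
  he : ∀ {p q : P} (h : p ≤ q),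
    S.m (iic_mono h) ≫ (e q).hom = (e p).hom ≫ X.map (homOfLE h)

/-- Auxiliary: `X` extends to a cofibrant system. -/
def IsSystem (X : P ⥤ C) : Prop :=
  ∃ S : CofSystem C P, Nonempty (S.Extends X)

theorem CofSystem.Extends.he_inv {S : CofSystem C P} {X : P ⥤ C} (E : S.Extends X) {p q : P}
    (h : p ≤ q) : X.map (homOfLE h) = (E.e p).inv ≫ S.m (iic_mono h) ≫ (E.e q).hom := by
  rw [E.he, Iso.inv_hom_id_assoc]

theorem CofSystem.existsUnique_desc [Finite P] (S : CofSystem C P) {Z : C}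
    (f : ∀ p, S.obj (LowerSet.Iic p) ⟶ Z)
    (hf : ∀ p q (h : p ≤ q), S.m (iic_mono h) ≫ f q = f p)
    (D : LowerSet P) :
    ∃! g : S.obj D ⟶ Z, ∀ p (hp : p ∈ D), S.m (LowerSet.Iic_le.2 hp) ≫ g = f p := by
  classical
  induction D using WellFoundedLT.induction with
  | ind D ih =>
  by_cases hD : D = ⊥
  · subst hD
    refine ⟨S.bot.to_ Z, fun p hp => absurd hp (by simp), fun g _ => S.bot.eq_of_src _ _⟩
  · obtain ⟨p, hp, hmax⟩ : ∃ p ∈ D, ∀ b ∈ D, p ≤ b → b = p := by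
      have hne : (D : Set P).Nonempty := by
        rw [Set.nonempty_iff_ne_empty]; intro h; exact hD (SetLike.coe_injective h)
      obtain ⟨p, hp⟩ := (Set.toFinite (D : Set P)).exists_maximal hne
      exact ⟨p, hp.1, fun b hb hpb => le_antisymm (hp.2 hb hpb) hpb⟩
    have hsup : D = D.erase p ⊔ LowerSet.Iic p := (LowerSet.erase_sup_Iic hp hmax).symm
    have hlt : D.erase p < D := LowerSet.erase_lt.2 hp
    have hlt' : D.erase p ⊓ LowerSet.Iic p < D := lt_of_le_of_lt inf_le_left hlt
    obtain ⟨g, hg, hg'⟩ := ih _ hlt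
    obtain ⟨k, hk, hk'⟩ := ih _ hlt'
    have po := S.isPushout (rfl : D.erase p ⊓ LowerSet.Iic p = _) hsup inf_le_left inf_le_right
      hlt.le (LowerSet.Iic_le.2 hp)
    have hcomm : S.m (inf_le_left : D.erase p ⊓ LowerSet.Iic p ≤ D.erase p) ≫ g
        = S.m (inf_le_right : D.erase p ⊓ LowerSet.Iic p ≤ LowerSet.Iic p) ≫ f p := by
      refine (hk' _ (fun r hr => ?_)).trans (hk' _ (fun r hr => ?_)).symm
      · rw [S.m_comp_assoc]; exact hg r hr.1
      · rw [S.m_comp_assoc]; exact hf r p hr.2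
    refine ⟨po.desc g (f p) hcomm, fun r hr => ?_, fun g' hg₁ => ?_⟩
    · by_cases hrp : r = p
      · subst hrp; exact po.inr_desc _ _ _
      · have hr' : r ∈ D.erase p := by
          refine ⟨hr, fun h : p ≤ r => hrp (hmax r hr h)⟩
        have := po.inl_desc g (f p) hcomm
        rw [← hg r hr']
        conv_rhs => rw [← this]
        rw [S.m_comp_assoc]
    · apply po.hom_ext
      · rw [po.inl_desc]
        refine hg' _ (fun r hr => ?_)
        rw [S.m_comp_assoc]; exact hg₁ r hr.1
      · rw [po.inr_desc]; exact hg₁ p hp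

/-- Auxiliary: reindexing a cofibrant system along a map of lattices of lower sets. -/
def CofSystem.comap (S : CofSystem C P) (φ : LowerSet Q →o LowerSet P) (h₀ : φ ⊥ = ⊥)
    (h₁ : ∀ D E, φ (D ⊔ E) = φ D ⊔ φ E) (h₂ : ∀ D E, φ (D ⊓ E) = φ D ⊓ φ E) :
    CofSystem C Q where
  obj D := S.obj (φ D)
  m h := S.m (φ.monotone h)
  m_refl _ := S.m_refl _
  m_comp _ _ := S.m_comp _ _
  bot := by rw [h₀]; exact S.bot
  cof _ := S.cof _
  sup D E := S.isPushout (h₂ D E) (h₁ D E) _ _ _ _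

/-- Auxiliary: the lower closure of the image. -/
def lowerImage (f : Q →o P) : LowerSet Q →o LowerSet P where
  toFun D := ⟨{y | ∃ x ∈ D, y ≤ f x}, fun _ _ h ⟨x, hx, hy⟩ => ⟨x, hx, h.trans hy⟩⟩
  monotone' _ _ h _ := fun ⟨x, hx, hy⟩ => ⟨x, h hx, hy⟩

/-- Auxiliary: binary meets exist in `Q` and are preserved by `f`. -/
def MeetPres (f : Q →o P) : Prop :=
  ∀ x x' : Q, ∃ z, z ≤ x ∧ z ≤ x' ∧ ∀ y, y ≤ f x → y ≤ f x' → y ≤ f z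

/-- Auxiliary: reindexing a cofibrant system along a meet preserving map. -/
def CofSystem.reindex (S : CofSystem C P) (f : Q →o P) (hf : MeetPres f) : CofSystem C Q :=
  S.comap (lowerImage f)
    (by ext y; constructor
        · rintro ⟨x, hx, _⟩; exact absurd hx (by simp)
        · intro h; exact absurd h (by simp))
    (fun D E => by
      ext y; constructor
      · rintro ⟨x, hx | hx, hy⟩
        · exact Or.inl ⟨x, hx, hy⟩
        · exact Or.inr ⟨x, hx, hy⟩
      · rintro (⟨x, hx, hy⟩ | ⟨x, hx, hy⟩)
        · exact ⟨x, Or.inl hx, hy⟩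
        · exact ⟨x, Or.inr hx, hy⟩)
    (fun D E => by
      ext y; constructor
      · rintro ⟨x, hx, hy⟩; exact ⟨⟨x, hx.1, hy⟩, ⟨x, hx.2, hy⟩⟩
      · rintro ⟨⟨x, hx, hy⟩, ⟨x', hx', hy'⟩⟩
        obtain ⟨z, h₁, h₂, h₃⟩ := hf x x'
        exact ⟨z, ⟨D.lower h₁ hx, E.lower h₂ hx'⟩, h₃ y hy hy'⟩)

theorem lowerImage_Iic (f : Q →o P) (x : Q) :
    lowerImage f (LowerSet.Iic x) = LowerSet.Iic (f x) := by
  ext y; constructor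
  · rintro ⟨z, hz, hy⟩; exact hy.trans (f.monotone hz)
  · intro hy; exact ⟨x, le_rfl, hy⟩

/-- Auxiliary: equal lower sets have isomorphic values. -/
def CofSystem.isoOfEq (S : CofSystem C P) {A B : LowerSet P} (h : A = B) : S.obj A ≅ S.obj B where
  hom := S.m h.le
  inv := S.m h.ge
  hom_inv_id := by rw [S.m_comp, S.m_refl]
  inv_hom_id := by rw [S.m_comp, S.m_refl]

/-- Auxiliary: reindexing is compatible with extensions. -/
def CofSystem.Extends.reindex {S : CofSystem C P} {X : P ⥤ C} (E : S.Extends X) (f : Q →o P)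
    (hf : MeetPres f) (Y : Q ⥤ C) (i : ∀ x, X.obj (f x) ≅ Y.obj x)
    (hi : ∀ {x y : Q} (h : x ≤ y), X.map (homOfLE (f.monotone h)) ≫ (i y).hom =
      (i x).hom ≫ Y.map (homOfLE h)) :
    (S.reindex f hf).Extends Y where
  e x := S.isoOfEq (lowerImage_Iic f x) ≪≫ E.e (f x) ≪≫ i x
  he {x y} h := by
    change S.m _ ≫ S.m _ ≫ _ ≫ _ = (S.m _ ≫ _ ≫ _) ≫ _
    rw [S.m_comp_assoc, Category.assoc, Category.assoc, ← hi h, ← Category.assoc (E.e _).hom,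
      ← E.he (f.monotone h), Category.assoc, S.m_comp_assoc]

theorem IsSystem.reindex {X : P ⥤ C} (hX : IsSystem X) (f : Q →o P) (hf : MeetPres f)
    (Y : Q ⥤ C) (i : ∀ x, X.obj (f x) ≅ Y.obj x)
    (hi : ∀ {x y : Q} (h : x ≤ y), X.map (homOfLE (f.monotone h)) ≫ (i y).hom =
      (i x).hom ≫ Y.map (homOfLE h)) : IsSystem Y := by
  obtain ⟨S, ⟨E⟩⟩ := hX
  exact ⟨S.reindex f hf, ⟨E.reindex f hf Y i hi⟩⟩

theorem IsSystem.cof_map {X : P ⥤ C} (hX : IsSystem X) {p q : P} (h : p ≤ q) :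
    C.cof (X.map (homOfLE h)) := by
  obtain ⟨S, ⟨E⟩⟩ := hX
  rw [E.he_inv h]
  exact C.cof_comp _ _ (C.cof_of_isIso _) (C.cof_comp _ _ (S.cof _) (C.cof_of_isIso _))

/-- Auxiliary: the cocone with vertex the value of a cofibrant system on the whole poset. -/
def CofSystem.Extends.cocone {S : CofSystem C P} {X : P ⥤ C} (E : S.Extends X) : Cocone X where
  pt := S.obj ⊤
  ι :=
    { app := fun p => (E.e p).inv ≫ S.m (le_top : LowerSet.Iic p ≤ ⊤)
      naturality := fun p q h => by
        simp only [Functor.const_obj_map, Functor.const_obj_obj, Category.comp_id]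
        have := E.he_inv (leOfHom h)
        rw [show h = homOfLE (leOfHom h) from rfl, this]
        simp only [Category.assoc, Iso.hom_inv_id_assoc, S.m_comp] }

/-- The value of a cofibrant system on the whole poset is the colimit. -/
theorem CofSystem.Extends.nonempty_isColimit [Finite P] {S : CofSystem C P} {X : P ⥤ C}
    (E : S.Extends X) : Nonempty (IsColimit E.cocone) := by
  have key := fun s : Cocone X => S.existsUnique_desc (fun p => (E.e p).hom ≫ s.ι.app p)
      (fun p q h => by
        rw [← Category.assoc, E.he h, Category.assoc, s.w]) ⊤
  exact ⟨
      { desc := fun s => (key s).choose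
        fac := fun s p => by
          have := (key s).choose_spec.1 p trivial
          change ((E.e p).inv ≫ S.m _) ≫ _ = _
          rw [Category.assoc, this, Iso.inv_hom_id_assoc]
        uniq := fun s (g : S.obj ⊤ ⟶ s.pt) hg => (key s).choose_spec.2 g (fun p _ => by
          have : ((E.e p).inv ≫ S.m _) ≫ g = s.ι.app p := hg p
          rw [← this, Category.assoc, Iso.hom_inv_id_assoc]) }⟩

theorem IsSystem.isCubicallyCofibrant {q : ℕ} {n : Fin q → ℕ} {X : Grid n ⥤ C}
    (hX : IsSystem X) : IsCubicallyCofibrant X := by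
  refine ⟨fun i j h => hX.cof_map _, fun i j _ => ?_⟩
  obtain ⟨S, ⟨E⟩⟩ := hX
  let f : Set.Ico i j →o Grid n := ⟨Subtype.val, Subtype.mono_coe _⟩
  have hf : MeetPres f := fun x x' =>
    ⟨⟨x.1 ⊓ x'.1, le_inf x.2.1 x'.2.1, lt_of_le_of_lt inf_le_left x.2.2⟩, inf_le_left,
      inf_le_right, fun y h h' => le_inf h h'⟩
  let E' := E.reindex f hf (icoRestrict X i j) (fun x => Iso.refl _) (fun {x y} h => by
    exact (Category.comp_id (X.map (homOfLE h : x.1 ⟶ y.1))).trans (Category.id_comp _).symm)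
  obtain ⟨hc⟩ := E'.nonempty_isColimit
  refine ⟨_, hc, ?_⟩
  have hle : lowerImage f ⊤ ≤ LowerSet.Iic j := fun y ⟨x, _, hy⟩ => hy.trans x.2.2.le
  have : hc.desc (icoCocone X i j) = S.m hle ≫ (E.e j).hom := by
    refine hc.hom_ext (fun x => ?_)
    rw [hc.fac]
    change X.map (homOfLE x.2.2.le) = (((𝟙 _ ≫ (E.e x.1).inv) ≫ S.m _) ≫ S.m _) ≫ S.m _ ≫ _
    rw [E.he_inv x.2.2.le]
    simp only [Category.assoc, Category.id_comp, S.m_comp_assoc]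
  have h1 : C.cof (S.m hle ≫ (E.e j).hom) := C.cof_comp _ _ (S.cof _) (C.cof_of_isIso _)
  rw [this]
  exact h1

/-- Auxiliary: the image of a cofibrant system under an exact functor. -/
def CofSystem.mapExact (S : CofSystem C P) (F : C ⥤ D) (hF : WaldCat.IsExact F) :
    CofSystem D P where
  obj A := F.obj (S.obj A)
  m h := F.map (S.m h)
  m_refl h := by rw [S.m_refl, F.map_id]
  m_comp h h' := by rw [← F.map_comp, S.m_comp]
  bot := by
    have e : F.obj (S.obj ⊥) ≅ D.zero :=
      F.mapIso (S.bot.iso C.isZero_zero) ≪≫ eqToIso hF.map_zero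
    exact D.isZero_zero.of_iso e
  cof h := hF.map_cof _ (S.cof h)
  sup A B := hF.map_pushout (S.cof _) (S.sup A B)

theorem IsSystem.mapExact {X : P ⥤ C} (hX : IsSystem X) (F : C ⥤ D) (hF : WaldCat.IsExact F) :
    IsSystem (X ⋙ F) := by
  obtain ⟨S, ⟨E⟩⟩ := hX
  refine ⟨S.mapExact F hF, ⟨⟨fun p => F.mapIso (E.e p), fun {p q} h => ?_⟩⟩⟩
  change F.map (S.m _) ≫ F.map (E.e q).hom = F.map (E.e p).hom ≫ F.map (X.map _)
  rw [← F.map_comp, E.he, F.map_comp]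

theorem IsSystem.of_isZero {X : P ⥤ C} (hX : ∀ p, IsZero (X.obj p)) : IsSystem X := by
  refine ⟨
    { obj := fun _ => C.zero
      m := fun _ => 𝟙 _
      m_refl := fun _ => rfl
      m_comp := fun _ _ => Category.comp_id _
      bot := C.isZero_zero
      cof := fun _ => C.cof_of_isIso _
      sup := fun A B => IsPushout.of_id_fst }, ⟨⟨fun p => C.isZero_zero.iso (hX p),
        fun {p q} h => (hX q).eq_of_tgt _ _⟩⟩⟩

theorem IsSystem.extend {X : P ⥤ C} (hX : IsSystem X) (Y : Q ⥤ C) (g : P →o Q) (h : Q → P)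
    (U : Set Q) (hU : ∀ y ∈ U, ∀ p, g p ≤ y ↔ p ≤ h y) (hU' : ∀ y ∉ U, ∀ p, ¬ g p ≤ y)
    (hmono : ∀ {y y' : Q}, y ≤ y' → h y ≤ h y')
    (i : ∀ y ∈ U, X.obj (h y) ≅ Y.obj y)
    (hi : ∀ {y y' : Q} (hy : y ∈ U) (hy' : y' ∈ U) (hle : y ≤ y'),
      X.map (homOfLE (hmono hle)) ≫ (i y' hy').hom = (i y hy).hom ≫ Y.map (homOfLE hle))
    (hz : ∀ y ∉ U, IsZero (Y.obj y)) : IsSystem Y := by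
  classical
  obtain ⟨S, ⟨E⟩⟩ := hX
  let φ : LowerSet Q →o LowerSet P :=
    ⟨fun A => ⟨{p | g p ∈ A}, fun _ _ hle ha => A.lower (g.monotone hle) ha⟩,
      fun _ _ hle _ hp => hle hp⟩
  have h1 : ∀ y ∈ U, φ (LowerSet.Iic y) = LowerSet.Iic (h y) := fun y hy => by
    ext p; exact hU y hy p
  have h2 : ∀ y ∉ U, φ (LowerSet.Iic y) = ⊥ := fun y hy => by
    ext p; exact ⟨fun hp => absurd hp (hU' y hy p), fun hp => absurd hp (by simp)⟩
  let S' := S.comap φ (by ext p; exact Iff.rfl) (fun A B => by ext p; exact Iff.rfl)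
    (fun A B => by ext p; exact Iff.rfl)
  have h3 : ∀ y ∉ U, IsZero (S'.obj (LowerSet.Iic y)) := fun y hy => by
    change IsZero (S.obj (φ _)); rw [h2 y hy]; exact S.bot
  let e : ∀ y, S'.obj (LowerSet.Iic y) ≅ Y.obj y := fun y =>
    if hy : y ∈ U then S.isoOfEq (h1 y hy) ≪≫ E.e (h y) ≪≫ i y hy
    else (h3 y hy).iso (hz y hy)
  refine ⟨S', ⟨⟨e, fun {y y'} hle => ?_⟩⟩⟩
  by_cases hy : y ∈ U
  · have hy' : y' ∈ U := by
      by_contra hn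
      exact hU' y' hn (h y) (((hU y hy (h y)).2 le_rfl).trans hle)
    have e1 : (e y).hom = S.m (h1 y hy).le ≫ (E.e (h y)).hom ≫ (i y hy).hom := by
      simp only [e, dif_pos hy]; rfl
    have e2 : (e y').hom = S.m (h1 y' hy').le ≫ (E.e (h y')).hom ≫ (i y' hy').hom := by
      simp only [e, dif_pos hy']; rfl
    rw [e1, e2]
    change S.m _ ≫ _ = (S.m _ ≫ (E.e (h y)).hom ≫ (i y hy).hom) ≫ _
    rw [S.m_comp_assoc, Category.assoc, Category.assoc, ← hi hy hy' hle,
      ← Category.assoc (E.e _).hom, ← E.he (hmono hle), Category.assoc, S.m_comp_assoc]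
  · exact (h3 y hy).eq_of_src _ _

/-! Quotients of cofibrant systems. -/

/-- Auxiliary: the quotient of the value at `A` by the value at `A ⊓ E`. -/
noncomputable def CofSystem.quotObj (S : CofSystem C P) (E A : LowerSet P) : C :=
  haveI := C.hasPushout (S.m (inf_le_left : A ⊓ E ≤ A)) (C.isZero_zero.from_ _) (S.cof _)
  pushout (S.m (inf_le_left : A ⊓ E ≤ A)) (C.isZero_zero.from_ _)

/-- Auxiliary: the quotient map. -/
noncomputable def CofSystem.quotMap (S : CofSystem C P) (E A : LowerSet P) :
    S.obj A ⟶ S.quotObj E A :=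
  haveI := C.hasPushout (S.m (inf_le_left : A ⊓ E ≤ A)) (C.isZero_zero.from_ _) (S.cof _)
  pushout.inl _ _

theorem CofSystem.quot_isPushout (S : CofSystem C P) (E A : LowerSet P) :
    IsPushout (S.m (inf_le_left : A ⊓ E ≤ A)) (C.isZero_zero.from_ _) (S.quotMap E A)
      (C.isZero_zero.to_ _) := by
  have := C.hasPushout (S.m (inf_le_left : A ⊓ E ≤ A)) (C.isZero_zero.from_ _) (S.cof _)
  have := IsPushout.of_hasPushout (S.m (inf_le_left : A ⊓ E ≤ A)) (C.isZero_zero.from_ _)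
  rw [show pushout.inr (S.m (inf_le_left : A ⊓ E ≤ A)) (C.isZero_zero.from_ _) =
    C.isZero_zero.to_ _ from C.isZero_zero.eq_of_src _ _] at this
  exact this

theorem CofSystem.quot_ext (S : CofSystem C P) (E A : LowerSet P) {Z : C}
    {f g : S.quotObj E A ⟶ Z} (h : S.quotMap E A ≫ f = S.quotMap E A ≫ g) : f = g :=
  (S.quot_isPushout E A).hom_ext h (C.isZero_zero.eq_of_src _ _)

theorem CofSystem.quot_exists (S : CofSystem C P) (E A : LowerSet P) {Z : C} (f : S.obj A ⟶ Z)
    (hf : S.m (inf_le_left : A ⊓ E ≤ A) ≫ f = C.zeroMap _ _) :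
    ∃ g, S.quotMap E A ≫ g = f :=
  ⟨(S.quot_isPushout E A).desc f (C.isZero_zero.to_ _) hf, IsPushout.inl_desc _ _ _ _⟩

theorem zeroMap_comp {A B E : C} (f : A ⟶ B) : f ≫ C.zeroMap B E = C.zeroMap A E := by
  unfold WaldCat.zeroMap
  rw [← Category.assoc, C.isZero_zero.eq_of_tgt (f ≫ _) (C.isZero_zero.from_ A)]

theorem comp_zeroMap {A B E : C} (f : B ⟶ E) : C.zeroMap A B ≫ f = C.zeroMap A E := by
  unfold WaldCat.zeroMap
  rw [Category.assoc, C.isZero_zero.eq_of_src (_ ≫ f) (C.isZero_zero.to_ E)]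

theorem CofSystem.quot_zero (S : CofSystem C P) {E A B : LowerSet P} (h : B ≤ A) (h' : B ≤ E) :
    S.m h ≫ S.quotMap E A = C.zeroMap _ _ := by
  have h1 : S.m h = S.m (le_inf h h') ≫ S.m (inf_le_left : A ⊓ E ≤ A) := (S.m_comp _ _).symm
  rw [h1, Category.assoc, (S.quot_isPushout E A).w]
  exact zeroMap_comp _

theorem CofSystem.quot_exists_m (S : CofSystem C P) (E : LowerSet P) {A B : LowerSet P}
    (h : A ≤ B) : ∃ g : S.quotObj E A ⟶ S.quotObj E B,
      S.quotMap E A ≫ g = S.m h ≫ S.quotMap E B := by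
  apply S.quot_exists
  rw [S.m_comp_assoc]
  exact S.quot_zero _ inf_le_right

/-- Auxiliary: transition maps of a quotient. -/
noncomputable def CofSystem.quotM (S : CofSystem C P) (E : LowerSet P) {A B : LowerSet P}
    (h : A ≤ B) : S.quotObj E A ⟶ S.quotObj E B := (S.quot_exists_m E h).choose

theorem CofSystem.quotMap_quotM (S : CofSystem C P) (E : LowerSet P) {A B : LowerSet P}
    (h : A ≤ B) : S.quotMap E A ≫ S.quotM E h = S.m h ≫ S.quotMap E B :=
  (S.quot_exists_m E h).choose_spec

theorem CofSystem.quotMap_quotM_assoc (S : CofSystem C P) (E : LowerSet P) {A B : LowerSet P}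
    (h : A ≤ B) {Z : C} (f : S.quotObj E B ⟶ Z) :
    S.quotMap E A ≫ S.quotM E h ≫ f = S.m h ≫ S.quotMap E B ≫ f := by
  rw [← Category.assoc, S.quotMap_quotM, Category.assoc]

theorem CofSystem.quot_cof (S : CofSystem C P) (E : LowerSet P) {A B : LowerSet P}
    (h : A ≤ B) : C.cof (S.quotM E h) := by
  let G := A ⊔ (B ⊓ E)
  have hG : G ≤ B := sup_le h inf_le_left
  have hinf : A ⊓ E = A ⊓ (B ⊓ E) := by
    rw [← inf_assoc, inf_eq_left.2 h]
  have po := S.isPushout hinf (rfl : G = _) inf_le_left (le_inf (inf_le_left.trans h) inf_le_right)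
    le_sup_left le_sup_right
  have hw : S.m (inf_le_left : A ⊓ E ≤ A) ≫ S.quotMap E A =
      S.m (le_inf (inf_le_left.trans h) inf_le_right : A ⊓ E ≤ B ⊓ E) ≫
        C.zeroMap _ (S.quotObj E A) := by
    rw [S.quot_zero _ inf_le_right, zeroMap_comp]
  let g : S.obj G ⟶ S.quotObj E A := po.desc (S.quotMap E A) (C.zeroMap _ _) hw
  have hg1 : S.m (le_sup_left : A ≤ G) ≫ g = S.quotMap E A := po.inl_desc _ _ _
  have hg2 : S.m (le_sup_right : B ⊓ E ≤ G) ≫ g = C.zeroMap _ _ := po.inr_desc _ _ _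
  refine C.cof_pushout (f := S.m hG) (g := g) (h := S.quotMap E B) (i := S.quotM E h) ?_ (S.cof hG)
  have hcomm : S.m hG ≫ S.quotMap E B = g ≫ S.quotM E h := by
    apply po.hom_ext
    · rw [S.m_comp_assoc, ← Category.assoc, hg1, S.quotMap_quotM]
    · rw [S.m_comp_assoc, ← Category.assoc, hg2, comp_zeroMap]
      exact S.quot_zero _ inf_le_right
  have key : ∀ {Z : C} (a : S.obj B ⟶ Z) (b : S.quotObj E A ⟶ Z), S.m hG ≫ a = g ≫ b →
      ∃ c, S.quotMap E B ≫ c = a ∧ S.quotM E h ≫ c = b := by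
    intro Z a b hab
    obtain ⟨c, hc⟩ := S.quot_exists E B a (by
      have h1 : S.m (inf_le_left : B ⊓ E ≤ B) = S.m (le_sup_right : B ⊓ E ≤ G) ≫ S.m hG :=
        (S.m_comp _ _).symm
      rw [h1, Category.assoc, hab, ← Category.assoc, hg2, comp_zeroMap])
    refine ⟨c, hc, S.quot_ext E A ?_⟩
    rw [S.quotMap_quotM_assoc, hc, ← hg1, Category.assoc, ← hab, S.m_comp_assoc]
  refine ⟨⟨hcomm⟩, ⟨PushoutCocone.IsColimit.mk _ (fun s => (key s.inl s.inr s.condition).choose)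
    (fun s => (key s.inl s.inr s.condition).choose_spec.1)
    (fun s => (key s.inl s.inr s.condition).choose_spec.2) (fun s m h1 _ => ?_)⟩⟩
  apply S.quot_ext
  rw [h1, (key s.inl s.inr s.condition).choose_spec.1]

theorem CofSystem.quot_sup (S : CofSystem C P) (E A B : LowerSet P) :
    IsPushout (S.quotM E (inf_le_left : A ⊓ B ≤ A)) (S.quotM E inf_le_right)
      (S.quotM E (le_sup_left : A ≤ A ⊔ B)) (S.quotM E le_sup_right) := by
  have hcomm : S.quotM E (inf_le_left : A ⊓ B ≤ A) ≫ S.quotM E (le_sup_left : A ≤ A ⊔ B) =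
      S.quotM E (inf_le_right : A ⊓ B ≤ B) ≫ S.quotM E le_sup_right := by
    apply S.quot_ext
    rw [S.quotMap_quotM_assoc, S.quotMap_quotM_assoc, S.quotMap_quotM, S.quotMap_quotM,
      S.m_comp_assoc, S.m_comp_assoc]
  have key : ∀ {Z : C} (a : S.quotObj E A ⟶ Z) (b : S.quotObj E B ⟶ Z),
      S.quotM E (inf_le_left : A ⊓ B ≤ A) ≫ a = S.quotM E (inf_le_right : A ⊓ B ≤ B) ≫ b →
      ∃ c, S.quotM E (le_sup_left : A ≤ A ⊔ B) ≫ c = a ∧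
        S.quotM E (le_sup_right : B ≤ A ⊔ B) ≫ c = b := by
    intro Z a b hab
    have hab' : S.m (inf_le_left : A ⊓ B ≤ A) ≫ S.quotMap E A ≫ a =
        S.m (inf_le_right : A ⊓ B ≤ B) ≫ S.quotMap E B ≫ b := by
      rw [← S.quotMap_quotM_assoc, hab, S.quotMap_quotM_assoc]
    let f := (S.sup A B).desc (S.quotMap E A ≫ a) (S.quotMap E B ≫ b) hab'
    have hf1 : S.m (le_sup_left : A ≤ A ⊔ B) ≫ f = S.quotMap E A ≫ a := (S.sup A B).inl_desc _ _ _
    have hf2 : S.m (le_sup_right : B ≤ A ⊔ B) ≫ f = S.quotMap E B ≫ b := (S.sup A B).inr_desc _ _ _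
    obtain ⟨c, hc⟩ := S.quot_exists E (A ⊔ B) f (by
      have po := S.isPushout (A := (A ⊓ E) ⊓ (B ⊓ E)) rfl (inf_sup_right A B E) inf_le_left
        inf_le_right (inf_le_inf_right _ le_sup_left) (inf_le_inf_right _ le_sup_right)
      apply po.hom_ext
      · have h1 : S.m (inf_le_inf_right E le_sup_left : A ⊓ E ≤ (A ⊔ B) ⊓ E) ≫
            S.m (inf_le_left : (A ⊔ B) ⊓ E ≤ A ⊔ B) =
            S.m (inf_le_left : A ⊓ E ≤ A) ≫ S.m le_sup_left := by rw [S.m_comp, S.m_comp]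
        rw [← Category.assoc, h1, Category.assoc, hf1, ← Category.assoc,
          S.quot_zero _ inf_le_right, comp_zeroMap, zeroMap_comp]
      · have h1 : S.m (inf_le_inf_right E le_sup_right : B ⊓ E ≤ (A ⊔ B) ⊓ E) ≫
            S.m (inf_le_left : (A ⊔ B) ⊓ E ≤ A ⊔ B) =
            S.m (inf_le_left : B ⊓ E ≤ B) ≫ S.m le_sup_right := by rw [S.m_comp, S.m_comp]
        rw [← Category.assoc, h1, Category.assoc, hf2, ← Category.assoc,
          S.quot_zero _ inf_le_right, comp_zeroMap, zeroMap_comp])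
    refine ⟨c, S.quot_ext E A ?_, S.quot_ext E B ?_⟩
    · rw [S.quotMap_quotM_assoc, hc, hf1]
    · rw [S.quotMap_quotM_assoc, hc, hf2]
  refine ⟨⟨hcomm⟩, ⟨PushoutCocone.IsColimit.mk _ (fun s => (key s.inl s.inr s.condition).choose)
    (fun s => (key s.inl s.inr s.condition).choose_spec.1)
    (fun s => (key s.inl s.inr s.condition).choose_spec.2) (fun s m h1 h2 => ?_)⟩⟩
  apply S.quot_ext
  apply (S.sup A B).hom_ext
  · rw [← S.quotMap_quotM_assoc, ← S.quotMap_quotM_assoc, h1,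
      (key s.inl s.inr s.condition).choose_spec.1]
  · rw [← S.quotMap_quotM_assoc, ← S.quotMap_quotM_assoc, h2,
      (key s.inl s.inr s.condition).choose_spec.2]

/-- Auxiliary: quotient systems. -/
noncomputable def CofSystem.quot (S : CofSystem C P) (E : LowerSet P) : CofSystem C P where
  obj A := S.quotObj E A
  m h := S.quotM E h
  m_refl h := by
    apply S.quot_ext
    rw [S.quotMap_quotM, S.m_refl, Category.id_comp, Category.comp_id]
  m_comp h h' := by
    apply S.quot_ext
    rw [S.quotMap_quotM_assoc, S.quotMap_quotM, S.quotMap_quotM, S.m_comp_assoc]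
  bot := by
    have h1 : ∀ {Z : C} (f g : S.quotObj E ⊥ ⟶ Z), f = g := fun f g =>
      S.quot_ext E ⊥ (S.bot.eq_of_src _ _)
    have h2 : S.quotObj E ⊥ ≅ C.zero :=
      ⟨C.isZero_zero.from_ _, C.isZero_zero.to_ _, h1 _ _, C.isZero_zero.eq_of_src _ _⟩
    exact C.isZero_zero.of_iso h2
  cof h := S.quot_cof E h
  sup A B := S.quot_sup E A B

theorem IsSystem.quot {X : P ⥤ C} (hX : IsSystem X) (f : Q →o P) (hf : MeetPres f)
    (u v : Q → P) (hu : ∀ x y, y ≤ v x ↔ y ≤ f x ∧ y ≤ u x) (E : LowerSet P)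
    (hE : ∀ x y, y ≤ u x → y ∈ E) (hE' : ∀ x y, y ≤ f x → y ∈ E → y ≤ u x)
    (Y : Q ⥤ C) (π : ∀ x, X.obj (f x) ⟶ Y.obj x)
    (hπ : ∀ {x y : Q} (h : x ≤ y), X.map (homOfLE (f.monotone h)) ≫ π y =
      π x ≫ Y.map (homOfLE h))
    (hpo : ∀ x, ∃ (z : C) (_ : IsZero z) (a : X.obj (v x) ⟶ z) (b : z ⟶ Y.obj x),
      IsPushout (X.map (homOfLE ((hu x _).1 le_rfl).1)) a (π x) b) :
    IsSystem Y := by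
  obtain ⟨S, ⟨e⟩⟩ := hX
  have hv : ∀ x, LowerSet.Iic (f x) ⊓ E = LowerSet.Iic (v x) := fun x => by
    ext y; constructor
    · rintro ⟨h1, h2⟩; exact (hu x y).2 ⟨h1, hE' x y h1 h2⟩
    · intro h; exact ⟨((hu x y).1 h).1, hE x y ((hu x y).1 h).2⟩
  have key : ∀ x, ∃ i : S.quotObj E (LowerSet.Iic (f x)) ≅ Y.obj x,
      S.quotMap E _ ≫ i.hom = (e.e (f x)).hom ≫ π x := by
    intro x
    obtain ⟨z, hz, a, b, po⟩ := hpo x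
    have po1 := S.quot_isPushout E (LowerSet.Iic (f x))
    have po2 : IsPushout (S.m (inf_le_left : LowerSet.Iic (f x) ⊓ E ≤ _)) (C.isZero_zero.from_ _)
        ((e.e (f x)).hom ≫ π x) (C.isZero_zero.to_ _) := by
      refine IsPushout.of_iso po ((S.isoOfEq (hv x)) ≪≫ e.e (v x)).symm (e.e (f x)).symm
        (hz.iso C.isZero_zero) (Iso.refl _) ?_ (C.isZero_zero.eq_of_tgt _ _) ?_ (hz.eq_of_src _ _)
      · rw [e.he_inv ((hu x _).1 le_rfl).1]
        change _ = ((e.e (v x)).inv ≫ S.m _) ≫ S.m _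
        simp only [Category.assoc, Iso.symm_hom, Iso.hom_inv_id, Category.comp_id, S.m_comp]
      · simp
    refine ⟨po1.isoIsPushout _ _ po2, ?_⟩
    exact po1.inl_isoIsPushout_hom _ _ po2
  choose i hi using key
  refine ⟨(S.quot E).reindex f hf, ⟨⟨fun x => (S.quot E).isoOfEq (lowerImage_Iic f x) ≪≫ i x,
    fun {x y} h => ?_⟩⟩⟩
  change S.quotM E _ ≫ S.quotM E _ ≫ _ = (S.quotM E _ ≫ _) ≫ _
  apply S.quot_ext
  simp only [Category.assoc]
  rw [S.quotMap_quotM_assoc, S.quotMap_quotM_assoc, S.quotMap_quotM_assoc, hi y,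
    ← Category.assoc (S.quotMap _ _), hi x, Category.assoc, ← hπ h, ← Category.assoc (e.e _).hom,
    ← e.he (f.monotone h), Category.assoc, S.m_comp_assoc, S.m_comp_assoc]

/-! Colimits over lower sets. -/

theorem memL {A B : LowerSet P} {p : P} (h : p ∈ A) : p ∈ A ⊔ B := LowerSet.mem_sup_iff.2 (Or.inl h)
theorem memR {A B : LowerSet P} {p : P} (h : p ∈ B) : p ∈ A ⊔ B := LowerSet.mem_sup_iff.2 (Or.inr h)
theorem memI {A B : LowerSet P} {p : P} (h : p ∈ A) (h' : p ∈ B) : p ∈ A ⊓ B :=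
  LowerSet.mem_inf_iff.2 ⟨h, h'⟩
theorem iio_le (p : P) : LowerSet.Iio p ≤ LowerSet.Iic p := fun _ h => le_of_lt h


/-- Auxiliary: a colimit of the restriction of `X` to a lower set. -/
structure Col (X : P ⥤ C) (A : LowerSet P) where
  pt : C
  ι : ∀ p, p ∈ A → (X.obj p ⟶ pt)
  w : ∀ {p q} (h : p ≤ q) (hq : q ∈ A), X.map (homOfLE h) ≫ ι q hq = ι p (A.lower h hq)
  exists_desc : ∀ {Z : C} (f : ∀ p, p ∈ A → (X.obj p ⟶ Z)),
    (∀ {p q} (h : p ≤ q) (hq : q ∈ A), X.map (homOfLE h) ≫ f q hq = f p (A.lower h hq)) →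
    ∃ g : pt ⟶ Z, ∀ p hp, ι p hp ≫ g = f p hp
  hom_ext : ∀ {Z : C} {f g : pt ⟶ Z}, (∀ p hp, ι p hp ≫ f = ι p hp ≫ g) → f = g

theorem Col.exists_m {X : P ⥤ C} {A B : LowerSet P} (c : Col X A) (d : Col X B) (h : A ≤ B) :
    ∃ g : c.pt ⟶ d.pt, ∀ p hp, c.ι p hp ≫ g = d.ι p (h hp) :=
  c.exists_desc (fun p hp => d.ι p (h hp)) (fun h' _ => d.w h' _)

/-- Auxiliary: comparison maps. -/
noncomputable def Col.m {X : P ⥤ C} {A B : LowerSet P} (c : Col X A) (d : Col X B) (h : A ≤ B) :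
    c.pt ⟶ d.pt := (c.exists_m d h).choose

theorem Col.ι_m {X : P ⥤ C} {A B : LowerSet P} (c : Col X A) (d : Col X B) (h : A ≤ B)
    (p : P) (hp : p ∈ A) : c.ι p hp ≫ c.m d h = d.ι p (h hp) :=
  (c.exists_m d h).choose_spec p hp

theorem Col.ι_m_assoc {X : P ⥤ C} {A B : LowerSet P} (c : Col X A) (d : Col X B) (h : A ≤ B)
    (p : P) (hp : p ∈ A) {Z : C} (f : d.pt ⟶ Z) :
    c.ι p hp ≫ c.m d h ≫ f = d.ι p (h hp) ≫ f := by
  rw [← Category.assoc, c.ι_m]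

theorem Col.m_comp {X : P ⥤ C} {A B E : LowerSet P} (c : Col X A) (d : Col X B) (e : Col X E)
    (h : A ≤ B) (h' : B ≤ E) : c.m d h ≫ d.m e h' = c.m e (h.trans h') :=
  c.hom_ext fun p hp => by rw [c.ι_m_assoc, d.ι_m, c.ι_m]

theorem Col.m_self {X : P ⥤ C} {A : LowerSet P} (c : Col X A) : c.m c le_rfl = 𝟙 _ :=
  c.hom_ext fun p hp => by rw [c.ι_m, Category.comp_id]

theorem Col.isPushout {X : P ⥤ C} {A B : LowerSet P} (a : Col X A) (b : Col X B)
    (c : Col X (A ⊓ B)) (d : Col X (A ⊔ B)) :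
    IsPushout (c.m a inf_le_left) (c.m b inf_le_right) (a.m d le_sup_left)
      (b.m d le_sup_right) := by
  have key : ∀ {Z : C} (f : a.pt ⟶ Z) (g : b.pt ⟶ Z),
      c.m a inf_le_left ≫ f = c.m b inf_le_right ≫ g →
      ∃ k, a.m d le_sup_left ≫ k = f ∧ b.m d le_sup_right ≫ k = g := by
    classical
    intro Z f g hfg
    have hAB : ∀ p (h1 : p ∈ A) (h2 : p ∈ B), a.ι p h1 ≫ f = b.ι p h2 ≫ g := fun p h1 h2 => by
      rw [← c.ι_m a inf_le_left p (memI h1 h2), Category.assoc, hfg, c.ι_m_assoc]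
    let k : ∀ p, p ∈ A ⊔ B → (X.obj p ⟶ Z) := fun p hp =>
      if h : p ∈ A then a.ι p h ≫ f else b.ι p ((LowerSet.mem_sup_iff.1 hp).resolve_left h) ≫ g
    have kA : ∀ p (h : p ∈ A) (hp : p ∈ A ⊔ B), k p hp = a.ι p h ≫ f := fun p h hp => dif_pos h
    have kB : ∀ p (h : p ∈ B) (hp : p ∈ A ⊔ B), k p hp = b.ι p h ≫ g := fun p h hp => by
      by_cases h' : p ∈ A
      · rw [kA p h' (memL h'), hAB p h' h]
      · exact dif_neg h'
    obtain ⟨t, ht⟩ := d.exists_desc k (fun {p q} h hq => by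
      rcases LowerSet.mem_sup_iff.1 hq with hq | hq
      · rw [kA q hq (memL hq), kA p (A.lower h hq) (memL (A.lower h hq)), ← Category.assoc, a.w]
      · rw [kB q hq (memR hq), kB p (B.lower h hq) (memR (B.lower h hq)), ← Category.assoc, b.w])
    refine ⟨t, a.hom_ext fun p hp => ?_, b.hom_ext fun p hp => ?_⟩
    · rw [a.ι_m_assoc, ht, kA p hp (memL hp)]
    · rw [b.ι_m_assoc, ht, kB p hp (memR hp)]
  have hcomm : c.m a inf_le_left ≫ a.m d le_sup_left =
      c.m b inf_le_right ≫ b.m d le_sup_right := by rw [c.m_comp, c.m_comp]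
  refine ⟨⟨hcomm⟩, ⟨PushoutCocone.IsColimit.mk _ (fun s => (key s.inl s.inr s.condition).choose)
    (fun s => (key s.inl s.inr s.condition).choose_spec.1)
    (fun s => (key s.inl s.inr s.condition).choose_spec.2) (fun s m h1 h2 => ?_)⟩⟩
  obtain ⟨e1, e2⟩ := (key s.inl s.inr s.condition).choose_spec
  refine d.hom_ext fun p hp => ?_
  rcases LowerSet.mem_sup_iff.1 hp with hp | hp
  · rw [← a.ι_m d le_sup_left p hp, Category.assoc, Category.assoc, h1, e1]
  · rw [← b.ι_m d le_sup_right p hp, Category.assoc, Category.assoc, h2, e2]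

/-- Auxiliary: colimits over principal lower sets. -/
def Col.iic (X : P ⥤ C) (p : P) : Col X (LowerSet.Iic p) where
  pt := X.obj p
  ι q hq := X.map (homOfLE hq)
  w h hq := by rw [← X.map_comp]; rfl
  exists_desc f hf := ⟨f p le_rfl, fun q hq => hf hq _⟩
  hom_ext {Z f g} h := by
    have := h p le_rfl
    have h1 : X.map (homOfLE (le_refl p)) = 𝟙 _ := X.map_id p
    rwa [h1, Category.id_comp, Category.id_comp] at this

/-- Auxiliary: colimits over unions. -/
theorem Col.nonempty_sup {X : P ⥤ C} {A B : LowerSet P} (a : Col X A) (b : Col X B)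
    (c : Col X (A ⊓ B)) {E : C} {i : a.pt ⟶ E} {j : b.pt ⟶ E}
    (po : IsPushout (c.m a inf_le_left) (c.m b inf_le_right) i j) : Nonempty (Col X (A ⊔ B)) := by
  classical
  have hAB : ∀ p (h1 : p ∈ A) (h2 : p ∈ B), a.ι p h1 ≫ i = b.ι p h2 ≫ j := fun p h1 h2 => by
    rw [← c.ι_m a inf_le_left p (memI h1 h2), Category.assoc, po.w, c.ι_m_assoc]
  let k : ∀ p, p ∈ A ⊔ B → (X.obj p ⟶ E) := fun p hp =>
    if h : p ∈ A then a.ι p h ≫ i else b.ι p ((LowerSet.mem_sup_iff.1 hp).resolve_left h) ≫ j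
  have kA : ∀ p (h : p ∈ A) (hp : p ∈ A ⊔ B), k p hp = a.ι p h ≫ i := fun p h hp => dif_pos h
  have kB : ∀ p (h : p ∈ B) (hp : p ∈ A ⊔ B), k p hp = b.ι p h ≫ j := fun p h hp => by
    by_cases h' : p ∈ A
    · rw [kA p h' (memL h'), hAB p h' h]
    · exact dif_neg h'
  refine ⟨{ pt := E, ι := k, w := ?_, exists_desc := ?_, hom_ext := ?_ }⟩
  · intro p q h hq
    rcases LowerSet.mem_sup_iff.1 hq with hq | hq
    · rw [kA q hq (memL hq), kA p (A.lower h hq) (memL (A.lower h hq)), ← Category.assoc, a.w]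
    · rw [kB q hq (memR hq), kB p (B.lower h hq) (memR (B.lower h hq)), ← Category.assoc, b.w]
  · intro Z f hf
    obtain ⟨f1, h1⟩ := a.exists_desc (fun p hp => f p (memL hp)) (fun h hq => hf h _)
    obtain ⟨f2, h2⟩ := b.exists_desc (fun p hp => f p (memR hp)) (fun h hq => hf h _)
    refine ⟨po.desc f1 f2 (c.hom_ext fun p hp => ?_), fun p hp => ?_⟩
    · rw [c.ι_m_assoc, c.ι_m_assoc, h1, h2]
    · rcases LowerSet.mem_sup_iff.1 hp with hp | hp
      · rw [kA p hp (memL hp), Category.assoc, po.inl_desc, h1]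
      · rw [kB p hp (memR hp), Category.assoc, po.inr_desc, h2]
  · intro Z f g h
    apply po.hom_ext
    · refine a.hom_ext fun p hp => ?_
      have := h p (memL hp)
      rwa [kA p hp (memL hp), Category.assoc, Category.assoc] at this
    · refine b.hom_ext fun p hp => ?_
      have := h p (memR hp)
      rwa [kB p hp (memR hp), Category.assoc, Category.assoc] at this

/-- Auxiliary: the colimit over the empty set. -/
noncomputable def Col.empty (X : P ⥤ C) : Col X ⊥ where
  pt := C.zero
  ι p hp := absurd hp (by simp)
  w h hq := absurd hq (by simp)
  exists_desc f hf := ⟨C.isZero_zero.to_ _, fun p hp => absurd hp (by simp)⟩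
  hom_ext _ := C.isZero_zero.eq_of_src _ _

theorem exists_maximal_of_ne_bot [Finite P] {A : LowerSet P} (hA : A ≠ ⊥) :
    ∃ p ∈ A, ∀ b ∈ A, p ≤ b → b = p := by
  have hne : (A : Set P).Nonempty := by
    rw [Set.nonempty_iff_ne_empty]; intro h; exact hA (SetLike.coe_injective h)
  obtain ⟨p, hp⟩ := (Set.toFinite (A : Set P)).exists_maximal hne
  exact ⟨p, hp.1, fun b hb hpb => le_antisymm (hp.2 hb hpb) hpb⟩

/-- Auxiliary: the latching condition. -/
def Latching (X : P ⥤ C) : Prop :=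
  ∀ p, ∃ c : Col X (LowerSet.Iio p), C.cof (c.m (Col.iic X p) (iio_le p))

theorem erase_inf_Iic {A : LowerSet P} {p : P} (hp : p ∈ A) :
    A.erase p ⊓ LowerSet.Iic p = LowerSet.Iio p := by
  ext y; constructor
  · rintro ⟨⟨_, h1⟩, h2⟩; exact lt_of_le_not_ge h2 h1
  · intro h; exact ⟨⟨A.lower (le_of_lt h) hp, not_le_of_gt h⟩, le_of_lt h⟩

theorem Latching.nonempty_col [Finite P] {X : P ⥤ C} (hX : Latching X) (A : LowerSet P) :
    Nonempty (Col X A) := by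
  classical
  induction A using WellFoundedLT.induction with
  | ind A ih =>
  by_cases hA : A = ⊥
  · subst hA; exact ⟨Col.empty X⟩
  · obtain ⟨p, hp, hmax⟩ := exists_maximal_of_ne_bot hA
    obtain ⟨a⟩ := ih _ (LowerSet.erase_lt.2 hp)
    obtain ⟨c, hc⟩ : ∃ c : Col X (A.erase p ⊓ LowerSet.Iic p),
        C.cof (c.m (Col.iic X p) inf_le_right) := by
      have := hX p
      revert this
      generalize_proofs h1 h2
      revert h1 h2
      rw [← erase_inf_Iic hp]
      exact fun _ _ h => h
    have := C.hasPushout _ (c.m a inf_le_left) hc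
    have po := (IsPushout.of_hasPushout (c.m (Col.iic X p) inf_le_right) (c.m a inf_le_left)).flip
    have := Col.nonempty_sup a (Col.iic X p) c po
    rwa [LowerSet.erase_sup_Iic hp hmax] at this

theorem Col.isPushout' {X : P ⥤ C} {A B E F : LowerSet P} (a : Col X A) (b : Col X B)
    (c : Col X E) (d : Col X F) (hE : E = A ⊓ B) (hF : F = A ⊔ B) (h1 : E ≤ A) (h2 : E ≤ B)
    (h3 : A ≤ F) (h4 : B ≤ F) : IsPushout (c.m a h1) (c.m b h2) (a.m d h3) (b.m d h4) := by
  subst hE hF; exact Col.isPushout a b c d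

theorem Col.cof_congr {X : P ⥤ C} {A : LowerSet P} (a a' : Col X A) {E : C} (f : a.pt ⟶ E)
    (hf : C.cof f) : C.cof (a'.m a le_rfl ≫ f) := by
  have h1 : a'.m a le_rfl ≫ a.m a' le_rfl = 𝟙 _ := a'.hom_ext fun p hp => by
    rw [a'.ι_m_assoc, a.ι_m, Category.comp_id]
  have h2 : a.m a' le_rfl ≫ a'.m a le_rfl = 𝟙 _ := a.hom_ext fun p hp => by
    rw [a.ι_m_assoc, a'.ι_m, Category.comp_id]
  have : IsIso (a'.m a le_rfl) := ⟨_, h1, h2⟩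
  exact C.cof_comp _ _ (C.cof_of_isIso _) hf

theorem Latching.cof_m [Finite P] {X : P ⥤ C} (hX : Latching X) (c : ∀ A, Col X A)
    (B A : LowerSet P) (h : A ≤ B) : C.cof ((c A).m (c B) h) := by
  classical
  induction B using WellFoundedLT.induction generalizing A with
  | ind B ih =>
  by_cases hB : B = ⊥
  · subst hB
    obtain rfl : A = ⊥ := le_bot_iff.1 h
    have : (c ⊥).m (c ⊥) h = 𝟙 _ := (c ⊥).hom_ext fun p hp => absurd hp (by simp)
    rw [this]; exact C.cof_of_isIso _
  · obtain ⟨p, hp, hmax⟩ := exists_maximal_of_ne_bot hB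
    have hlt := LowerSet.erase_lt.2 hp
    have hsup : B = B.erase p ⊔ LowerSet.Iic p := (LowerSet.erase_sup_Iic hp hmax).symm
    by_cases hpA : p ∈ A
    · have h1 : A.erase p ≤ B.erase p := fun y hy => ⟨h hy.1, hy.2⟩
      have h2 : A.erase p ≤ A := LowerSet.erase_le
      have hE : A.erase p = B.erase p ⊓ A := by
        ext y; constructor
        · exact fun hy => ⟨h1 hy, hy.1⟩
        · exact fun hy => ⟨hy.2, hy.1.2⟩
      have hF : B = B.erase p ⊔ A := by
        apply le_antisymm
        · conv_lhs => rw [hsup]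
          exact sup_le_sup le_rfl (LowerSet.Iic_le.2 hpA)
        · exact sup_le hlt.le h
      exact C.cof_pushout (Col.isPushout' (c _) (c _) (c _) (c _) hE hF h1 h2 hlt.le h)
        (ih _ hlt _ h1)
    · have h1 : A ≤ B.erase p := fun y hy => ⟨h hy, fun hpy : p ≤ y =>
        hpA (A.lower hpy hy)⟩
      rw [← (c A).m_comp (c (B.erase p)) (c B) h1 hlt.le]
      refine C.cof_comp _ _ (ih _ hlt _ h1) ?_
      have hIic : LowerSet.Iic p ≤ B := LowerSet.Iic_le.2 hp
      have hIio : LowerSet.Iio p ≤ B.erase p := by rw [← erase_inf_Iic hp]; exact inf_le_left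
      refine C.cof_pushout (Col.isPushout' (Col.iic X p) (c _) (c (LowerSet.Iio p)) (c _)
        (by rw [inf_comm, erase_inf_Iic hp]) (by rw [sup_comm]; exact hsup)
        (iio_le p) hIio hIic hlt.le) ?_
      obtain ⟨d, hd⟩ := hX p
      rw [← (c (LowerSet.Iio p)).m_comp d (Col.iic X p) le_rfl (iio_le p)]
      exact Col.cof_congr d _ _ hd

theorem Latching.isSystem [Finite P] {X : P ⥤ C} (hX : Latching X) : IsSystem X := by
  let c : ∀ A, Col X A := fun A => (hX.nonempty_col A).some
  refine ⟨
    { obj := fun A => (c A).pt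
      m := fun h => (c _).m (c _) h
      m_refl := fun h => (c _).hom_ext fun p hp => by rw [(c _).ι_m, Category.comp_id]
      m_comp := fun h h' => (c _).m_comp _ _ _ _
      bot := ?_
      cof := fun h => hX.cof_m c _ _ h
      sup := fun A B => Col.isPushout _ _ _ _ }, ⟨⟨fun p =>
        ⟨(c _).m (Col.iic X p) le_rfl, (Col.iic X p).m (c _) le_rfl, ?_, ?_⟩,
          fun {p q} h => ?_⟩⟩⟩
  · refine C.isZero_zero.of_iso ⟨(c ⊥).m (Col.empty X) le_rfl, (Col.empty X).m (c ⊥) le_rfl, ?_,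
      ?_⟩
    · exact (c ⊥).hom_ext fun p hp => absurd hp (by simp)
    · exact (Col.empty X).hom_ext fun p hp => absurd hp (by simp)
  · exact (Col.m_comp _ _ _ _ _).trans (Col.m_self _)
  · exact (Col.m_comp _ _ _ _ _).trans (Col.m_self _)
  · refine (c _).hom_ext fun r hr => ?_
    change (c _).ι r hr ≫ (c (LowerSet.Iic p)).m (c (LowerSet.Iic q)) (iic_mono h) ≫
      (c (LowerSet.Iic q)).m (Col.iic X q) le_rfl =
      (c _).ι r hr ≫ (c (LowerSet.Iic p)).m (Col.iic X p) le_rfl ≫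
      (show (Col.iic X p).pt ⟶ (Col.iic X q).pt from X.map (homOfLE h))
    rw [(c _).ι_m_assoc, (c _).ι_m_assoc, (c _).ι_m]
    exact X.map_comp (homOfLE (show r ≤ p from hr)) (homOfLE h)

theorem IsCubicallyCofibrant.isSystem {q : ℕ} {n : Fin q → ℕ} {X : Grid n ⥤ C}
    (hX : IsCubicallyCofibrant X) : IsSystem X := by
  refine Latching.isSystem fun p => ?_
  let r : Grid n := fun k => Order.pred (p k)
  have hrp : ∀ k, r k ⩿ p k := fun k => Order.pred_wcovBy (p k)
  obtain ⟨c, hc, hcof⟩ := hX.cof_cube r p hrp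
  have hr : r ≤ p := fun k => (hrp k).le
  have hlt : ∀ {y : Grid n}, y ∈ LowerSet.Iio p → y ⊔ r < p := fun {y} hy => by
    have hy : y < p := hy
    refine lt_of_le_of_ne (sup_le hy.le hr) fun h => ?_
    obtain ⟨hle, k, hk⟩ := Pi.lt_def.1 hy
    have h1 : y k ⊔ r k = p k := congrFun h k
    have h2 : r k < p k := Order.pred_lt_of_not_isMin (fun hm => absurd hk hm.not_lt)
    exact absurd h1 (ne_of_lt (max_lt hk h2))
  let s : ∀ y : Grid n, y ∈ LowerSet.Iio p → Set.Ico r p := fun y hy =>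
    ⟨y ⊔ r, le_sup_right, hlt hy⟩
  let γ : ∀ x : Set.Ico r p, X.obj x.1 ⟶ c.pt := fun x => c.ι.app x
  have hγ : ∀ (x y : Set.Ico r p) (h : x.1 ≤ y.1), X.map (homOfLE h) ≫ γ y = γ x :=
    fun x y h => c.w (homOfLE (show x ≤ y from h))
  have hγc : ∀ x : Set.Ico r p, γ x ≫ hc.desc (icoCocone X r p) = X.map (homOfLE x.2.2.le) :=
    fun x => hc.fac (icoCocone X r p) x
  have hdesc : ∀ {Z : C} (f : ∀ x : Set.Ico r p, X.obj x.1 ⟶ Z),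
      (∀ (x y : Set.Ico r p) (h : x.1 ≤ y.1), X.map (homOfLE h) ≫ f y = f x) →
      ∃ g : c.pt ⟶ Z, ∀ x, γ x ≫ g = f x := fun {Z} f hf => by
    let t : Cocone (icoRestrict X r p) :=
      { pt := Z
        ι := { app := fun x => f x
               naturality := fun x y g =>
                (hf x y (leOfHom g)).trans (Category.comp_id _).symm } }
    exact ⟨hc.desc t, fun x => hc.fac t x⟩
  have hcomp : ∀ (a b e : Grid n) (h : a ≤ b) (h' : b ≤ e),
      X.map (homOfLE h) ≫ X.map (homOfLE h') = X.map (homOfLE (h.trans h')) :=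
    fun a b e h h' => (X.map_comp (homOfLE h) (homOfLE h')).symm
  have hι : ∀ y (hy : y ∈ LowerSet.Iio p), y ≤ (s y hy).1 := fun y hy => le_sup_left
  let d : Col X (LowerSet.Iio p) :=
    { pt := c.pt
      ι := fun y hy => X.map (homOfLE (hι y hy)) ≫ γ (s y hy)
      w := fun {y z} h hz => by
        have hs : (s y ((LowerSet.Iio p).lower h hz)).1 ≤ (s z hz).1 := sup_le_sup h le_rfl
        rw [← hγ _ _ hs, ← Category.assoc, ← Category.assoc, hcomp, hcomp]
      exists_desc := fun {Z} f hf => by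
        obtain ⟨g, hg⟩ := hdesc (fun x => f x.1 x.2.2) (fun x y h => hf h y.2.2)
        refine ⟨g, fun y hy => ?_⟩
        rw [Category.assoc, hg]
        exact hf _ _
      hom_ext := fun {Z f g} h => hc.hom_ext fun x => by
        have h1 := h x.1 x.2.2
        have h2 : s x.1 x.2.2 = x := Subtype.ext (sup_eq_left.2 x.2.1)
        rw [hγ x (s x.1 x.2.2)] at h1
        exact h1 }
  refine ⟨d, ?_⟩
  have h1 : d.m (Col.iic X p) (iio_le p) = hc.desc (icoCocone X r p) := by
    refine d.hom_ext fun y hy => ?_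
    rw [Col.ι_m]
    refine Eq.trans ?_ (Category.assoc (X.map (homOfLE (hι y hy))) (γ (s y hy)) _).symm
    refine Eq.trans ?_ (congrArg (fun g => X.map (homOfLE (hι y hy)) ≫ g) (hγc (s y hy))).symm
    exact (hcomp _ _ _ _ _).symm
  rw [h1]
  exact hcof

end CofibrantSystems

/-! ### The iterated S-construction -/

/-- The poset `Ar[n]` of pairs `i ≤ j` in `[n]`, with the componentwise order. -/
def Ar (n : ℕ) : Type := {p : Fin (n + 1) × Fin (n + 1) // p.1 ≤ p.2}

namespace Ar

instance (n : ℕ) : PartialOrder (Ar n) :=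
  inferInstanceAs (PartialOrder {p : Fin (n + 1) × Fin (n + 1) // p.1 ≤ p.2})

variable {n m : ℕ}

/-- The element `(i, j)`. -/
def mk (i j : Fin (n + 1)) (h : i ≤ j) : Ar n := ⟨(i, j), h⟩

/-- The first coordinate. -/
def fst (a : Ar n) : Fin (n + 1) := a.1.1

/-- The second coordinate. -/
def snd (a : Ar n) : Fin (n + 1) := a.1.2

theorem fst_le_snd (a : Ar n) : a.fst ≤ a.snd := a.2

theorem mk_le_mk {i j i' j' : Fin (n + 1)} {h : i ≤ j} {h' : i' ≤ j'} (h₁ : i ≤ i')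
    (h₂ : j ≤ j') : mk i j h ≤ mk i' j' h' := ⟨h₁, h₂⟩

theorem fst_mono {a b : Ar n} (h : a ≤ b) : a.fst ≤ b.fst := h.1

theorem snd_mono {a b : Ar n} (h : a ≤ b) : a.snd ≤ b.snd := h.2

/-- The map induced by a monotone map. -/
def map (θ : Fin (m + 1) →o Fin (n + 1)) (a : Ar m) : Ar n :=
  mk (θ a.fst) (θ a.snd) (θ.monotone a.fst_le_snd)

theorem map_mono (θ : Fin (m + 1) →o Fin (n + 1)) {a b : Ar m} (h : a ≤ b) : map θ a ≤ map θ b :=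
  mk_le_mk (θ.monotone h.1) (θ.monotone h.2)

end Ar

/-- The poset `Ar[n₁] × ⋯ × Ar[n_q]`. -/
def ArGrid {q : ℕ} (n : Fin q → ℕ) : Type := ∀ k, Ar (n k)

namespace ArGrid

variable {q : ℕ} {n : Fin q → ℕ}

instance : PartialOrder (ArGrid n) := inferInstanceAs (PartialOrder (∀ k, Ar (n k)))

/-- Replace the `r`-th coordinate. -/
def set (y : ArGrid n) (r : Fin q) (a : Ar (n r)) : ArGrid n := Function.update y r a

theorem set_mono (y : ArGrid n) (r : Fin q) {a b : Ar (n r)} (h : a ≤ b) :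
    y.set r a ≤ y.set r b := Function.update_mono h

/-- The inclusion `(j₁, …, j_q) ↦ ((0, j₁), …, (0, j_q))`. -/
def zeroRow (n : Fin q → ℕ) : Grid n →o ArGrid n where
  toFun j k := Ar.mk 0 (j k) (Fin.zero_le _)
  monotone' _ _ h k := Ar.mk_le_mk le_rfl (h k)

end ArGrid

/-- The objects of the iterated S-construction `S⁽q⁾[n₁, …, n_q] C`. -/
structure InS {C : WaldCat.{u}} {q : ℕ} {n : Fin q → ℕ} (A : ArGrid n ⥤ C) : Prop where
  zero : ∀ y : ArGrid n, (∃ k, (y k).fst = (y k).snd) → A.obj y = C.zero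
  cof : IsCubicallyCofibrant ((ArGrid.zeroRow n).monotone.functor ⋙ A)
  pushout : ∀ (y : ArGrid n) (r : Fin q) (i j k : Fin (n r + 1)) (hij : i ≤ j) (hjk : j ≤ k),
    IsPushout
      (A.map (homOfLE (y.set_mono r (Ar.mk_le_mk le_rfl hjk :
        Ar.mk i j hij ≤ Ar.mk i k (hij.trans hjk)))))
      (A.map (homOfLE (y.set_mono r (Ar.mk_le_mk hij le_rfl :
        Ar.mk i j hij ≤ Ar.mk j j le_rfl))))
      (A.map (homOfLE (y.set_mono r (Ar.mk_le_mk hij le_rfl :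
        Ar.mk i k (hij.trans hjk) ≤ Ar.mk j k hjk))))
      (A.map (homOfLE (y.set_mono r (Ar.mk_le_mk le_rfl hjk :
        Ar.mk j j le_rfl ≤ Ar.mk j k hjk))))

section Closure

variable {C D : WaldCat.{u}} {q : ℕ} {n : Fin q → ℕ}

theorem isPushout_congr {P : Type} [PartialOrder P] (A : P ⥤ C) {a b c d a' b' c' d' : P}
    (ha : a' = a) (hb : b' = b) (hc : c' = c) (hd : d' = d)
    {h₁ : a ≤ b} {h₂ : a ≤ c} {h₃ : b ≤ d} {h₄ : c ≤ d}
    (po : IsPushout (A.map (homOfLE h₁)) (A.map (homOfLE h₂)) (A.map (homOfLE h₃))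
      (A.map (homOfLE h₄))) (h₁' : a' ≤ b') (h₂' : a' ≤ c') (h₃' : b' ≤ d') (h₄' : c' ≤ d') :
    IsPushout (A.map (homOfLE h₁')) (A.map (homOfLE h₂')) (A.map (homOfLE h₃'))
      (A.map (homOfLE h₄')) := by
  subst ha hb hc hd; exact po

theorem map_comp_le {P : Type} [PartialOrder P] (A : P ⥤ C) {a b c : P} (h : a ≤ b) (h' : b ≤ c) :
    A.map (homOfLE h) ≫ A.map (homOfLE h') = A.map (homOfLE (h.trans h')) :=
  (A.map_comp (homOfLE h) (homOfLE h')).symm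

/-- Auxiliary: equal indices have isomorphic values. -/
def isoOfEq {P : Type} [PartialOrder P] (A : P ⥤ C) {a b : P} (h : a = b) : A.obj a ≅ A.obj b where
  hom := A.map (homOfLE h.le)
  inv := A.map (homOfLE h.ge)
  hom_inv_id := (map_comp_le A _ _).trans (A.map_id a)
  inv_hom_id := (map_comp_le A _ _).trans (A.map_id b)

/-- Auxiliary: the inclusion `j ↦ (i, i ⊔ j)`. -/
noncomputable def rowAt (i : Grid n) : Grid n →o ArGrid n where
  toFun j k := Ar.mk (i k) (j k ⊔ i k) le_sup_right
  monotone' _ _ h k := Ar.mk_le_mk le_rfl (sup_le_sup (h k) le_rfl)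

theorem Ar.ext {m : ℕ} {a b : Ar m} (h : a.fst = b.fst) (h' : a.snd = b.snd) : a = b :=
  Subtype.ext (Prod.ext h h')

theorem ArGrid.ext {a b : ArGrid n} (h : ∀ k, (a k).fst = (b k).fst)
    (h' : ∀ k, (a k).snd = (b k).snd) : a = b :=
  funext fun k => Ar.ext (h k) (h' k)

theorem ArGrid.set_self (y : ArGrid n) (r : Fin q) (a : Ar (n r)) : y.set r a r = a :=
  Function.update_self _ _ _

theorem ArGrid.set_ne (y : ArGrid n) {r k : Fin q} (h : k ≠ r) (a : Ar (n r)) :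
    y.set r a k = y k :=
  Function.update_of_ne h _ _

theorem ArGrid.eq_set {y z : ArGrid n} {r : Fin q} {a : Ar (n r)} (h : z r = a)
    (h' : ∀ k, k ≠ r → z k = y k) : z = y.set r a := by
  funext k
  by_cases hk : k = r
  · subst hk; rw [ArGrid.set_self, h]
  · rw [ArGrid.set_ne _ hk, h' k hk]

theorem InS.isSystem_rowAt {A : ArGrid n ⥤ C} (hA : InS A) (i : Grid n) :
    IsSystem ((rowAt i).monotone.functor ⋙ A) := by
  classical
  let iT : Finset (Fin q) → Grid n := fun T k => if k ∈ T then i k else 0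
  suffices h : ∀ T, IsSystem ((rowAt (iT T)).monotone.functor ⋙ A) by
    have h1 : iT Finset.univ = i := funext fun k => if_pos (Finset.mem_univ k)
    have := h Finset.univ
    rwa [h1] at this
  intro T
  induction T using Finset.induction_on with
  | empty =>
    refine hA.cof.isSystem.reindex OrderHom.id (fun x x' => ⟨x ⊓ x', inf_le_left, inf_le_right,
      fun y h h' => le_inf h h'⟩) _ (fun x => isoOfEq A ?_) ?_
    · refine ArGrid.ext (fun k => ?_) (fun k => ?_)
      · exact (if_neg (Finset.notMem_empty k) : iT ∅ k = 0)
      · refine (sup_eq_left.2 ?_).symm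
        change (if k ∈ (∅ : Finset (Fin q)) then i k else 0) ≤ x k
        rw [if_neg (Finset.notMem_empty _)]; exact Fin.zero_le _
    · intro x y h
      exact (map_comp_le A _ _).trans (map_comp_le A _ _).symm
  | insert r T hr ih =>
    have hle : iT T ≤ iT (insert r T) := fun k => by
      by_cases hk : k ∈ T
      · simp [iT, hk]
      · change (if k ∈ T then i k else 0) ≤ _
        rw [if_neg hk]; exact Fin.zero_le _
    have hTr : iT T r = 0 := if_neg hr
    have hT'r : iT (insert r T) r = i r := if_pos (Finset.mem_insert_self _ _)
    have hTk : ∀ k, k ≠ r → iT T k = iT (insert r T) k := fun k hk => by simp [iT, hk]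
    let i' := iT (insert r T)
    let f : Grid n →o Grid n := ⟨fun j => j ⊔ i', fun _ _ h => sup_le_sup h le_rfl⟩
    have hf : MeetPres f := fun x x' => ⟨x ⊓ x', inf_le_left, inf_le_right, fun y h h' => by
      change y ≤ (x ⊓ x') ⊔ i'
      rw [sup_inf_right]; exact le_inf h h'⟩
    let u : Grid n := Function.update ⊤ r (i r)
    have hu : ∀ y : Grid n, y ≤ u ↔ y r ≤ i r := fun y => by
      constructor
      · intro h
        have := h r
        simp only [u, Function.update_self] at this
        exact this
      · intro h k
        by_cases hk : k = r
        · subst hk; simp only [u, Function.update_self]; exact h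
        · simp only [u]; rw [Function.update_of_ne hk]; exact le_top
    have hur : u r = i r := Function.update_self _ _ _
    have huk : ∀ k, k ≠ r → u k = ⊤ := fun k hk => Function.update_of_ne hk _ _
    let Y := (rowAt i').monotone.functor ⋙ A
    have hπle : ∀ x, rowAt (iT T) (f x) ≤ rowAt i' x := fun x k => by
      refine Ar.mk_le_mk (hle k) ?_
      change (x k ⊔ i' k) ⊔ iT T k ≤ x k ⊔ i' k
      exact sup_le le_rfl ((hle k).trans le_sup_right)
    refine ih.quot f hf (fun _ => u) (fun x => f x ⊓ u) (fun x y => le_inf_iff) (LowerSet.Iic u)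
      (fun _ _ h => h) (fun _ _ _ h => h) Y (fun x => A.map (homOfLE (hπle x))) ?_ ?_
    · intro x y h
      exact (map_comp_le A _ _).trans (map_comp_le A _ _).symm
    · intro x
      have hk0 : i r ≤ x r ⊔ i r := le_sup_right
      have po := hA.pushout (rowAt i' x) r 0 (i r) (x r ⊔ i r) (Fin.zero_le _) hk0
      have ha : rowAt (iT T) (f x ⊓ u) =
          (rowAt i' x).set r (Ar.mk 0 (i r) (Fin.zero_le _)) := by
        refine ArGrid.eq_set (Ar.ext hTr ?_) (fun k hk => Ar.ext (hTk k hk) ?_)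
        · change ((x r ⊔ i' r) ⊓ u r) ⊔ iT T r = i r
          rw [hTr, hur, show i' r = i r from hT'r, inf_eq_right.2 hk0]
          exact sup_eq_left.2 (Fin.zero_le _)
        · change ((x k ⊔ i' k) ⊓ u k) ⊔ iT T k = x k ⊔ i' k
          rw [huk k hk, inf_top_eq, hTk k hk]
          exact sup_eq_left.2 le_sup_right
      have hb : rowAt (iT T) (f x) =
          (rowAt i' x).set r (Ar.mk 0 (x r ⊔ i r) (Fin.zero_le _)) := by
        refine ArGrid.eq_set (Ar.ext hTr ?_) (fun k hk => Ar.ext (hTk k hk) ?_)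
        · change (x r ⊔ i' r) ⊔ iT T r = x r ⊔ i r
          rw [hTr, show i' r = i r from hT'r]
          exact sup_eq_left.2 (Fin.zero_le _)
        · change (x k ⊔ i' k) ⊔ iT T k = x k ⊔ i' k
          rw [hTk k hk]
          exact sup_eq_left.2 le_sup_right
      have hd : rowAt i' x = (rowAt i' x).set r (Ar.mk (i r) (x r ⊔ i r) hk0) := by
        refine ArGrid.eq_set (Ar.ext hT'r ?_) (fun k hk => rfl)
        change x r ⊔ i' r = x r ⊔ i r
        rw [show i' r = i r from hT'r]
      refine ⟨_, ?_, _, _, isPushout_congr A ha hb rfl hd po ((rowAt (iT T)).monotone inf_le_left)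
        (ha.trans_le (ArGrid.set_mono _ _ (Ar.mk_le_mk (Fin.zero_le _) le_rfl))) (hπle x)
        ((ArGrid.set_mono _ _ (Ar.mk_le_mk le_rfl hk0)).trans hd.ge)⟩
      rw [hA.zero _ ⟨r, by rw [ArGrid.set_self]; rfl⟩]; exact C.isZero_zero

theorem InS.cof_map {A : ArGrid n ⥤ C} (hA : InS A) {y z : ArGrid n} (h : y ≤ z)
    (h' : ∀ k, (y k).fst = (z k).fst) : C.cof (A.map (homOfLE h)) := by
  let i : Grid n := fun k => (y k).fst
  have h1 : ∀ w : ArGrid n, (∀ k, (w k).fst = i k) → rowAt i (fun k => (w k).snd) = w := by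
    intro w hw
    refine ArGrid.ext (fun k => (hw k).symm) (fun k => ?_)
    change (w k).snd ⊔ i k = (w k).snd
    rw [← hw k]; exact sup_eq_left.2 (w k).fst_le_snd
  have h2 := (hA.isSystem_rowAt i).cof_map
    (show (fun k => (y k).snd : Grid n) ≤ fun k => (z k).snd from fun k => Ar.snd_mono (h k))
  have key : ∀ {a b : ArGrid n} (ha : a = y) (hb : b = z) (hab : a ≤ b),
      C.cof (A.map (homOfLE hab)) → C.cof (A.map (homOfLE h)) := by
    intro a b ha hb hab hc; subst ha hb; exact hc
  exact key (h1 y fun _ => rfl) (h1 z fun k => (h' k).symm) _ h2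

theorem InS.mapExact {A : ArGrid n ⥤ C} (hA : InS A) (F : C ⥤ D) (hF : WaldCat.IsExact F) :
    InS (A ⋙ F) where
  zero y hy := (congrArg F.obj (hA.zero y hy)).trans hF.map_zero
  cof := (hA.cof.isSystem.mapExact F hF).isCubicallyCofibrant
  pushout y r i j k hij hjk := by
    refine hF.map_pushout (hA.cof_map _ fun l => ?_) (hA.pushout y r i j k hij hjk)
    by_cases hl : l = r
    · subst hl; rw [ArGrid.set_self, ArGrid.set_self]; rfl
    · rw [ArGrid.set_ne _ hl, ArGrid.set_ne _ hl]

theorem isPushout_of_isZero {A B E F : C} (hA : IsZero A) (hB : IsZero B) (hE : IsZero E)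
    (hF : IsZero F) (f : A ⟶ B) (g : A ⟶ E) (h : B ⟶ F) (k : E ⟶ F) : IsPushout f g h k := by
  have : IsIso f := ⟨⟨hB.to_ _, hA.eq_of_src _ _, hB.eq_of_src _ _⟩⟩
  have : IsIso k := ⟨⟨hF.to_ _, hE.eq_of_src _ _, hF.eq_of_src _ _⟩⟩
  exact IsPushout.of_horiz_isIso ⟨hA.eq_of_src _ _⟩

theorem InS.of_eq_zero {A : ArGrid n ⥤ C} (hA : ∀ y, A.obj y = C.zero) : InS A := by
  have h : ∀ y, IsZero (A.obj y) := fun y => by rw [hA y]; exact C.isZero_zero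
  refine ⟨fun y _ => hA y, ?_, fun y r i j k hij hjk => ?_⟩
  · exact (IsSystem.of_isZero (X := (ArGrid.zeroRow n).monotone.functor ⋙ A)
      fun p => h _).isCubicallyCofibrant
  · exact isPushout_of_isZero (h _) (h _) (h _) (h _) _ _ _ _

/-- Reindexing of `Ar[n₁] × ⋯ × Ar[n_p]` along a bijection of the factors and monotone maps. -/
def ArGrid.reindex {p : ℕ} {n' : Fin p → ℕ} (e : Fin p ≃ Fin q)
    (θ : ∀ k, Fin (n (e k) + 1) →o Fin (n' k + 1)) : ArGrid n →o ArGrid n' where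
  toFun y k := Ar.map (θ k) (y (e k))
  monotone' _ _ h k := Ar.map_mono (θ k) (h (e k))

theorem InS.comap {p : ℕ} {n' : Fin p → ℕ} {A : ArGrid n' ⥤ C} (hA : InS A) (e : Fin p ≃ Fin q)
    (θ : ∀ k, Fin (n (e k) + 1) →o Fin (n' k + 1)) :
    InS ((ArGrid.reindex e θ).monotone.functor ⋙ A) where
  zero y := fun ⟨k, hk⟩ => by
    obtain ⟨k, rfl⟩ := e.surjective k
    exact hA.zero _ ⟨k, congrArg (θ k) hk⟩
  cof := by
    let i : Grid n' := fun k => θ k 0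
    let g : Grid n →o Grid n' :=
      ⟨fun j k => θ k (j (e k)), fun _ _ h k => (θ k).monotone (h (e k))⟩
    have hg : MeetPres g := fun x x' => ⟨x ⊓ x', inf_le_left, inf_le_right, fun y h h' k => by
      change y k ≤ θ k (x (e k) ⊓ x' (e k))
      rcases le_total (x (e k)) (x' (e k)) with hx | hx
      · rw [inf_eq_left.2 hx]; exact h k
      · rw [inf_eq_right.2 hx]; exact h' k⟩
    refine ((hA.isSystem_rowAt i).reindex g hg
      ((ArGrid.zeroRow n).monotone.functor ⋙ (ArGrid.reindex e θ).monotone.functor ⋙ A)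
      (fun x => isoOfEq A ?_) ?_).isCubicallyCofibrant
    · refine ArGrid.ext (fun k => rfl) (fun k => ?_)
      exact sup_eq_left.2 ((θ k).monotone (Fin.zero_le _))
    · intro x y h
      exact (map_comp_le A _ _).trans (map_comp_le A _ _).symm
  pushout y r i j k hij hjk := by
    obtain ⟨r, rfl⟩ := e.surjective r
    have h : ∀ (i j : Fin (n (e r) + 1)) (hij : i ≤ j),
        ArGrid.reindex e θ (y.set (e r) (Ar.mk i j hij)) =
          (ArGrid.reindex e θ y).set r (Ar.mk (θ r i) (θ r j) ((θ r).monotone hij)) := by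
      intro i j hij
      refine ArGrid.eq_set ?_ (fun l hl => ?_)
      · change Ar.map (θ r) (y.set (e r) _ (e r)) = _
        rw [ArGrid.set_self]; rfl
      · change Ar.map (θ l) (y.set (e r) _ (e l)) = Ar.map (θ l) (y (e l))
        rw [ArGrid.set_ne _ (fun h => hl (e.injective h))]
    exact isPushout_congr A (h _ _ _) (h _ _ _) (h _ _ _) (h _ _ _)
      (hA.pushout (ArGrid.reindex e θ y) r (θ r i) (θ r j) (θ r k) ((θ r).monotone hij)
        ((θ r).monotone hjk)) _ _ _ _

open Classical in
/-- Extension by zero: the functor with values `X y` for `y ∈ U` and `*` for `y ∉ U`. -/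
noncomputable def extZero {T : Type} [PartialOrder T] (X : T ⥤ C) (U : Set T)
    (hU : U.OrdConnected) : T ⥤ C where
  obj y := if y ∈ U then X.obj y else C.zero
  map {y z} f :=
    if h : y ∈ U ∧ z ∈ U then eqToHom (if_pos h.1) ≫ X.map f ≫ eqToHom (if_pos h.2).symm
    else C.zeroMap _ _
  map_id y := by
    by_cases h : y ∈ U
    · rw [dif_pos ⟨h, h⟩, X.map_id, Category.id_comp, eqToHom_trans, eqToHom_refl]
    · have hz : IsZero (if y ∈ U then X.obj y else C.zero) := by
        rw [if_neg h]; exact C.isZero_zero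
      exact hz.eq_of_src _ _
  map_comp {y z w} f g := by
    by_cases hy : y ∈ U
    · by_cases hw : w ∈ U
      · have hz : z ∈ U := hU.out hy hw ⟨leOfHom f, leOfHom g⟩
        rw [dif_pos ⟨hy, hw⟩, dif_pos ⟨hy, hz⟩, dif_pos ⟨hz, hw⟩, X.map_comp]
        simp
      · have hz : IsZero (if w ∈ U then X.obj w else C.zero) := by
          rw [if_neg hw]; exact C.isZero_zero
        exact hz.eq_of_tgt _ _
    · have hz : IsZero (if y ∈ U then X.obj y else C.zero) := by
        rw [if_neg hy]; exact C.isZero_zero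
      exact hz.eq_of_src _ _

section ExtZero

variable {T : Type} [PartialOrder T] (X : T ⥤ C) (U : Set T) (hU : U.OrdConnected)

theorem extZero_pos {y : T} (h : y ∈ U) : (extZero X U hU).obj y = X.obj y := if_pos h

theorem extZero_neg {y : T} (h : y ∉ U) : (extZero X U hU).obj y = C.zero := if_neg h

theorem extZero_isZero {y : T} (h : y ∉ U) : IsZero ((extZero X U hU).obj y) := by
  rw [extZero_neg X U hU h]; exact C.isZero_zero

theorem extZero_map {y z : T} (f : y ⟶ z) (hy : y ∈ U) (hz : z ∈ U) :
    (extZero X U hU).map f = eqToHom (extZero_pos X U hU hy) ≫ X.map f ≫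
      eqToHom (extZero_pos X U hU hz).symm := dif_pos ⟨hy, hz⟩

/-- Auxiliary: values on `U`. -/
noncomputable def extZeroIso {y : T} (h : y ∈ U) : X.obj y ≅ (extZero X U hU).obj y :=
  eqToIso (extZero_pos X U hU h).symm

theorem extZeroIso_comm {y z : T} (f : y ⟶ z) (hy : y ∈ U) (hz : z ∈ U) :
    X.map f ≫ (extZeroIso X U hU hz).hom =
      (extZeroIso X U hU hy).hom ≫ (extZero X U hU).map f := by
  rw [extZero_map X U hU f hy hz]
  change _ = eqToHom (extZero_pos X U hU hy).symm ≫ _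
  rw [eqToHom_trans_assoc, eqToHom_refl, Category.id_comp]; rfl

end ExtZero

/-- The projection forgetting the last factor. -/
def ArGrid.init {n : Fin (q + 1) → ℕ} : ArGrid n →o ArGrid (fun k => n (Fin.castSucc k)) where
  toFun y k := y (Fin.castSucc k)
  monotone' _ _ h _ := h _

/-- The part of `Ar[n₁] × ⋯ × Ar[n_{q+1}]` on which the last pair is sent to `(0, 1)` by `s`. -/
def suspSet {n : Fin (q + 1) → ℕ} (s : Fin (n (Fin.last q) + 1) →o Fin 2) : Set (ArGrid n) :=
  {y | s (y (Fin.last q)).fst = 0 ∧ s (y (Fin.last q)).snd = 1}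

theorem fin2_eq_zero {a b : Fin 2} (h : a ≤ b) (hb : b = 0) : a = 0 :=
  le_antisymm (h.trans hb.le) (Fin.zero_le _)

theorem fin2_eq_one {a b : Fin 2} (h : a ≤ b) (ha : a = 1) : b = 1 :=
  le_antisymm (Fin.le_last b) (ha.ge.trans h)

theorem fin2_cases (a : Fin 2) : a = 0 ∨ a = 1 := by omega

theorem fin2_ne {a : Fin 2} (h : a = 0) (h' : a = 1) : False := by
  rw [h] at h'; exact absurd h' (by decide)

theorem suspSet_ordConnected {n : Fin (q + 1) → ℕ} (s : Fin (n (Fin.last q) + 1) →o Fin 2) :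
    (suspSet s).OrdConnected :=
  ⟨fun _ hx _ hy _ hz =>
    ⟨fin2_eq_zero (s.monotone (Ar.fst_mono (hz.2 _))) hy.1,
      fin2_eq_one (s.monotone (Ar.snd_mono (hz.1 _))) hx.2⟩⟩

theorem isPushout_extZero_pos {T : Type} [PartialOrder T] {X : T ⥤ C} {U : Set T}
    {hU : U.OrdConnected} {a b c d : T} {f : a ⟶ b} {g : a ⟶ c} {h : b ⟶ d} {k : c ⟶ d}
    (po : IsPushout (X.map f) (X.map g) (X.map h) (X.map k)) (ha : a ∈ U) (hb : b ∈ U)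
    (hc : c ∈ U) (hd : d ∈ U) :
    IsPushout ((extZero X U hU).map f) ((extZero X U hU).map g) ((extZero X U hU).map h)
      ((extZero X U hU).map k) :=
  IsPushout.of_iso po (extZeroIso X U hU ha) (extZeroIso X U hU hb) (extZeroIso X U hU hc)
    (extZeroIso X U hU hd) (extZeroIso_comm _ _ _ _ _ _) (extZeroIso_comm _ _ _ _ _ _)
    (extZeroIso_comm _ _ _ _ _ _) (extZeroIso_comm _ _ _ _ _ _)

theorem InS.susp {n : Fin (q + 1) → ℕ} {A : ArGrid (fun k => n (Fin.castSucc k)) ⥤ C}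
    (hA : InS A) (s : Fin (n (Fin.last q) + 1) →o Fin 2) :
    InS (extZero (ArGrid.init.monotone.functor ⋙ A) (suspSet s) (suspSet_ordConnected s)) where
  zero y := fun ⟨k, hk⟩ => by
    by_cases hy : y ∈ suspSet s
    · refine (extZero_pos _ _ _ hy).trans ?_
      induction k using Fin.lastCases with
      | last => exact (fin2_ne hy.1 (by rw [hk]; exact hy.2)).elim
      | cast k => exact hA.zero _ ⟨k, hk⟩
    · exact extZero_neg _ _ _ hy
  cof := by
    by_cases hU : s 0 = 0 ∧ s (Fin.last _) = 1
    · have hex : ∃ j, s j = 1 := ⟨_, hU.2⟩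
      obtain ⟨j₀, hj₀, hmin⟩ : ∃ j₀, s j₀ = 1 ∧ ∀ j, s j = 1 → j₀ ≤ j :=
        ⟨Fin.find _ hex, Fin.find_spec hex, fun j hj => Fin.find_le_of_pos hex hj⟩
      have hiff : ∀ j, s j = 1 ↔ j₀ ≤ j := fun j =>
        ⟨hmin j, fun h => fin2_eq_one (s.monotone h) hj₀⟩
      let G : Grid (fun k => n (Fin.castSucc k)) → Grid n :=
        fun p => Fin.snoc (α := fun k => Fin (n k + 1)) p j₀
      have hg1 : ∀ p, G p (Fin.last q) = j₀ := fun p =>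
        Fin.snoc_last (α := fun k => Fin (n k + 1)) j₀ p
      have hg2 : ∀ p k, G p (Fin.castSucc k) = p k := fun p k =>
        Fin.snoc_castSucc (α := fun k => Fin (n k + 1)) j₀ p k
      let g : Grid (fun k => n (Fin.castSucc k)) →o Grid n :=
        ⟨G, fun p p' h k => by
          induction k using Fin.lastCases with
          | last => exact (hg1 p).trans_le (hg1 p').ge
          | cast k => exact (hg2 p k).trans_le ((h k).trans (hg2 p' k).ge)⟩
      refine (hA.cof.isSystem.extend ((ArGrid.zeroRow n).monotone.functor ⋙
        extZero (ArGrid.init.monotone.functor ⋙ A) (suspSet s) (suspSet_ordConnected s)) g (fun y k => y (Fin.castSucc k))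
        {y | ArGrid.zeroRow n y ∈ suspSet s} (fun y hy p => ?_) (fun y hy p h => ?_)
        (fun h k => h _) (fun y hy => extZeroIso (ArGrid.init.monotone.functor ⋙ A) (suspSet s)
          (suspSet_ordConnected s) hy) (fun hy hy' h => ?_)
        (fun y hy => extZero_isZero _ _ (suspSet_ordConnected s) hy)).isCubicallyCofibrant
      · constructor
        · intro h k
          exact (hg2 p k).ge.trans (h (Fin.castSucc k))
        · intro h k
          induction k using Fin.lastCases with
          | last => exact (hg1 p).le.trans ((hiff _).1 hy.2)
          | cast k => exact (hg2 p k).le.trans (h k)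
      · exact hy ⟨hU.1, (hiff _).2 ((hg1 p).ge.trans (h (Fin.last q)))⟩
      · exact extZeroIso_comm (ArGrid.init.monotone.functor ⋙ A) (suspSet s)
          (suspSet_ordConnected s) (homOfLE ((ArGrid.zeroRow n).monotone h)) hy hy'
    · have hz : ∀ p, IsZero (((ArGrid.zeroRow n).monotone.functor ⋙
          extZero (ArGrid.init.monotone.functor ⋙ A) (suspSet s)
            (suspSet_ordConnected s)).obj p) := fun p =>
        extZero_isZero _ _ (suspSet_ordConnected s) fun hp : ArGrid.zeroRow n p ∈ suspSet s =>
          hU ⟨hp.1, fin2_eq_one (s.monotone (Fin.le_last _)) hp.2⟩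
      exact (IsSystem.of_isZero hz).isCubicallyCofibrant
  pushout y r i j k hij hjk := by
    induction r using Fin.lastCases with
    | cast r =>
      have hset : ∀ a, (y.set (Fin.castSucc r) a) (Fin.last q) = y (Fin.last q) := fun a =>
        ArGrid.set_ne _ (Fin.castSucc_lt_last r).ne' _
      have hmem : ∀ a, y.set (Fin.castSucc r) a ∈ suspSet s ↔ y ∈ suspSet s := fun a => by
        change (s (y.set _ a _).fst = 0 ∧ s (y.set _ a _).snd = 1) ↔ _
        rw [hset]; exact Iff.rfl
      by_cases hy : y ∈ suspSet s
      · have h : ∀ a, ArGrid.init (y.set (Fin.castSucc r) a) = (ArGrid.init y).set r a :=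
          fun a => ArGrid.eq_set (ArGrid.set_self y _ _) (fun l hl =>
            ArGrid.set_ne _ (fun h => hl (Fin.castSucc_injective _ h)) _)
        refine isPushout_extZero_pos ?_ ((hmem _).2 hy) ((hmem _).2 hy) ((hmem _).2 hy)
          ((hmem _).2 hy)
        exact isPushout_congr A (h _) (h _) (h _) (h _)
          (hA.pushout (ArGrid.init y) r i j k hij hjk) _ _ _ _
      · have h : ∀ a, IsZero ((extZero (ArGrid.init.monotone.functor ⋙ A) (suspSet s)
          (suspSet_ordConnected s)).obj (y.set (Fin.castSucc r) a)) := fun a =>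
            extZero_isZero _ _ _ fun h => hy ((hmem _).1 h)
        exact isPushout_of_isZero (h _) (h _) (h _) (h _) _ _ _ _
    | last =>
      have hmem : ∀ i j hij, y.set (Fin.last q) (Ar.mk i j hij) ∈ suspSet s ↔
          s i = 0 ∧ s j = 1 := fun i j hij => by
        change (s (y.set _ _ _).fst = 0 ∧ s (y.set _ _ _).snd = 1) ↔ _
        rw [ArGrid.set_self]; exact Iff.rfl
      have hz := fun i j (hij : i ≤ j) (h : ¬ (s i = 0 ∧ s j = 1)) => extZero_isZero (ArGrid.init.monotone.functor ⋙ A) (suspSet s)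
        (suspSet_ordConnected s) (fun hm => h ((hmem i j hij).1 hm))
      have hinit : ∀ a, ArGrid.init (y.set (Fin.last q) a) = ArGrid.init y := fun a =>
        funext fun l => ArGrid.set_ne y (Fin.castSucc_lt_last l).ne a
      have hiso : ∀ {i j i' j' : Fin (n (Fin.last q) + 1)} (hij : i ≤ j) (hij' : i' ≤ j')
          (h : y.set (Fin.last q) (Ar.mk i j hij) ≤ y.set (Fin.last q) (Ar.mk i' j' hij')),
          (s i = 0 ∧ s j = 1) → (s i' = 0 ∧ s j' = 1) →
          IsIso ((extZero (ArGrid.init.monotone.functor ⋙ A) (suspSet s)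
            (suspSet_ordConnected s)).map (homOfLE h)) := by
        intro i j i' j' hij hij' h hs hs'
        rw [extZero_map _ _ _ _ ((hmem _ _ _).2 hs) ((hmem _ _ _).2 hs')]
        have : IsIso ((ArGrid.init.monotone.functor ⋙ A).map (homOfLE h)) :=
          (isoOfEq A ((hinit (Ar.mk i j hij)).trans (hinit (Ar.mk i' j' hij')).symm)).isIso_hom
        infer_instance
      have hjj : ¬ (s j = 0 ∧ s j = 1) := fun h => fin2_ne h.1 h.2
      have comm : ∀ {a b c d : ArGrid n} {h₁ : a ≤ b} {h₂ : a ≤ c} {h₃ : b ≤ d} {h₄ : c ≤ d}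
          (F : ArGrid n ⥤ C), F.map (homOfLE h₁) ≫ F.map (homOfLE h₃) =
            F.map (homOfLE h₂) ≫ F.map (homOfLE h₄) := fun F =>
        (map_comp_le F _ _).trans (map_comp_le F _ _).symm
      rcases fin2_cases (s i) with h0 | h0
      · rcases fin2_cases (s j) with h1 | h1
        · have h2 := hz i j hij fun h => fin2_ne h1 h.2
          have := hz j j le_rfl hjj
          by_cases h3 : s k = 1
          · have := hiso (hij.trans hjk) hjk (y.set_mono _ (Ar.mk_le_mk hij le_rfl)) ⟨h0, h3⟩
              ⟨h1, h3⟩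
            have : IsIso ((extZero (ArGrid.init.monotone.functor ⋙ A) (suspSet s)
              (suspSet_ordConnected s)).map (homOfLE (y.set_mono (Fin.last q)
                (Ar.mk_le_mk hij le_rfl : Ar.mk i j hij ≤ Ar.mk j j le_rfl)))) :=
              ⟨⟨(hz j j le_rfl hjj).to_ _, h2.eq_of_src _ _, (hz j j le_rfl hjj).eq_of_src _ _⟩⟩
            exact IsPushout.of_vert_isIso ⟨comm _⟩
          · exact isPushout_of_isZero h2 (hz _ _ _ fun h => h3 h.2) (hz _ _ _ hjj)
              (hz _ _ _ fun h => h3 h.2) _ _ _ _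
        · have h2 := hz j k hjk fun h => fin2_ne h.1 h1
          have h3 := fin2_eq_one (s.monotone hjk) h1
          have := hiso hij (hij.trans hjk) (y.set_mono _ (Ar.mk_le_mk le_rfl hjk)) ⟨h0, h1⟩
              ⟨h0, h3⟩
          have : IsIso ((extZero (ArGrid.init.monotone.functor ⋙ A) (suspSet s)
              (suspSet_ordConnected s)).map (homOfLE (y.set_mono (Fin.last q)
                (Ar.mk_le_mk le_rfl hjk : Ar.mk j j le_rfl ≤ Ar.mk j k hjk)))) :=
              ⟨⟨h2.to_ _, (hz j j le_rfl hjj).eq_of_src _ _, h2.eq_of_src _ _⟩⟩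
          exact IsPushout.of_horiz_isIso ⟨comm _⟩
      · have hj := fin2_eq_one (s.monotone hij) h0
        exact isPushout_of_isZero (hz _ _ _ fun h => fin2_ne h.1 h0)
          (hz _ _ _ fun h => fin2_ne h.1 h0) (hz _ _ _ hjj) (hz _ _ _ fun h => fin2_ne h.1 hj)
          _ _ _ _

end Closure

/-! ### Symmetric spectra -/

/-- Pointed simplicial sets. -/
structure PSSet : Type (u + 1) where
  X : SSet.{u}
  pt : ∀ n, X.obj n
  map_pt : ∀ {n m : SimplexCategoryᵒᵖ} (θ : n ⟶ m), X.map θ (pt n) = pt m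

namespace PSSet

/-- The set of simplices in a given degree. -/
abbrev S (Y : PSSet.{u}) (n : SimplexCategoryᵒᵖ) : Type u := Y.X.obj n

end PSSet

/-- The monotone map underlying a simplicial operator. -/
abbrev simpOp {n m : SimplexCategoryᵒᵖ} (θ : n ⟶ m) :
    Fin (m.unop.len + 1) →o Fin (n.unop.len + 1) := θ.unop.toOrderHom

/-- The simplices of `Δ[1]`.  The simplicial circle is the quotient of `Δ[1]` which identifies all
constant simplices with the base point. -/
abbrev IntervalSimplex (n : SimplexCategoryᵒᵖ) : Type := Fin (n.unop.len + 1) →o Fin 2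

/-- The constant simplices of `Δ[1]`. -/
def IntervalSimplex.IsConst {n : SimplexCategoryᵒᵖ} (s : IntervalSimplex n) : Prop := ∀ i j, s i = s j

/-- The data of a symmetric spectrum (of simplicial sets): pointed simplicial sets, actions of
bijections, and suspension maps, written on the level of simplices. -/
structure SymSpectrumData : Type (u + 1) where
  level : ℕ → PSSet.{u}
  /-- A bijection of `Fin p` with `Fin q` (whence `p = q`) acts; this is the action of the
  symmetric groups. -/
  act : ∀ {p q : ℕ} (_ : Fin p ≃ Fin q) {n : SimplexCategoryᵒᵖ}, (level p).S n → (level q).S n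
  /-- The suspension map, as a map on the product with `Δ[1]`. -/
  susp : ∀ {q : ℕ} {n : SimplexCategoryᵒᵖ}, (level q).S n → IntervalSimplex n → (level (q + 1)).S n

namespace SymSpectrumData

/-- The iterated suspension map. -/
def suspIter (A : SymSpectrumData.{u}) : ∀ (p : ℕ) {q : ℕ} {n : SimplexCategoryᵒᵖ},
    (A.level q).S n → (Fin p → IntervalSimplex n) → (A.level (q + p)).S n
  | 0, _, _, x, _ => x
  | p + 1, _, _, x, s =>
    A.susp (A.suspIter p x fun k => s (Fin.castSucc k)) (s (Fin.last p))

end SymSpectrumData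

/-- The block sum of two bijections. -/
def blockSum {p q p' q' : ℕ} (e : Fin p ≃ Fin q) (e' : Fin p' ≃ Fin q') :
    Fin (p + p') ≃ Fin (q + q') :=
  finSumFinEquiv.symm.trans ((e.sumCongr e').trans finSumFinEquiv)

/-- Symmetric spectra (of simplicial sets): the structure maps are pointed simplicial maps out of
the smash product with the circle, and the iterated structure maps
`A q ∧ S¹ ∧ ⋯ ∧ S¹ ⟶ A (q + p)` are equivariant for the product of the symmetric groups. -/
structure SymSpectrum : Type (u + 1) extends SymSpectrumData.{u} where
  act_map : ∀ {p q : ℕ} (e : Fin p ≃ Fin q) {n m : SimplexCategoryᵒᵖ} (θ : n ⟶ m)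
    (x : (level p).S n), (level q).X.map θ (act e x) = act e ((level p).X.map θ x)
  act_pt : ∀ {p q : ℕ} (e : Fin p ≃ Fin q) (n : SimplexCategoryᵒᵖ),
    act e ((level p).pt n) = (level q).pt n
  act_refl : ∀ {p : ℕ} {n : SimplexCategoryᵒᵖ} (x : (level p).S n), act (Equiv.refl _) x = x
  act_trans : ∀ {p q r : ℕ} (e : Fin p ≃ Fin q) (e' : Fin q ≃ Fin r) {n : SimplexCategoryᵒᵖ}
    (x : (level p).S n), act (e.trans e') x = act e' (act e x)
  susp_map : ∀ {q : ℕ} {n m : SimplexCategoryᵒᵖ} (θ : n ⟶ m) (x : (level q).S n)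
    (s : IntervalSimplex n),
    (level (q + 1)).X.map θ (susp x s) = susp ((level q).X.map θ x) (s.comp (simpOp θ))
  susp_pt : ∀ {q : ℕ} {n : SimplexCategoryᵒᵖ} (s : IntervalSimplex n),
    susp ((level q).pt n) s = (level (q + 1)).pt n
  susp_const : ∀ {q : ℕ} {n : SimplexCategoryᵒᵖ} (x : (level q).S n) (s : IntervalSimplex n),
    s.IsConst → susp x s = (level (q + 1)).pt n
  susp_act : ∀ (p : ℕ) {q q' : ℕ} (e : Fin q ≃ Fin q') (σ : Equiv.Perm (Fin p))
    {n : SimplexCategoryᵒᵖ} (x : (level q).S n) (s : Fin p → IntervalSimplex n),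
    toSymSpectrumData.suspIter p (act e x) (fun k => s (σ.symm k)) =
      act (blockSum e σ) (toSymSpectrumData.suspIter p x s)

namespace SymSpectrum

/-- Maps of symmetric spectra. -/
@[ext]
structure Hom (A B : SymSpectrum.{u}) : Type u where
  app : ∀ (q : ℕ) (n : SimplexCategoryᵒᵖ), (A.level q).S n → (B.level q).S n
  app_map : ∀ {q : ℕ} {n m : SimplexCategoryᵒᵖ} (θ : n ⟶ m) (x : (A.level q).S n),
    app q m ((A.level q).X.map θ x) = (B.level q).X.map θ (app q n x)
  app_pt : ∀ {q : ℕ} {n : SimplexCategoryᵒᵖ}, app q n ((A.level q).pt n) = (B.level q).pt n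
  app_act : ∀ {p q : ℕ} (e : Fin p ≃ Fin q) {n : SimplexCategoryᵒᵖ} (x : (A.level p).S n),
    app q n (A.act e x) = B.act e (app p n x)
  app_susp : ∀ {q : ℕ} {n : SimplexCategoryᵒᵖ} (x : (A.level q).S n) (s : IntervalSimplex n),
    app (q + 1) n (A.susp x s) = B.susp (app q n x) s

instance : Category.{u} SymSpectrum.{u} where
  Hom := Hom
  id A :=
    { app := fun _ _ x => x
      app_map := fun _ _ => rfl
      app_pt := rfl
      app_act := fun _ _ _ => rfl
      app_susp := fun _ _ => rfl }
  comp f g :=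
    { app := fun q n x => g.app q n (f.app q n x)
      app_map := fun θ x => by rw [f.app_map, g.app_map]
      app_pt := (congrArg _ f.app_pt).trans g.app_pt
      app_act := fun e _ x => by rw [f.app_act, g.app_act]
      app_susp := fun x s => by rw [f.app_susp, g.app_susp] }

end SymSpectrum

/-! ### The K-theory spectrum -/

namespace WaldCat

/-- Exact functors as morphisms of Waldhausen categories. -/
@[ext]
structure Hom (C D : WaldCat.{u}) : Type u where
  functor : C ⥤ D
  exact : IsExact functor

theorem IsExact.id (C : WaldCat.{u}) : IsExact (𝟭 C) :=
  ⟨rfl, fun _ h => h, fun _ h => h, fun _ h => h⟩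

theorem IsExact.comp {C D E : WaldCat.{u}} {F : C ⥤ D} {G : D ⥤ E} (hF : IsExact F)
    (hG : IsExact G) : IsExact (F ⋙ G) :=
  ⟨(congrArg G.obj hF.map_zero).trans hG.map_zero, fun _ h => hG.map_cof _ (hF.map_cof _ h),
    fun _ h => hG.map_weq _ (hF.map_weq _ h),
    fun h h' => hG.map_pushout (hF.map_cof _ h) (hF.map_pushout h h')⟩

instance : Category.{u} WaldCat.{u} where
  Hom := Hom
  id C := ⟨𝟭 C, IsExact.id C⟩
  comp F G := ⟨F.functor ⋙ G.functor, F.exact.comp G.exact⟩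

end WaldCat

/-- The poset `[m] × Ar[m] × ⋯ × Ar[m]`. -/
def KShape (q m : ℕ) : Type := Fin (m + 1) × ArGrid fun _ : Fin q => m

namespace KShape

variable {p q r m m' : ℕ}

instance : PartialOrder (KShape q m) :=
  inferInstanceAs (PartialOrder (Fin (m + 1) × ArGrid fun _ : Fin q => m))

/-- The inclusion at a fixed first coordinate. -/
def slice (t : Fin (m + 1)) : (ArGrid fun _ : Fin q => m) →o KShape q m where
  toFun y := (t, y)
  monotone' _ _ h := ⟨le_rfl, h⟩

/-- The map induced by a monotone map `θ` and a map `f` of index sets (in the opposite direction):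
`(t, y) ↦ (θ t, k ↦ θ (y (f k)))`. -/
def map (θ : Fin (m' + 1) →o Fin (m + 1)) (f : Fin p → Fin q) : KShape q m' →o KShape p m where
  toFun a := (θ a.1, fun k => Ar.map θ (a.2 (f k)))
  monotone' _ _ h := ⟨θ.monotone h.1, fun k => Ar.map_mono θ (h.2 (f k))⟩

end KShape

/-- The `m`-simplices of the diagonal of the multisimplicial set `N_• w S⁽q⁾_• C`: chains of `m`
weak equivalences between objects of `S⁽q⁾[m, …, m] C`, regarded as functors on
`[m] × Ar[m] × ⋯ × Ar[m]`. -/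
@[ext]
structure KSimp (C : WaldCat.{u}) (q m : ℕ) : Type u where
  F : KShape q m ⥤ C
  inS : ∀ t, InS ((KShape.slice t).monotone.functor ⋙ F)
  weq : ∀ (t t' : Fin (m + 1)) (h : t ≤ t') (y : ArGrid fun _ : Fin q => m),
    C.weq (F.map (homOfLE (show (KShape.slice t y) ≤ KShape.slice t' y from ⟨h, le_rfl⟩)))

namespace KSimp

variable {C D : WaldCat.{u}} {p q m m' : ℕ}

/-- The base point. -/
def pt (C : WaldCat.{u}) (q m : ℕ) : KSimp C q m where
  F := (Functor.const _).obj C.zero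
  inS _ := InS.of_eq_zero fun _ => rfl
  weq _ _ _ _ := C.weq_of_isIso (𝟙 C.zero)

/-- Simplicial operators. -/
def op (X : KSimp C q m) (θ : Fin (m' + 1) →o Fin (m + 1)) : KSimp C q m' where
  F := (KShape.map θ id).monotone.functor ⋙ X.F
  inS t := (X.inS (θ t)).comap (n := fun _ => m') (Equiv.refl _) (fun _ => θ)
  weq t t' h _ := X.weq (θ t) (θ t') (θ.monotone h) _

/-- Permutation of the simplicial directions. -/
def act (X : KSimp C p m) (e : Fin p ≃ Fin q) : KSimp C q m where
  F := (KShape.map OrderHom.id e).monotone.functor ⋙ X.F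
  inS t := (X.inS t).comap (n := fun _ => m) e (fun _ => OrderHom.id)
  weq t t' h _ := X.weq t t' h _

theorem suspSet_ordConnected (s : Fin (m + 1) →o Fin 2) :
    {a : KShape (q + 1) m | a.2 ∈ suspSet (n := fun _ => m) s}.OrdConnected :=
  ⟨fun _ hx _ hy _ hz => (_root_.suspSet_ordConnected (n := fun _ : Fin (q + 1) => m) s).out hx hy
    ⟨hz.1.2, hz.2.2⟩⟩

/-- The suspension by a simplex `s : [m] ⟶ [1]`: the value at `(t, y₁, …, y_{q+1})` is the value
of `X` at `(t, y₁, …, y_q)` if `s` sends `y_{q+1}` to `(0, 1)`, and `*` otherwise. -/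
noncomputable def susp (X : KSimp C q m) (s : Fin (m + 1) →o Fin 2) : KSimp C (q + 1) m where
  F := extZero ((KShape.map OrderHom.id Fin.castSucc).monotone.functor ⋙ X.F) _
    (suspSet_ordConnected s)
  inS t := (X.inS t).susp (n := fun _ => m) s
  weq t t' h y := by
    by_cases hy : y ∈ suspSet (n := fun _ => m) s
    · rw [extZero_map _ _ (suspSet_ordConnected s) _ hy hy]
      exact C.weq_comp _ _ (C.weq_of_isIso _) (C.weq_comp _ _
        (X.weq t t' h (ArGrid.init (n := fun _ => m) y)) (C.weq_of_isIso _))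
    · have h1 := extZero_isZero ((KShape.map OrderHom.id Fin.castSucc).monotone.functor ⋙ X.F) _
        (suspSet_ordConnected s) (y := KShape.slice t y) hy
      have h2 := extZero_isZero ((KShape.map OrderHom.id Fin.castSucc).monotone.functor ⋙ X.F) _
        (suspSet_ordConnected s) (y := KShape.slice t' y) hy
      have := (⟨⟨h2.to_ _, h1.eq_of_src _ _, h2.eq_of_src _ _⟩⟩ : IsIso ((extZero
        ((KShape.map OrderHom.id Fin.castSucc).monotone.functor ⋙ X.F) _
        (suspSet_ordConnected s)).map (homOfLE (show (KShape.slice t y) ≤ KShape.slice t' y from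
          ⟨h, le_rfl⟩))))
      exact C.weq_of_isIso _

/-- The effect of an exact functor. -/
def mapExact (X : KSimp C q m) (G : C ⥤ D) (hG : WaldCat.IsExact G) : KSimp D q m where
  F := X.F ⋙ G
  inS t := (X.inS t).mapExact G hG
  weq t t' h y := hG.map_weq _ (X.weq t t' h y)

end KSimp

/-- Auxiliary: the defining properties of the extension by zero. -/
structure IsExtZero {C : WaldCat.{u}} {T : Type} [PartialOrder T] (F X : T ⥤ C) (U : Set T) :
    Prop where
  pos : ∀ y ∈ U, F.obj y = X.obj y
  neg : ∀ y ∉ U, F.obj y = C.zero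
  map : ∀ {y z : T} (f : y ⟶ z), y ∈ U → z ∈ U → HEq (F.map f) (X.map f)

section IsExtZero

variable {C D : WaldCat.{u}} {T T' : Type} [PartialOrder T] [PartialOrder T']

theorem isExtZero_extZero (X : T ⥤ C) (U : Set T) (hU : U.OrdConnected) :
    IsExtZero (extZero X U hU) X U := by
  refine ⟨fun y h => extZero_pos X U hU h, fun y h => extZero_neg X U hU h, fun f hy hz => ?_⟩
  rw [extZero_map X U hU f hy hz]
  simp

theorem IsExtZero.unique {F F' X : T ⥤ C} {U : Set T} (h : IsExtZero F X U)
    (h' : IsExtZero F' X U) : F = F' := by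
  have hobj : ∀ y, F.obj y = F'.obj y := fun y => by
    by_cases hy : y ∈ U
    · rw [h.pos y hy, h'.pos y hy]
    · rw [h.neg y hy, h'.neg y hy]
  refine Functor.hext hobj fun y z f => ?_
  have hzero : ∀ {A A' B B' : C} (f : A ⟶ B) (g : A' ⟶ B'), A = A' → B = B' →
      (A = C.zero ∨ B = C.zero) → HEq f g := by
    intro A A' B B' f g hA hB h0
    subst hA hB
    rcases h0 with h0 | h0
    · subst h0; exact heq_of_eq (C.isZero_zero.eq_of_src _ _)
    · subst h0; exact heq_of_eq (C.isZero_zero.eq_of_tgt _ _)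
  by_cases hy : y ∈ U
  · by_cases hz : z ∈ U
    · exact (h.map f hy hz).trans (h'.map f hy hz).symm
    · exact hzero _ _ (hobj y) (hobj z) (Or.inr (h.neg z hz))
  · exact hzero _ _ (hobj y) (hobj z) (Or.inl (h.neg y hy))

theorem IsExtZero.precomp {F X : T ⥤ C} {U : Set T} (h : IsExtZero F X U) (g : T' →o T) :
    IsExtZero (g.monotone.functor ⋙ F) (g.monotone.functor ⋙ X) {y | g y ∈ U} :=
  ⟨fun _ hy => h.pos _ hy, fun _ hy => h.neg _ hy, fun _ hy hz => h.map _ hy hz⟩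

theorem IsExtZero.trans {F G X : T ⥤ C} {U V : Set T} (h : IsExtZero F G U)
    (h' : IsExtZero G X V) : IsExtZero F X {y | y ∈ V ∧ y ∈ U} := by
  refine ⟨fun y hy => (h.pos y hy.2).trans (h'.pos y hy.1), fun y hy => ?_,
    fun f hy hz => (h.map f hy.2 hz.2).trans (h'.map f hy.1 hz.1)⟩
  by_cases hU : y ∈ U
  · exact (h.pos y hU).trans (h'.neg y fun hV => hy ⟨hV, hU⟩)
  · exact h.neg y hU

theorem functor_map_heq {A B : Type u} [SmallCategory A] [SmallCategory B] (G : A ⥤ B)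
    {a b a' b' : A} {f : a ⟶ b} {g : a' ⟶ b'} (ha : a = a') (hb : b = b') (h : HEq f g) :
    HEq (G.map f) (G.map g) := by
  subst ha hb; cases h; rfl

theorem IsExtZero.postcomp {F X : T ⥤ C} {U : Set T} (h : IsExtZero F X U) (G : C ⥤ D)
    (hG : WaldCat.IsExact G) : IsExtZero (F ⋙ G) (X ⋙ G) U :=
  ⟨fun _ hy => congrArg G.obj (h.pos _ hy),
    fun _ hy => (congrArg G.obj (h.neg _ hy)).trans hG.map_zero,
    fun f hy hz => functor_map_heq G (h.pos _ hy) (h.pos _ hz) (h.map f hy hz)⟩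

end IsExtZero

/-- The pointed simplicial set `KC(q)`. -/
def kLevel (C : WaldCat.{u}) (q : ℕ) : PSSet.{u} where
  X :=
    { obj := fun n => KSimp C q n.unop.len
      map := fun θ => ↾ fun X => X.op (simpOp θ)
      map_id := fun _ => rfl
      map_comp := fun _ _ => rfl }
  pt n := KSimp.pt C q n.unop.len
  map_pt _ := rfl

/-- The data of the K-theory spectrum. -/
noncomputable def kSpectrumData (C : WaldCat.{u}) : SymSpectrumData.{u} where
  level := kLevel C
  act e _ X := KSimp.act X e
  susp X s := KSimp.susp X s

/-- The functor underlying a simplex of the K-theory spectrum. -/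
def kFunctor {C : WaldCat.{u}} {q : ℕ} {n : SimplexCategoryᵒᵖ}
    (X : ((kSpectrumData C).level q).S n) : KShape q n.unop.len ⥤ C := KSimp.F X

theorem isExtZero_suspIter (C : WaldCat.{u}) (p : ℕ) {q : ℕ} {n : SimplexCategoryᵒᵖ}
    (X : ((kSpectrumData C).level q).S n) (s : Fin p → IntervalSimplex n) :
    IsExtZero (kFunctor ((kSpectrumData C).suspIter p X s))
      ((KShape.map OrderHom.id (Fin.castAdd p)).monotone.functor ⋙ kFunctor X)
      {a | ∀ k, s k (a.2 (Fin.natAdd q k)).fst = 0 ∧ s k (a.2 (Fin.natAdd q k)).snd = 1} := by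
  induction p with
  | zero => exact ⟨fun _ _ => rfl, fun y hy => (hy fun k => k.elim0).elim, fun _ _ _ => HEq.rfl⟩
  | succ p ih =>
    have h1 := ih fun k => s (Fin.castSucc k)
    have h2 := isExtZero_extZero ((KShape.map OrderHom.id Fin.castSucc).monotone.functor ⋙
      kFunctor ((kSpectrumData C).suspIter p X fun k => s (Fin.castSucc k))) _
      (KSimp.suspSet_ordConnected (s (Fin.last p)))
    have h3 := h2.trans (h1.precomp (KShape.map OrderHom.id Fin.castSucc))
    refine ⟨fun y hy => h3.pos y ?_, fun y hy => h3.neg y ?_, fun f hy hz => h3.map f ?_ ?_⟩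
    · exact ⟨fun k => hy (Fin.castSucc k), hy (Fin.last p)⟩
    · intro h
      refine hy fun k => ?_
      induction k using Fin.lastCases with
      | last => exact h.2
      | cast k => exact h.1 k
    · exact ⟨fun k => hy (Fin.castSucc k), hy (Fin.last p)⟩
    · exact ⟨fun k => hz (Fin.castSucc k), hz (Fin.last p)⟩

/-- The K-theory symmetric spectrum of a Waldhausen category. -/
noncomputable def kSpectrum (C : WaldCat.{u}) : SymSpectrum.{u} where
  toSymSpectrumData := kSpectrumData C
  act_map _ _ _ _ _ := rfl
  act_pt _ _ := rfl
  act_refl _ := rfl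
  act_trans _ _ _ _ := rfl
  susp_map _ _ _ := rfl
  susp_pt {q n} s := by
    refine KSimp.ext (IsExtZero.unique (isExtZero_extZero _ _
      (KSimp.suspSet_ordConnected s)) ⟨fun _ _ => rfl, fun _ _ => rfl, fun _ _ _ => HEq.rfl⟩)
  susp_const {q n} X s hs := by
    refine KSimp.ext (IsExtZero.unique (isExtZero_extZero _ _
      (KSimp.suspSet_ordConnected s)) ⟨fun _ hy => ?_, fun _ _ => rfl, fun _ hy _ => ?_⟩)
    · exact (fin2_ne hy.1 ((hs _ _).trans hy.2)).elim
    · exact (fin2_ne hy.1 ((hs _ _).trans hy.2)).elim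
  susp_act p {q q'} e σ {n} X s := by
    have hl : ∀ k, blockSum e σ (Fin.castAdd p k) = Fin.castAdd p (e k) := fun k => by
      simp [blockSum]
    have hr : ∀ k, blockSum e σ (Fin.natAdd q k) = Fin.natAdd q' (σ k) := fun k => by
      simp [blockSum]
    have h1 := isExtZero_suspIter C p ((kSpectrumData C).act e X) fun k => s (σ.symm k)
    have h2 := (isExtZero_suspIter C p X s).precomp (KShape.map OrderHom.id (blockSum e σ))
    have h3 : KShape.map (m' := n.unop.len) OrderHom.id (fun k => blockSum e σ (Fin.castAdd p k)) =
        KShape.map OrderHom.id (fun k => Fin.castAdd p (e k)) := by simp only [hl]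
    have h4 : {a : KShape (q' + p) n.unop.len | ∀ k, s k (a.2 (blockSum e σ (Fin.natAdd q k))).fst
        = 0 ∧ s k (a.2 (blockSum e σ (Fin.natAdd q k))).snd = 1} = {a | ∀ k,
        s (σ.symm k) (a.2 (Fin.natAdd q' k)).fst = 0 ∧
          s (σ.symm k) (a.2 (Fin.natAdd q' k)).snd = 1} := by
      ext a
      let W : Fin p → Fin (q' + p) → Prop := fun l b =>
        s l (a.2 b).fst = 0 ∧ s l (a.2 b).snd = 1
      refine ⟨fun h k => Eq.mp (congrArg (W (σ.symm k)) ?_) (h (σ.symm k)),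
        fun h k => Eq.mp (congrArg₂ W (σ.symm_apply_apply k) (hr k).symm) (h (σ k))⟩
      exact (hr _).trans (congrArg _ (σ.apply_symm_apply k))
    have h5 : IsExtZero ((KShape.map OrderHom.id (blockSum e σ)).monotone.functor ⋙
        kFunctor ((kSpectrumData C).suspIter p X s))
        ((KShape.map OrderHom.id fun k => blockSum e σ (Fin.castAdd p k)).monotone.functor ⋙
          kFunctor X) {a | ∀ k, s k (a.2 (blockSum e σ (Fin.natAdd q k))).fst
        = 0 ∧ s k (a.2 (blockSum e σ (Fin.natAdd q k))).snd = 1} := h2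
    rw [h4] at h5
    have h6 : (KShape.map OrderHom.id fun k => blockSum e σ (Fin.castAdd p k)).monotone.functor ⋙
          kFunctor X = (KShape.map OrderHom.id (Fin.castAdd p)).monotone.functor ⋙
          kFunctor ((kSpectrumData C).act e X) :=
      congrArg (fun g : KShape (q' + p) n.unop.len →o KShape q n.unop.len =>
        g.monotone.functor ⋙ kFunctor X) h3
    rw [h6] at h5
    exact KSimp.ext (h1.unique h5)

/-- Waldhausen's K-theory functor. -/
noncomputable def KTheory : WaldCat.{u} ⥤ SymSpectrum.{u} where
  obj := kSpectrum
  map {C D} G :=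
    { app := fun q n X => KSimp.mapExact X G.functor G.exact
      app_map := fun _ _ => rfl
      app_pt := fun {q n} => by
        refine KSimp.ext (IsExtZero.unique (U := ∅) (X := (Functor.const _).obj D.zero)
          ⟨fun _ _ => ?_, fun _ _ => G.exact.map_zero, fun _ h => h.elim⟩
          ⟨fun _ _ => rfl, fun _ _ => rfl, fun _ h => h.elim⟩)
        exact G.exact.map_zero
      app_act := fun _ _ _ => rfl
      app_susp := fun X s => KSimp.ext
        (((isExtZero_extZero _ _ (KSimp.suspSet_ordConnected s)).postcomp G.functor
          G.exact).unique (isExtZero_extZero _ _ (KSimp.suspSet_ordConnected s))) }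
  map_id _ := rfl
  map_comp _ _ := rfl

/-! ### Smash products -/

theorem SymSpectrum.suspIter_map (A : SymSpectrum.{u}) (p : ℕ) {q : ℕ} {n m : SimplexCategoryᵒᵖ}
    (θ : n ⟶ m) (x : (A.level q).S n) (s : Fin p → IntervalSimplex n) :
    (A.level (q + p)).X.map θ (A.suspIter p x s) =
      A.suspIter p ((A.level q).X.map θ x) fun k => (s k).comp (simpOp θ) := by
  induction p with
  | zero => rfl
  | succ p ih => exact (A.susp_map θ _ _).trans (congrArg (fun z => A.susp z _) (ih _))

theorem IntervalSimplex.IsConst.comp {n m : SimplexCategoryᵒᵖ} {s : IntervalSimplex n}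
    (hs : s.IsConst) (θ : n ⟶ m) : IntervalSimplex.IsConst (s.comp (simpOp θ)) :=
  fun _ _ => hs _ _

section Smash

variable {k : ℕ} (A : Fin k → SymSpectrum.{u})

/-- A representative of a simplex of the `n`-th space of the smash product `A₁ ∧ ⋯ ∧ A_k`:
simplices `a i` of `A i (q i)`, an injection `e` of the disjoint union of the sets `{1, …, q i}`
into `{1, …, n}`, and circle coordinates `s l`, of which only those with `l` not in the image of
`e` matter. -/
@[ext]
structure SmashGen (n : ℕ) (m : SimplexCategoryᵒᵖ) : Type u where
  q : Fin k → ℕ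
  e : (Σ i, Fin (q i)) → Fin n
  inj : Function.Injective e
  s : Fin n → IntervalSimplex m
  a : ∀ i, ((A i).level (q i)).S m

variable {A}

theorem smash_inj {q r : Fin k → ℕ} {n : ℕ} {e : (Σ i, Fin (q i + r i)) → Fin n}
    (he : Function.Injective e) :
    Function.Injective fun x : Σ i, Fin (q i) => e ⟨x.1, Fin.castAdd (r x.1) x.2⟩ := by
  rintro ⟨i, a⟩ ⟨j, b⟩ h
  have := he h
  simp only [Sigma.mk.injEq] at this
  obtain ⟨rfl, h⟩ := this
  have := Fin.castAdd_injective _ _ (eq_of_heq h)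
  rw [this]

theorem smash_inj' {q q' : Fin k → ℕ} {n : ℕ} {e : (Σ i, Fin (q i)) → Fin n}
    (he : Function.Injective e) (θ : ∀ i, Fin (q i) ≃ Fin (q' i)) :
    Function.Injective fun x : Σ i, Fin (q' i) => e ⟨x.1, (θ x.1).symm x.2⟩ :=
  he.comp (Equiv.sigmaCongrRight fun i => (θ i).symm).injective

/-- The identifications which define the smash product: the relations of the coend
`∫^{q₁, …, q_k} Σ_S(q₁ + ⋯ + q_k, n) ∧ A₁(q₁) ∧ ⋯ ∧ A_k(q_k)`, where `Σ_S(q, n)` is the wedge of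
the spheres `S^{n - e(q)}` over the injections `e`.  The base point is `none`. -/
inductive SmashRel {n : ℕ} {m : SimplexCategoryᵒᵖ} :
    Option (SmashGen A n m) → Option (SmashGen A n m) → Prop
  | sphere (q : Fin k → ℕ) (e : (Σ i, Fin (q i)) → Fin n) (he : Function.Injective e)
      (s s' : Fin n → IntervalSimplex m) (a : ∀ i, ((A i).level (q i)).S m)
      (h : ∀ l ∉ Set.range e, s l = s' l) :
      SmashRel (some ⟨q, e, he, s, a⟩) (some ⟨q, e, he, s', a⟩)
  | perm (q q' : Fin k → ℕ) (θ : ∀ i, Fin (q i) ≃ Fin (q' i)) (e : (Σ i, Fin (q i)) → Fin n)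
      (he : Function.Injective e) (s : Fin n → IntervalSimplex m)
      (a : ∀ i, ((A i).level (q i)).S m) :
      SmashRel (some ⟨q, e, he, s, a⟩)
        (some ⟨q', fun x => e ⟨x.1, (θ x.1).symm x.2⟩, smash_inj' he θ, s,
          fun i => (A i).act (θ i) (a i)⟩)
  | susp (q r : Fin k → ℕ) (e : (Σ i, Fin (q i + r i)) → Fin n) (he : Function.Injective e)
      (s : Fin n → IntervalSimplex m) (a : ∀ i, ((A i).level (q i)).S m) :
      SmashRel
        (some ⟨q, fun x => e ⟨x.1, Fin.castAdd (r x.1) x.2⟩, smash_inj he, s, a⟩)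
        (some ⟨fun i => q i + r i, e, he, s,
          fun i => (A i).suspIter (r i) (a i) fun l => s (e ⟨i, Fin.natAdd (q i) l⟩)⟩)
  | pt (g : SmashGen A n m) (i : Fin k) (h : g.a i = ((A i).level (g.q i)).pt m) :
      SmashRel (some g) none
  | sphere_pt (g : SmashGen A n m) (l : Fin n) (hl : l ∉ Set.range g.e)
      (h : (g.s l).IsConst) : SmashRel (some g) none

namespace SmashGen

variable {n n' : ℕ} {m m' : SimplexCategoryᵒᵖ}

/-- Simplicial operators on representatives. -/
def map (θ : m ⟶ m') (g : SmashGen A n m) : SmashGen A n m' where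
  q := g.q
  e := g.e
  inj := g.inj
  s l := (g.s l).comp (simpOp θ)
  a i := ((A i).level (g.q i)).X.map θ (g.a i)

/-- Auxiliary: change of `n` along an injection. -/
def push (ι : Fin n ↪ Fin n') (σ : (Fin n → IntervalSimplex m) → Fin n' → IntervalSimplex m)
    (g : SmashGen A n m) : SmashGen A n' m where
  q := g.q
  e x := ι (g.e x)
  inj := ι.injective.comp g.inj
  s := σ g.s
  a := g.a

theorem map_rel (θ : m ⟶ m') (x y : Option (SmashGen A n m)) (h : SmashRel x y) :
    SmashRel (x.map (map θ)) (y.map (map θ)) := by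
  cases h with
  | sphere q e he s s' a h =>
    exact SmashRel.sphere q e he _ _ _ fun l hl =>
      congrArg (fun z : IntervalSimplex m => z.comp (simpOp θ)) (h l hl)
  | perm q q' f e he s a =>
    have := SmashRel.perm q q' f e he (fun l => (s l).comp (simpOp θ))
      (fun i => ((A i).level (q i)).X.map θ (a i))
    rw [show (fun i => (A i).act (f i) (((A i).level (q i)).X.map θ (a i))) =
      fun i => ((A i).level (q' i)).X.map θ ((A i).act (f i) (a i)) from
        funext fun i => ((A i).act_map (f i) θ (a i)).symm] at this
    exact this
  | susp q r e he s a =>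
    have := SmashRel.susp q r e he (fun l => (s l).comp (simpOp θ))
      (fun i => ((A i).level (q i)).X.map θ (a i))
    rw [show (fun i => (A i).suspIter (r i) (((A i).level (q i)).X.map θ (a i))
        fun l => (s (e ⟨i, Fin.natAdd (q i) l⟩)).comp (simpOp θ)) =
      fun i => ((A i).level (q i + r i)).X.map θ ((A i).suspIter (r i) (a i)
        fun l => s (e ⟨i, Fin.natAdd (q i) l⟩)) from
        funext fun i => ((A i).suspIter_map (r i) θ (a i) _).symm] at this
    exact this
  | pt g i h =>
    refine SmashRel.pt _ i ?_
    exact (congrArg _ h).trans (((A i).level (g.q i)).map_pt θ)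
  | sphere_pt g l hl h => exact SmashRel.sphere_pt _ l hl (h.comp θ)

theorem push_rel (ι : Fin n ↪ Fin n')
    (σ : (Fin n → IntervalSimplex m) → Fin n' → IntervalSimplex m)
    (h₁ : ∀ s l, σ s (ι l) = s l) (h₂ : ∀ s s', ∀ l ∉ Set.range ι, σ s l = σ s' l)
    (x y : Option (SmashGen A n m)) (h : SmashRel x y) :
    SmashRel (x.map (push ι σ)) (y.map (push ι σ)) := by
  cases h with
  | sphere q e he s s' a h =>
    refine SmashRel.sphere q (fun x => ι (e x)) _ _ _ _ fun l hl => ?_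
    by_cases hr : l ∈ Set.range ι
    · obtain ⟨l, rfl⟩ := hr
      rw [h₁, h₁]
      exact h l fun ⟨x, hx⟩ => hl ⟨x, congrArg ι hx⟩
    · exact h₂ _ _ l hr
  | perm q q' f e he s a =>
    exact SmashRel.perm q q' f (fun x => ι (e x)) (ι.injective.comp he) (σ s) a
  | susp q r e he s a =>
    have := SmashRel.susp q r (fun x => ι (e x)) (ι.injective.comp he) (σ s) a
    simp only [h₁] at this
    exact this
  | pt g i h => exact SmashRel.pt _ i h
  | sphere_pt g l hl h =>
    refine SmashRel.sphere_pt _ (ι l) (fun ⟨x, hx⟩ => hl ⟨x, ι.injective hx⟩) ?_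
    change (σ g.s (ι l)).IsConst
    rw [h₁]; exact h

end SmashGen

variable (A)

/-- The data of the smash product. -/
def smashData : SymSpectrumData.{u} where
  level n :=
    { X :=
        { obj := fun m => Quot (SmashRel (A := A) (n := n) (m := m))
          map := fun θ => ↾ Quot.map (Option.map (SmashGen.map θ)) (SmashGen.map_rel θ)
          map_id := fun m => by
            ext x
            obtain ⟨x | g, rfl⟩ := Quot.exists_rep x
            · rfl
            · refine congrArg (fun a => Quot.mk _ (some (SmashGen.mk g.q g.e g.inj g.s a))) ?_
              funext i
              exact Functor.map_id_apply ((A i).level (g.q i)).X m (g.a i)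
          map_comp := fun θ θ' => by
            ext x
            obtain ⟨x | g, rfl⟩ := Quot.exists_rep x
            · rfl
            · refine congrArg (fun a => Quot.mk _ (some (SmashGen.mk g.q g.e g.inj _ a))) ?_
              funext i
              exact Functor.map_comp_apply _ _ _ _ }
      pt := fun m => Quot.mk _ none
      map_pt := fun _ => rfl }
  act e := Quot.map (Option.map (SmashGen.push e.toEmbedding fun s l => s (e.symm l)))
    (SmashGen.push_rel _ _ (fun s l => congrArg s (e.symm_apply_apply l))
      (fun _ _ l hl => (hl ⟨e.symm l, e.apply_symm_apply l⟩).elim))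
  susp {n m} x s' := Quot.map (Option.map (SmashGen.push Fin.castSuccEmb
      fun s => Fin.snoc (α := fun _ => IntervalSimplex m) s s'))
    (SmashGen.push_rel _ _
      (fun s l => Fin.snoc_castSucc (α := fun _ => IntervalSimplex m) s' s l)
      (fun s t l hl => by
        induction l using Fin.lastCases with
        | last => rw [Fin.snoc_last, Fin.snoc_last]
        | cast l => exact (hl ⟨l, rfl⟩).elim)) x

theorem smash_suspIter_none (p : ℕ) {n : ℕ} {m : SimplexCategoryᵒᵖ}
    (s : Fin p → IntervalSimplex m) :
    (smashData A).suspIter p (q := n) (Quot.mk _ none) s = Quot.mk _ none := by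
  induction p with
  | zero => rfl
  | succ p ih => exact congrArg (fun z => (smashData A).susp z _) (ih _)

theorem smash_suspIter_some (p : ℕ) {n : ℕ} {m : SimplexCategoryᵒᵖ} (g : SmashGen A n m)
    (s : Fin p → IntervalSimplex m) :
    (smashData A).suspIter p (q := n) (Quot.mk _ (some g)) s =
      Quot.mk _ (some ⟨g.q, fun x => Fin.castAdd p (g.e x),
        (Fin.castAdd_injective _ _).comp g.inj, Fin.append g.s s, g.a⟩) := by
  induction p with
  | zero =>
    refine congrArg (fun s => Quot.mk _ (some (SmashGen.mk g.q g.e g.inj s g.a))) ?_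
    funext l
    exact (Fin.append_left g.s s l).symm
  | succ p ih =>
    refine (congrArg (fun z => (smashData A).susp z _) (ih _)).trans ?_
    refine congrArg (fun s => Quot.mk _ (some (SmashGen.mk g.q (fun x => Fin.castAdd (p + 1) (g.e x))
      ((Fin.castAdd_injective _ _).comp g.inj) s g.a))) ?_
    funext l
    induction l using Fin.lastCases with
    | last =>
      refine (Fin.snoc_last (α := fun _ => IntervalSimplex m) _ _).trans ?_
      exact (Fin.append_right g.s s (Fin.last p)).symm
    | cast l =>
      refine (Fin.snoc_castSucc (α := fun _ => IntervalSimplex m) _ _ _).trans ?_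
      induction l using Fin.addCases with
      | left l =>
        refine (Fin.append_left g.s (fun k => s (Fin.castSucc k)) l).trans ?_
        exact (Fin.append_left g.s s l).symm
      | right l =>
        refine (Fin.append_right g.s (fun k => s (Fin.castSucc k)) l).trans ?_
        exact (Fin.append_right g.s s (Fin.castSucc l)).symm

/-- The smash product of a family of symmetric spectra (the sphere spectrum for the empty
family). -/
def smash : SymSpectrum.{u} where
  toSymSpectrumData := smashData A
  act_map {p q} e {n m} θ x := by
    obtain ⟨x | g, rfl⟩ := Quot.exists_rep x <;> rfl
  act_pt _ _ := rfl
  act_refl x := by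
    obtain ⟨x | g, rfl⟩ := Quot.exists_rep x <;> rfl
  act_trans _ _ _ x := by
    obtain ⟨x | g, rfl⟩ := Quot.exists_rep x <;> rfl
  susp_map {q n m} θ x s := by
    obtain ⟨x | g, rfl⟩ := Quot.exists_rep x
    · rfl
    · refine congrArg (fun s => Quot.mk _ (some (SmashGen.mk g.q (fun x => Fin.castSucc (g.e x))
        ((Fin.castSucc_injective _).comp g.inj) s _))) ?_
      funext l
      induction l using Fin.lastCases with
      | last =>
        refine Eq.trans ?_ (Fin.snoc_last (α := fun _ => IntervalSimplex m) _ _).symm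
        exact congrArg (fun z : IntervalSimplex n => z.comp (simpOp θ))
          (Fin.snoc_last (α := fun _ => IntervalSimplex n) s g.s)
      | cast l =>
        refine Eq.trans ?_ (Fin.snoc_castSucc (α := fun _ => IntervalSimplex m) _ _ l).symm
        exact congrArg (fun z : IntervalSimplex n => z.comp (simpOp θ))
          (Fin.snoc_castSucc (α := fun _ => IntervalSimplex n) s g.s l)
  susp_pt _ := rfl
  susp_const {q n} x s hs := by
    obtain ⟨x | g, rfl⟩ := Quot.exists_rep x
    · rfl
    · refine Quot.sound (SmashRel.sphere_pt _ (Fin.last q) ?_ ?_)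
      · rintro ⟨x, hx⟩
        exact (Fin.castSucc_lt_last (g.e x)).ne hx
      · change IntervalSimplex.IsConst (Fin.snoc (α := fun _ => IntervalSimplex n) g.s s (Fin.last q))
        rw [Fin.snoc_last]; exact hs
  susp_act p {q q'} e σ {n} x s := by
    obtain ⟨x | g, rfl⟩ := Quot.exists_rep x
    · refine (smash_suspIter_none A p _).trans ?_
      exact (congrArg ((smashData A).act (blockSum e σ)) (smash_suspIter_none A p s)).symm
    · refine (smash_suspIter_some A p _ _).trans ?_
      refine Eq.trans ?_
        (congrArg ((smashData A).act (blockSum e σ)) (smash_suspIter_some A p g s)).symm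
      refine congrArg (Quot.mk _) (congrArg some (SmashGen.ext rfl (heq_of_eq ?_)
        ?_ HEq.rfl))
      · funext x
        change Fin.castAdd p (e (g.e x)) = blockSum e σ (Fin.castAdd p (g.e x))
        simp [blockSum]
      · funext l
        change Fin.append (fun l => g.s (e.symm l)) (fun k => s (σ.symm k)) l =
          Fin.append g.s s ((blockSum e σ).symm l)
        induction l using Fin.addCases with
        | left l => simp [blockSum]
        | right l => simp [blockSum]

variable {A}

/-- The simplex `a₁ ∧ ⋯ ∧ a_k` of the smash product, shuffled by the bijection `e`. -/
def smashMk {q : Fin k → ℕ} {n : ℕ} {m : SimplexCategoryᵒᵖ} (e : (Σ i, Fin (q i)) ≃ Fin n)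
    (a : ∀ i, ((A i).level (q i)).S m) : ((smash A).level n).S m :=
  Quot.mk _ (some ⟨q, e, e.injective, fun _ => OrderHom.const _ 0, a⟩)

end Smash

/-- The relation which collapses `N × *`. -/
inductive TensorRel (N : SSet.{u}) (Y : PSSet.{u}) (m : SimplexCategoryᵒᵖ) :
    Option (N.obj m × Y.S m) → Option (N.obj m × Y.S m) → Prop
  | pt (ν : N.obj m) : TensorRel N Y m (some (ν, Y.pt m)) none

theorem TensorRel.some_pt {N : SSet.{u}} {Y : PSSet.{u}} {m : SimplexCategoryᵒᵖ} (ν : N.obj m)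
    {y : Y.S m} (h : y = Y.pt m) : TensorRel N Y m (some (ν, y)) none := by
  subst h; exact TensorRel.pt ν

/-- The pointed simplicial set `N₊ ∧ Y`. -/
def tensorLevel (N : SSet.{u}) (Y : PSSet.{u}) : PSSet.{u} where
  X :=
    { obj := fun m => Quot (TensorRel N Y m)
      map := fun θ => ↾ Quot.map (Option.map fun z => (N.map θ z.1, Y.X.map θ z.2)) (by
        rintro _ _ ⟨ν⟩
        exact TensorRel.some_pt _ (Y.map_pt θ))
      map_id := fun m => by
        ext x
        obtain ⟨x | g, rfl⟩ := Quot.exists_rep x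
        · rfl
        · exact congrArg (fun z => Quot.mk _ (some z))
            (Prod.ext (Functor.map_id_apply N m g.1) (Functor.map_id_apply Y.X m g.2))
      map_comp := fun θ θ' => by
        ext x
        obtain ⟨x | g, rfl⟩ := Quot.exists_rep x
        · rfl
        · exact congrArg (fun z => Quot.mk _ (some z)) (Prod.ext
            (Functor.map_comp_apply _ _ _ _) (Functor.map_comp_apply _ _ _ _)) }
  pt m := Quot.mk _ none
  map_pt _ := rfl

/-- Auxiliary: the data of `N ∧ A`. -/
def tensorData (N : SSet.{u}) (A : SymSpectrum.{u}) : SymSpectrumData.{u} where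
  level q := tensorLevel N (A.level q)
  act e := Quot.map (Option.map fun z => (z.1, A.act e z.2)) (by
    rintro _ _ ⟨ν⟩
    exact TensorRel.some_pt _ (A.act_pt e _))
  susp x s := Quot.map (Option.map fun z => (z.1, A.susp z.2 s)) (by
    rintro _ _ ⟨ν⟩
    exact TensorRel.some_pt _ (A.susp_pt s)) x

/-- The simplex `ν ∧ x` of `N ∧ A`. -/
def tensorMk {N : SSet.{u}} {A : SymSpectrum.{u}} {q : ℕ} {m : SimplexCategoryᵒᵖ} (ν : N.obj m)
    (x : (A.level q).S m) : ((tensorData N A).level q).S m :=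
  Quot.mk _ (some (ν, x))

theorem tensor_suspIter_pt (N : SSet.{u}) (A : SymSpectrum.{u}) (p : ℕ) {q : ℕ}
    {m : SimplexCategoryᵒᵖ} (s : Fin p → IntervalSimplex m) :
    (tensorData N A).suspIter p (((tensorData N A).level q).pt m) s =
      ((tensorData N A).level (q + p)).pt m := by
  induction p with
  | zero => rfl
  | succ p ih => exact congrArg (fun z => (tensorData N A).susp z _) (ih _)

theorem tensor_suspIter_mk (N : SSet.{u}) (A : SymSpectrum.{u}) (p : ℕ) {q : ℕ}
    {m : SimplexCategoryᵒᵖ} (ν : N.obj m) (x : (A.level q).S m) (s : Fin p → IntervalSimplex m) :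
    (tensorData N A).suspIter p (tensorMk ν x) s = tensorMk ν (A.suspIter p x s) := by
  induction p with
  | zero => rfl
  | succ p ih => exact congrArg (fun z => (tensorData N A).susp z _) (ih _)

theorem tensor_cases {N : SSet.{u}} {A : SymSpectrum.{u}} {q : ℕ} {m : SimplexCategoryᵒᵖ}
    (x : ((tensorData N A).level q).S m) :
    x = ((tensorData N A).level q).pt m ∨ ∃ ν y, x = tensorMk ν y := by
  obtain ⟨x | ⟨ν, y⟩, rfl⟩ := Quot.exists_rep x
  · exact Or.inl rfl
  · exact Or.inr ⟨ν, y, rfl⟩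

/-- The symmetric spectrum `N ∧ A` for an (unpointed) simplicial set `N`; the simplices of
`N₊ ∧ A(q)` are pairs, with all pairs `(ν, *)` identified with the base point. -/
def tensor (N : SSet.{u}) (A : SymSpectrum.{u}) : SymSpectrum.{u} where
  toSymSpectrumData := tensorData N A
  act_map {p q} e {n m} θ x := by
    obtain rfl | ⟨ν, y, rfl⟩ := tensor_cases x
    · rfl
    · exact congrArg (tensorMk (N.map θ ν)) (A.act_map e θ y)
  act_pt _ _ := rfl
  act_refl x := by
    obtain rfl | ⟨ν, y, rfl⟩ := tensor_cases x
    · rfl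
    · exact congrArg (tensorMk ν) (A.act_refl y)
  act_trans e e' _ x := by
    obtain rfl | ⟨ν, y, rfl⟩ := tensor_cases x
    · rfl
    · exact congrArg (tensorMk ν) (A.act_trans e e' y)
  susp_map θ x s := by
    obtain rfl | ⟨ν, y, rfl⟩ := tensor_cases x
    · rfl
    · exact congrArg (tensorMk (N.map θ ν)) (A.susp_map θ y s)
  susp_pt _ := rfl
  susp_const x s hs := by
    obtain rfl | ⟨ν, y, rfl⟩ := tensor_cases x
    · rfl
    · exact Quot.sound (TensorRel.some_pt _ (A.susp_const y s hs))
  susp_act p {q q'} e σ {n} x s := by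
    obtain rfl | ⟨ν, y, rfl⟩ := tensor_cases x
    · refine (tensor_suspIter_pt N A p _).trans ?_
      exact (congrArg ((tensorData N A).act (blockSum e σ)) (tensor_suspIter_pt N A p s)).symm
    · refine (tensor_suspIter_mk N A p ν (A.act e y) _).trans ?_
      refine (congrArg (tensorMk ν) (A.susp_act p e σ y s)).trans ?_
      exact (congrArg ((tensorData N A).act (blockSum e σ)) (tensor_suspIter_mk N A p ν y s)).symm

/-! ### Symmetric multicategories enriched in small categories -/

/-- The position of the `a`-th entry of the `i`-th block in a concatenation of blocks of lengths
`j 1, …, j n`. -/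
abbrev place {n : ℕ} (j : Fin n → ℕ) (i : Fin n) (a : Fin (j i)) : Fin (∑ i, j i) :=
  finSigmaFinEquiv ⟨i, a⟩

/-- The data of a symmetric multicategory enriched in small categories.  Tuples of objects are
functions on `Fin k`; equalities between tuples are given as hypotheses. -/
structure SymMulticatData : Type (max (v + 1) (u + 1)) where
  Ob : Type v
  /-- The category of `k`-morphisms `(x₁, …, x_k) ⟶ y`. -/
  Hom : ∀ {k : ℕ}, (Fin k → Ob) → Ob → Type u
  [cat : ∀ {k : ℕ} (x : Fin k → Ob) (y : Ob), SmallCategory (Hom x y)]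
  /-- The unit object in the category of `1`-morphisms `(x₁) ⟶ x₁`. -/
  one : ∀ x : Fin 1 → Ob, Hom x (x 0)
  /-- The functor `σ^*` from `(x₁, …, x_k) ⟶ y` to `(x_{σ 1}, …, x_{σ k}) ⟶ y`, for a bijection
  `σ : Fin k ≃ Fin l` (whence `k = l`). -/
  perm : ∀ {k l : ℕ} (σ : Fin k ≃ Fin l) {x : Fin l → Ob} {x' : Fin k → Ob} {y : Ob},
    (∀ i, x' i = x (σ i)) → (Hom x y ⥤ Hom x' y)
  /-- Composition; `x'` is the concatenation of the tuples `x 1, …, x n`. -/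
  comp : ∀ {n : ℕ} {j : Fin n → ℕ} {x : ∀ i, Fin (j i) → Ob} {x' : Fin (∑ i, j i) → Ob}
    {y : Fin n → Ob} {z : Ob}, (∀ i a, x' (place j i a) = x i a) →
    (Hom y z × (∀ i, Hom (x i) (y i)) ⥤ Hom x' z)

namespace SymMulticatData

instance (M : SymMulticatData.{v, u}) {k : ℕ} (x : Fin k → M.Ob) (y : M.Ob) :
    SmallCategory (M.Hom x y) := M.cat x y

/-- The composition, on diagrams of shape `T`. -/
def gamma (M : SymMulticatData.{v, u}) {T : Type} [SmallCategory T] {n : ℕ} {j : Fin n → ℕ}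
    {x : ∀ i, Fin (j i) → M.Ob} {x' : Fin (∑ i, j i) → M.Ob} {y : Fin n → M.Ob} {z : M.Ob}
    (h : ∀ i a, x' (place j i a) = x i a) (f : T ⥤ M.Hom y z)
    (g : ∀ i, T ⥤ M.Hom (x i) (y i)) : T ⥤ M.Hom x' z :=
  f.prod' (Functor.pi' g) ⋙ M.comp h

end SymMulticatData

/-- Symmetric multicategories enriched in small categories.  The axioms are equalities of
functors; they are stated on diagrams of an arbitrary small shape `T` (the shapes `[0]` and `[1]`
give the equalities on objects and on morphisms). -/
structure SymMulticat : Type (max (v + 1) (u + 1)) extends SymMulticatData.{v, u} where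
  perm_refl : ∀ {k : ℕ} {x : Fin k → Ob} {y : Ob} {T : Type} [SmallCategory T] (f : T ⥤ Hom x y),
    f ⋙ perm (Equiv.refl _) (fun _ => rfl) = f
  perm_trans : ∀ {k l m : ℕ} (τ : Fin k ≃ Fin l) (σ : Fin l ≃ Fin m) {x : Fin m → Ob}
    {x' : Fin l → Ob} {x'' : Fin k → Ob} {y : Ob} (h : ∀ i, x' i = x (σ i))
    (h' : ∀ i, x'' i = x' (τ i)) (h'' : ∀ i, x'' i = x (τ.trans σ i)) {T : Type} [SmallCategory T]
    (f : T ⥤ Hom x y),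
    (f ⋙ perm σ h) ⋙ perm τ h' = f ⋙ perm (τ.trans σ) h''
  /-- `γ(1; g) = g` -/
  one_comp : ∀ {k : ℕ} {x : Fin 1 → Fin k → Ob} {x' : Fin (∑ _ : Fin 1, k) → Ob}
    {y : Fin 1 → Ob} (h : ∀ i a, x' (place (fun _ => k) i a) = x i a)
    (σ : Fin (∑ _ : Fin 1, k) ≃ Fin k) (_ : ∀ a, σ (place (fun _ => k) 0 a) = a)
    (h' : ∀ b, x' b = x 0 (σ b)) {T : Type} [SmallCategory T] (g : ∀ i, T ⥤ Hom (x i) (y i)),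
    toSymMulticatData.gamma h ((Functor.const T).obj (one y)) g = g 0 ⋙ perm σ h'
  /-- `γ(f; 1, …, 1) = f` -/
  comp_one : ∀ {n : ℕ} {x : Fin n → Ob} {x' : Fin (∑ _ : Fin n, 1) → Ob} {z : Ob}
    (h : ∀ i a, x' (place (fun _ => 1) i a) = x i)
    (σ : Fin (∑ _ : Fin n, 1) ≃ Fin n) (_ : ∀ i a, σ (place (fun _ => 1) i a) = i)
    (h' : ∀ b, x' b = x (σ b)) {T : Type} [SmallCategory T] (f : T ⥤ Hom x z),
    toSymMulticatData.gamma (x := fun i _ => x i) h f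
      (fun i => (Functor.const T).obj (one fun _ => x i)) = f ⋙ perm σ h'
  /-- `γ(γ(f; g₁, …, g_n); h₁, h₂, …) = γ(f; γ(g₁; h₁, …), …, γ(g_n; …))`, up to the canonical
  identification `σ` of the index sets. -/
  assoc : ∀ {n : ℕ} {j : Fin n → ℕ} {l : Fin (∑ i, j i) → ℕ} {x : Fin (∑ i, j i) → Ob}
    {w : ∀ b, Fin (l b) → Ob} {w₁ : Fin (∑ b, l b) → Ob}
    {w₂ : ∀ i, Fin (∑ a, l (place j i a)) → Ob} {w₃ : Fin (∑ i, ∑ a, l (place j i a)) → Ob}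
    {y : Fin n → Ob} {z : Ob} (h₁ : ∀ b c, w₁ (place l b c) = w b c)
    (h₂ : ∀ i a c, w₂ i (place (fun a => l (place j i a)) a c) = w (place j i a) c)
    (h₃ : ∀ i d, w₃ (place (fun i => ∑ a, l (place j i a)) i d) = w₂ i d)
    (σ : Fin (∑ i, ∑ a, l (place j i a)) ≃ Fin (∑ b, l b))
    (_ : ∀ i a c, σ (place (fun i => ∑ a, l (place j i a)) i
      (place (fun a => l (place j i a)) a c)) = place l (place j i a) c)
    (h₄ : ∀ d, w₃ d = w₁ (σ d)) {T : Type} [SmallCategory T] (f : T ⥤ Hom y z)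
    (g : ∀ i, T ⥤ Hom (fun a => x (place j i a)) (y i)) (h : ∀ b, T ⥤ Hom (w b) (x b)),
    toSymMulticatData.gamma h₁ (toSymMulticatData.gamma (fun _ _ => rfl) f g) h ⋙ perm σ h₄ =
      toSymMulticatData.gamma h₃ f
        (fun i => toSymMulticatData.gamma (h₂ i) (g i) fun a => h (place j i a))
  /-- `γ(σ^* f; g_{σ 1}, …, g_{σ n}) = β^* γ(f; g₁, …, g_n)`, where `β` permutes blocks as `σ`. -/
  perm_comp : ∀ {n n' : ℕ} (σ : Fin n' ≃ Fin n) {j : Fin n → ℕ} {x : ∀ i, Fin (j i) → Ob}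
    {x₁ : Fin (∑ i, j i) → Ob} {x₂ : Fin (∑ i, j (σ i)) → Ob} {y : Fin n → Ob} {z : Ob}
    (h₁ : ∀ i a, x₁ (place j i a) = x i a)
    (h₂ : ∀ i a, x₂ (place (fun i => j (σ i)) i a) = x (σ i) a)
    (β : Fin (∑ i, j (σ i)) ≃ Fin (∑ i, j i))
    (_ : ∀ i a, β (place (fun i => j (σ i)) i a) = place j (σ i) a)
    (h₃ : ∀ b, x₂ b = x₁ (β b)) {T : Type} [SmallCategory T] (f : T ⥤ Hom y z)
    (g : ∀ i, T ⥤ Hom (x i) (y i)),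
    toSymMulticatData.gamma h₂ (f ⋙ perm (x' := fun i => y (σ i)) σ (fun _ => rfl))
        (fun i => g (σ i)) =
      toSymMulticatData.gamma h₁ f g ⋙ perm β h₃
  /-- `γ(f; τ₁^* g₁, …, τ_n^* g_n) = β^* γ(f; g₁, …, g_n)`, where `β = τ₁ ⊕ ⋯ ⊕ τ_n`. -/
  comp_perm : ∀ {n : ℕ} {j j' : Fin n → ℕ} (τ : ∀ i, Fin (j' i) ≃ Fin (j i))
    {x : ∀ i, Fin (j i) → Ob} {x' : ∀ i, Fin (j' i) → Ob}
    {x₁ : Fin (∑ i, j i) → Ob} {x₂ : Fin (∑ i, j' i) → Ob} {y : Fin n → Ob} {z : Ob}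
    (h : ∀ i a, x' i a = x i (τ i a)) (h₁ : ∀ i a, x₁ (place j i a) = x i a)
    (h₂ : ∀ i a, x₂ (place j' i a) = x' i a) (β : Fin (∑ i, j' i) ≃ Fin (∑ i, j i))
    (_ : ∀ i a, β (place j' i a) = place j i (τ i a))
    (h₃ : ∀ b, x₂ b = x₁ (β b)) {T : Type} [SmallCategory T] (f : T ⥤ Hom y z)
    (g : ∀ i, T ⥤ Hom (x i) (y i)),
    toSymMulticatData.gamma h₂ f (fun i => g i ⋙ perm (τ i) (h i)) =
      toSymMulticatData.gamma h₁ f g ⋙ perm β h₃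

namespace SymMulticat

instance (M : SymMulticat.{v, u}) {k : ℕ} (x : Fin k → M.Ob) (y : M.Ob) :
    SmallCategory (M.Hom x y) := M.cat x y

end SymMulticat

/-! ### Multiexact functors -/

section Multiexact

variable {k : ℕ} (C : Fin k → WaldCat.{u}) (D : WaldCat.{u})

/-- The functor which inserts an object in the `i`-th place, keeping the others fixed. -/
def insertAt {C : Fin k → WaldCat.{u}} (X : ∀ i, C i) (i : Fin k) : C i ⥤ ∀ j, C j :=
  Functor.pi' (Function.update (β := fun j => C i ⥤ C j)
    (fun j => (Functor.const (C i)).obj (X j)) i (𝟭 (C i)))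

/-- The cube of objects of `C₁ × ⋯ × C_k` given by one arrow in each of the categories. -/
noncomputable def cube {C : Fin k → WaldCat.{u}} {X Y : ∀ i, C i} (f : ∀ i, X i ⟶ Y i) :
    Grid (fun _ : Fin k => 1) ⥤ ∀ i, C i :=
  Functor.pi' fun i => Monotone.functor (f := fun x : Grid (fun _ : Fin k => 1) => x i)
    (fun _ _ h => h i) ⋙ ComposableArrows.mk₁ (f i)

variable {C D} in
/-- Multiexact functors. -/
structure IsMultiexact (F : (∀ i, C i) ⥤ D) : Prop where
  zero : ∀ X : ∀ i, C i, (∃ i, X i = (C i).zero) → F.obj X = D.zero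
  exact : ∀ (X : ∀ i, C i) (i : Fin k), WaldCat.IsExact (insertAt X i ⋙ F)
  cube : ∀ {X Y : ∀ i, C i} (f : ∀ i, X i ⟶ Y i), (∀ i, (C i).cof (f i)) →
    IsCubicallyCofibrant (cube f ⋙ F)

/-- The category of multiexact functors and natural weak equivalences.  For `k = 0` this is the
category of weak equivalences of `D`. -/
structure Mult : Type u where
  F : (∀ i, C i) ⥤ D
  isMultiexact : IsMultiexact F

instance : SmallCategory (Mult C D) where
  Hom F G := {α : F.F ⟶ G.F // ∀ X, D.weq (α.app X)}
  id F := ⟨𝟙 F.F, fun _ => D.weq_of_isIso (𝟙 _)⟩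
  comp α β := ⟨α.1 ≫ β.1, fun X => D.weq_comp _ _ (α.2 X) (β.2 X)⟩

/-- The functor which forgets that a functor is multiexact. -/
def Mult.forget : Mult C D ⥤ (∀ i, C i) ⥤ D where
  obj F := F.F
  map α := α.1

end Multiexact

/-! ### Algebras -/

/-- The data of an algebra in Waldhausen categories. -/
structure WaldAlgebraData (M : SymMulticat.{v, u}) : Type (max v (u + 1)) where
  obj : M.Ob → WaldCat.{u}
  act : ∀ {k : ℕ} (x : Fin k → M.Ob) (y : M.Ob), M.Hom x y ⥤ Mult (fun i => obj (x i)) (obj y)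

/-- Evaluation of the multiexact functors of an algebra, on diagrams of shape `T`. -/
def WaldAlgebraData.ev {M : SymMulticat.{v, u}} (C : WaldAlgebraData M) {T : Type}
    [SmallCategory T] {k : ℕ} {x : Fin k → M.Ob} {y : M.Ob} (f : T ⥤ M.Hom x y)
    (Z : ∀ i, T ⥤ C.obj (x i)) : T ⥤ C.obj y :=
  f.prod' (Functor.pi' Z) ⋙ Functor.uncurry.obj (C.act x y ⋙ Mult.forget _ _)

/-- `M`-algebras in Waldhausen categories: multifunctors enriched in categories from `M` to the
symmetric multicategory of Waldhausen categories and multiexact functors.  As for `SymMulticat`,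
the axioms are equalities of functors, stated on diagrams of an arbitrary small shape `T`. -/
structure WaldAlgebra (M : SymMulticat.{v, u}) : Type (max v (u + 1)) extends
    WaldAlgebraData M where
  ev_one : ∀ (x : Fin 1 → M.Ob) {T : Type} [SmallCategory T] (Z : ∀ i, T ⥤ obj (x i)),
    toWaldAlgebraData.ev ((Functor.const T).obj (M.one x)) Z = Z 0
  ev_comp : ∀ {n : ℕ} {j : Fin n → ℕ} {x : Fin (∑ i, j i) → M.Ob} {y : Fin n → M.Ob} {z : M.Ob}
    {T : Type} [SmallCategory T] (f : T ⥤ M.Hom y z)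
    (g : ∀ i, T ⥤ M.Hom (fun a => x (place j i a)) (y i)) (Z : ∀ b, T ⥤ obj (x b)),
    toWaldAlgebraData.ev (M.gamma (x' := x) (fun _ _ => rfl) f g) Z =
      toWaldAlgebraData.ev f fun i => toWaldAlgebraData.ev (g i) fun a => Z (place j i a)
  ev_perm : ∀ {k l : ℕ} (σ : Fin k ≃ Fin l) {x : Fin l → M.Ob} {y : M.Ob}
    {T : Type} [SmallCategory T] (f : T ⥤ M.Hom x y) (Z : ∀ i, T ⥤ obj (x i)),
    toWaldAlgebraData.ev (f ⋙ M.perm (x' := fun i => x (σ i)) σ fun _ => rfl)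
      (fun i => Z (σ i)) = toWaldAlgebraData.ev f Z

/-- Maps of `M`-algebras in Waldhausen categories: exact functors which commute with the
actions. -/
structure WaldAlgebra.Hom {M : SymMulticat.{v, u}} (C D : WaldAlgebra M) :
    Type (max v u) where
  app : ∀ x, C.obj x ⟶ D.obj x
  app_ev : ∀ {k : ℕ} {x : Fin k → M.Ob} {y : M.Ob} {T : Type} [SmallCategory T]
    (f : T ⥤ M.Hom x y) (Z : ∀ i, T ⥤ C.obj (x i)),
    C.ev f Z ⋙ (app y).functor = D.ev f fun i => Z i ⋙ (app (x i)).functor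

/-- The data of an algebra in symmetric spectra with given underlying spectra: maps of symmetric
spectra `N(M(x₁, …, x_k; y)) ∧ A x₁ ∧ ⋯ ∧ A x_k ⟶ A y`. -/
structure SpectrumAlgebraData (M : SymMulticat.{v, u}) (A : M.Ob → SymSpectrum.{u}) :
    Type (max v u) where
  act : ∀ {k : ℕ} (x : Fin k → M.Ob) (y : M.Ob),
    tensor (nerve (M.Hom x y)) (smash fun i => A (x i)) ⟶ A y

/-- The diagram given by a simplex of the nerve of a category. -/
def simplexFunctor {B : Type u} [SmallCategory B] {m : SimplexCategoryᵒᵖ}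
    (ν : (nerve B).obj m) : Fin (m.unop.len + 1) ⥤ B := ν

/-- The simplex of the nerve of a category given by a diagram. -/
def simplexOfFunctor {B : Type u} [SmallCategory B] {m : SimplexCategoryᵒᵖ}
    (f : Fin (m.unop.len + 1) ⥤ B) : (nerve B).obj m := f

namespace SpectrumAlgebraData

variable {M : SymMulticat.{v, u}} {A : M.Ob → SymSpectrum.{u}}

/-- The value of the action on the simplex `ν ∧ a₁ ∧ ⋯ ∧ a_k`, shuffled by a bijection `e`.  Since
the action is a map of symmetric spectra, it is determined by these values. -/
def component (Φ : SpectrumAlgebraData M A) {k : ℕ} {x : Fin k → M.Ob} {y : M.Ob}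
    {q : Fin k → ℕ} {n : ℕ} {m : SimplexCategoryᵒᵖ} (ν : (nerve (M.Hom x y)).obj m)
    (e : (Σ i, Fin (q i)) ≃ Fin n) (a : ∀ i, ((A (x i)).level (q i)).S m) :
    ((A y).level n).S m :=
  (Φ.act x y).app n m (tensorMk ν (smashMk e a))

end SpectrumAlgebraData

/-- `M`-algebras in symmetric spectra with given underlying spectra.  The compatibility of the
action with the units, the composition and the permutations of `M` is stated on the simplices
`ν ∧ a₁ ∧ ⋯ ∧ a_k`, which generate the source. -/
structure SpectrumAlgebra (M : SymMulticat.{v, u}) (A : M.Ob → SymSpectrum.{u}) :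
    Type (max v u) extends SpectrumAlgebraData M A where
  act_one : ∀ (x : Fin 1 → M.Ob) {q : Fin 1 → ℕ} {n : ℕ} {m : SimplexCategoryᵒᵖ}
    (e : (Σ i, Fin (q i)) ≃ Fin n) (e' : Fin (q 0) ≃ Fin n) (_ : ∀ l, e ⟨0, l⟩ = e' l)
    (a : ∀ i, ((A (x i)).level (q i)).S m),
    toSpectrumAlgebraData.component
      (simplexOfFunctor ((Functor.const (Fin (m.unop.len + 1))).obj (M.one x))) e a =
        (A (x 0)).act e' (a 0)
  act_comp : ∀ {n : ℕ} {j : Fin n → ℕ} {x : Fin (∑ i, j i) → M.Ob} {y : Fin n → M.Ob} {z : M.Ob}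
    {m : SimplexCategoryᵒᵖ} (ν : (nerve (M.Hom y z)).obj m)
    (μ : ∀ i, (nerve (M.Hom (fun a => x (place j i a)) (y i))).obj m)
    {q : Fin (∑ i, j i) → ℕ} {r : Fin n → ℕ} {N : ℕ}
    (e : ∀ i, (Σ a, Fin (q (place j i a))) ≃ Fin (r i)) (ε : (Σ i, Fin (r i)) ≃ Fin N)
    (ε' : (Σ b, Fin (q b)) ≃ Fin N)
    (_ : ∀ i a l, ε' ⟨place j i a, l⟩ = ε ⟨i, e i ⟨a, l⟩⟩)
    (a : ∀ b, ((A (x b)).level (q b)).S m),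
    toSpectrumAlgebraData.component
      (simplexOfFunctor (M.gamma (x' := x) (fun _ _ => rfl) (simplexFunctor ν)
        fun i => simplexFunctor (μ i))) ε' a =
      toSpectrumAlgebraData.component ν ε
        fun i => toSpectrumAlgebraData.component (μ i) (e i) fun c => a (place j i c)
  act_perm : ∀ {k l : ℕ} (σ : Fin k ≃ Fin l) {x : Fin l → M.Ob} {y : M.Ob}
    {m : SimplexCategoryᵒᵖ} (ν : (nerve (M.Hom x y)).obj m) {q : Fin l → ℕ} {n : ℕ}
    (e : (Σ i, Fin (q i)) ≃ Fin n) (e' : (Σ i, Fin (q (σ i))) ≃ Fin n)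
    (_ : ∀ i c, e' ⟨i, c⟩ = e ⟨σ i, c⟩) (a : ∀ i, ((A (x i)).level (q i)).S m),
    toSpectrumAlgebraData.component
      (simplexOfFunctor (simplexFunctor ν ⋙ M.perm (x' := fun i => x (σ i)) σ fun _ => rfl)) e'
        (fun i => a (σ i)) = toSpectrumAlgebraData.component ν e a

/-- Families of maps of symmetric spectra which commute with the actions of `M`. -/
def SpectrumAlgebra.IsHom {M : SymMulticat.{v, u}} {A B : M.Ob → SymSpectrum.{u}}
    (Φ : SpectrumAlgebra M A) (Ψ : SpectrumAlgebra M B) (h : ∀ x, A x ⟶ B x) : Prop :=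
  ∀ {k : ℕ} {x : Fin k → M.Ob} {y : M.Ob} {q : Fin k → ℕ} {n : ℕ} {m : SimplexCategoryᵒᵖ}
    (ν : (nerve (M.Hom x y)).obj m) (e : (Σ i, Fin (q i)) ≃ Fin n)
    (a : ∀ i, ((A (x i)).level (q i)).S m),
    (h y).app n m (Φ.component ν e a) =
      Ψ.component ν e fun i => (h (x i)).app (q i) m (a i)

/-- The diagram given by a simplex of the K-theory spectrum. -/
def kDiagram {C : WaldCat.{u}} {q : ℕ} {n : SimplexCategoryᵒᵖ}
    (X : ((KTheory.obj C).level q).S n) : KShape q n.unop.len ⥤ C := KSimp.F X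

/-- The projection to the first coordinate. -/
def KShape.fst {q m : ℕ} : KShape q m →o Fin (m + 1) where
  toFun a := a.1
  monotone' _ _ h := h.1

/-! The content of the theorem is that the prescribed diagram `(t, u) ↦ f_t(X₁(t, u₁), …, X_k(t,
u_k))` is again a simplex of K-theory, and that the prescription respects the identifications which
define the smash product. The algebra axioms are then formal.

For the first point, fix `t` and a multiexact functor `F`. The vanishing condition is immediate. A
square in one simplicial direction moves only one of the arguments `X_i`, up to isomorphism in the
others, so the pushout condition follows from exactness in that variable (`IsMultiexact.isPushout`).
Cofibrancy is the crux, because multiexactness only controls single cubes of cofibrations. A diagram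
on a grid is cubically cofibrant exactly when it extends to a `CofSystem`, which has values on all
lower sets, takes unions to pushouts and takes inclusions to cofibrations. Let `S_i` be such systems
on finite posets. By exactness in one variable at a time, `F(S₁(A₁), …, S_k(A_k))` is the colimit of
its values at the points of the box `A₁ × ⋯ × A_k` (`IsMultiexact.box_hom_ext`,
`IsMultiexact.box_exists_desc`). The points strictly below `p` form the union of the boxes with
sides `{y < p i}` or `{y ≤ p i}`, the full box excepted. Hence the latching object at `p` is the
colimit of a cube without its last vertex. That cube is the image under `F` of the cofibrations
`S_i(Iio (p i)) ⟶ S_i(Iic (p i))`, so the latching map is a cofibration by the cube axiom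
(`IsMultiexact.exists_latching`). The latching condition gives a cofibrant system on the product
(`IsMultiexact.isSystem`), and `IsMultiexact.inS` follows by reindexing. Compatibility with weak
equivalences is obtained by changing one variable at a time (`IsMultiexact.weq`).

For the second point, suspension in K-theory is strict extension by `*`, and such an extension is
determined as a functor by the original diagram and its support (`IsExtZero.unique`). A multiexact
functor sends extensions by zero to the extension by zero over the intersection of the supports
(`IsExtZero.ev`). A simplex of the smash product with circle coordinates outside the image of `e`
therefore acts as the extension by zero of the diagram above (`exists_smash_extZero`). Each defining
relation, and each compatibility of the action with the spectrum structure, amounts to comparing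
diagrams and supports (`smashAction_rel`, `kAction`).

When `e` is a bijection the support is everything, which gives the asserted formula
(`kDiagram_component`). The axioms for units, composition, permutations and maps are the
corresponding axioms of the Waldhausen algebra, evaluated on the shape `[m] × Ar[m]ⁿ`. -/

/-! ### Multiexact functors preserve pushouts and weak equivalences -/

section MultiexactBasic

variable {k : ℕ} {C : Fin k → WaldCat.{u}} {D : WaldCat.{u}}

/-- Morphisms out of a value of `insertAt`. -/
noncomputable def insertAtDesc (X : ∀ i, C i) (r : Fin k) {a : C r} {Y : ∀ i, C i} (f : a ⟶ Y r)
    (g : ∀ j, j ≠ r → (X j ⟶ Y j)) : (insertAt X r).obj a ⟶ Y := fun j =>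
  if h : j = r then
    eqToHom (by subst h; simp [insertAt]) ≫ (h ▸ f : h ▸ a ⟶ Y j)
  else eqToHom (by simp [insertAt, h]) ≫ g j h

theorem insertAtDesc_self (X : ∀ i, C i) (r : Fin k) {a : C r} {Y : ∀ i, C i} (f : a ⟶ Y r)
    (g : ∀ j, j ≠ r → (X j ⟶ Y j)) :
    insertAtDesc X r f g r = eqToHom (by simp [insertAt]) ≫ f := by
  simp [insertAtDesc]

theorem insertAtDesc_ne (X : ∀ i, C i) (r : Fin k) {a : C r} {Y : ∀ i, C i} (f : a ⟶ Y r)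
    (g : ∀ j, j ≠ r → (X j ⟶ Y j)) {j : Fin k} (h : j ≠ r) :
    insertAtDesc X r f g j = eqToHom (by simp [insertAt, h]) ≫ g j h := by
  simp [insertAtDesc, h]

/-- The components of `insertAt` come from a `Function.update`, which reduces only propositionally;
this is the source of the `eqToHom`s. They are confined to these component lemmas, and later
arguments use only the composition rules of `insertAtDesc`. -/
theorem insertAt_map_self (X : ∀ i, C i) (r : Fin k) {a b : C r} (f : a ⟶ b) :
    (insertAt X r).map f r = eqToHom (by simp [insertAt]) ≫ f ≫ eqToHom (by simp [insertAt]) :=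
  Functor.congr_hom (Function.update_self (β := fun j => C r ⥤ C j) r (𝟭 (C r)) _) f

theorem insertAt_map_ne (X : ∀ i, C i) (r : Fin k) {a b : C r} (f : a ⟶ b) {j : Fin k}
    (h : j ≠ r) : (insertAt X r).map f j = eqToHom (by simp [insertAt, h]) := by
  have := Functor.congr_hom (Function.update_of_ne (β := fun j => C r ⥤ C j) h (𝟭 (C r))
    fun j => (Functor.const (C r)).obj (X j)) f
  exact this.trans ((congrArg (eqToHom _ ≫ ·) (Category.id_comp _)).trans (eqToHom_trans _ _))

theorem insertAt_map_desc (X : ∀ i, C i) (r : Fin k) {a b : C r} {Y : ∀ i, C i} (t : a ⟶ b)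
    (f : b ⟶ Y r) (g : ∀ j, j ≠ r → (X j ⟶ Y j)) :
    (insertAt X r).map t ≫ insertAtDesc X r f g = insertAtDesc X r (t ≫ f) g := by
  funext j
  change (insertAt X r).map t j ≫ insertAtDesc X r f g j = _
  by_cases h : j = r
  · subst h
    rw [insertAtDesc_self, insertAtDesc_self, insertAt_map_self]
    simp
  · rw [insertAtDesc_ne _ _ _ _ h, insertAtDesc_ne _ _ _ _ h, insertAt_map_ne _ _ _ h]
    simp

theorem insertAtDesc_comp (X : ∀ i, C i) (r : Fin k) {a : C r} {Y Z : ∀ i, C i}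
    (f : a ⟶ Y r) (g : ∀ j, j ≠ r → (X j ⟶ Y j)) (t : Y ⟶ Z) :
    insertAtDesc X r f g ≫ t = insertAtDesc X r (f ≫ t r) fun j h => g j h ≫ t j := by
  funext j
  change insertAtDesc X r f g j ≫ t j = _
  by_cases h : j = r
  · subst h
    rw [insertAtDesc_self, insertAtDesc_self, Category.assoc]
  · rw [insertAtDesc_ne _ _ _ _ h, insertAtDesc_ne _ _ _ _ h, Category.assoc]

theorem isIso_insertAtDesc (X : ∀ i, C i) (r : Fin k) {a : C r} {Y : ∀ i, C i}
    (f : a ⟶ Y r) (g : ∀ j, j ≠ r → (X j ⟶ Y j)) [IsIso f] (hg : ∀ j h, IsIso (g j h)) :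
    IsIso (insertAtDesc X r f g) := by
  rw [isIso_pi_iff]
  intro j
  by_cases h : j = r
  · subst h
    rw [insertAtDesc_self]; infer_instance
  · rw [insertAtDesc_ne _ _ _ _ h]
    have := hg j h
    infer_instance

variable {F : (∀ i, C i) ⥤ D}

/-- A multiexact functor preserves pushouts along cofibrations in one variable; the other
components of the square are isomorphisms. -/
theorem IsMultiexact.isPushout (hF : IsMultiexact F) (r : Fin k) {X Y Z W : ∀ i, C i}
    {f : X ⟶ Y} {g : X ⟶ Z} {h : Y ⟶ W} {i : Z ⟶ W} (hw : f ≫ h = g ≫ i)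
    (hf : ∀ j, j ≠ r → IsIso (f j)) (hg : ∀ j, j ≠ r → IsIso (g j))
    (hh : ∀ j, j ≠ r → IsIso (h j)) (po : IsPushout (f r) (g r) (h r) (i r))
    (hc : (C r).cof (f r)) : IsPushout (F.map f) (F.map g) (F.map h) (F.map i) := by
  -- These maps compare the square that is constant off `r` at the components of `X` with the given
  -- square. They are isomorphisms because the given square consists of isomorphisms off `r`.
  let x := insertAtDesc X r (𝟙 (X r)) fun j _ => 𝟙 (X j)
  let y := insertAtDesc X r (𝟙 (Y r)) fun j _ => f j
  let z := insertAtDesc X r (𝟙 (Z r)) fun j _ => g j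
  let w := insertAtDesc X r (𝟙 (W r)) fun j _ => f j ≫ h j
  have : IsIso x := isIso_insertAtDesc _ _ _ _ fun j _ => inferInstance
  have : IsIso y := isIso_insertAtDesc _ _ _ _ hf
  have : IsIso z := isIso_insertAtDesc _ _ _ _ hg
  have : IsIso w := isIso_insertAtDesc _ _ _ _ fun j h' => by
    have := hf j h'
    have := hh j h'
    infer_instance
  have hi : ∀ j, g j ≫ i j = f j ≫ h j := fun j => (congrFun hw j).symm
  have e₁ : (insertAt X r).map (f r) ≫ y = x ≫ f := by
    rw [insertAt_map_desc, insertAtDesc_comp]; simp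
  have e₂ : (insertAt X r).map (g r) ≫ z = x ≫ g := by
    rw [insertAt_map_desc, insertAtDesc_comp]; simp
  have e₃ : (insertAt X r).map (h r) ≫ w = y ≫ h := by
    rw [insertAt_map_desc, insertAtDesc_comp]; simp
  have e₄ : (insertAt X r).map (i r) ≫ w = z ≫ i := by
    rw [insertAt_map_desc, insertAtDesc_comp]; simp [hi]
  refine IsPushout.of_iso ((hF.exact X r).map_pushout hc po) (F.mapIso (asIso x))
    (F.mapIso (asIso y)) (F.mapIso (asIso z)) (F.mapIso (asIso w)) ?_ ?_ ?_ ?_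
  · exact (F.map_comp _ _).symm.trans ((congrArg F.map e₁).trans (F.map_comp _ _))
  · exact (F.map_comp _ _).symm.trans ((congrArg F.map e₂).trans (F.map_comp _ _))
  · exact (F.map_comp _ _).symm.trans ((congrArg F.map e₃).trans (F.map_comp _ _))
  · exact (F.map_comp _ _).symm.trans ((congrArg F.map e₄).trans (F.map_comp _ _))

/-- Up to isomorphisms of source and target, `f` is a map inserted in the `r`-th variable, where
exactness applies. -/
theorem IsMultiexact.weq_of_isIso_of_ne (hF : IsMultiexact F) (r : Fin k) {X Y : ∀ i, C i}
    {f : X ⟶ Y} (hf : ∀ j, j ≠ r → IsIso (f j)) (hw : (C r).weq (f r)) : D.weq (F.map f) := by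
  let x := insertAtDesc X r (𝟙 (X r)) fun j _ => 𝟙 (X j)
  let y := insertAtDesc X r (𝟙 (Y r)) fun j _ => f j
  have : IsIso x := isIso_insertAtDesc _ _ _ _ fun j _ => inferInstance
  have : IsIso y := isIso_insertAtDesc _ _ _ _ hf
  have e : x ≫ f = (insertAt X r).map (f r) ≫ y := by
    rw [insertAt_map_desc, insertAtDesc_comp]; simp
  have e' : f = inv x ≫ (insertAt X r).map (f r) ≫ y := by rw [← e, IsIso.inv_hom_id_assoc]
  rw [e', F.map_comp, F.map_comp]
  exact D.weq_comp _ _ (D.weq_of_isIso _)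
    (D.weq_comp _ _ ((hF.exact X r).map_weq _ hw) (D.weq_of_isIso _))

/-- A multiexact functor preserves weak equivalences. -/
theorem IsMultiexact.weq (hF : IsMultiexact F) {X Y : ∀ i, C i} (f : X ⟶ Y)
    (hf : ∀ i, (C i).weq (f i)) : D.weq (F.map f) := by
  -- The induction is on a set `T` of directions outside of which `f` is an isomorphism.
  suffices h : ∀ (T : Finset (Fin k)) {X Y : ∀ i, C i} (f : X ⟶ Y), (∀ i, (C i).weq (f i)) →
      (∀ i ∉ T, IsIso (f i)) → D.weq (F.map f) from
    h Finset.univ f hf fun i hi => (hi (Finset.mem_univ i)).elim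
  intro T
  induction T using Finset.induction_on with
  | empty =>
    intro X Y f _ hi
    have : IsIso f := (isIso_pi_iff f).2 fun i => hi i (Finset.notMem_empty i)
    exact D.weq_of_isIso _
  | insert r T hr ih =>
    intro X Y f hf hi
    -- The intermediate object has `r`-th component `X r` and all others from `Y`. Thus `a` leaves
    -- the direction `r` alone and falls under the induction hypothesis, while `b` changes only the
    -- direction `r`.
    have key : ∀ i, ∃ (Z : C i) (a : X i ⟶ Z) (b : Z ⟶ Y i), a ≫ b = f i ∧ (C i).weq a ∧
        (C i).weq b ∧ (i ∉ T → IsIso a) ∧ (i ≠ r → IsIso b) := fun i => by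
      by_cases h : i = r
      · exact ⟨X i, 𝟙 _, f i, Category.id_comp _, (C i).weq_of_isIso _, hf i,
          fun _ => inferInstance, fun h' => (h' h).elim⟩
      · exact ⟨Y i, f i, 𝟙 _, Category.comp_id _, hf i, (C i).weq_of_isIso _,
          fun h' => hi i fun h'' => (Finset.mem_insert.1 h'').elim h h', fun _ => inferInstance⟩
    choose Z a b hab ha hb ha' hb' using key
    have e : f = (show X ⟶ Z from a) ≫ (show Z ⟶ Y from b) := funext fun i => (hab i).symm
    rw [e, F.map_comp]
    exact D.weq_comp _ _ (ih _ ha ha') (hF.weq_of_isIso_of_ne r hb' (hb r))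

end MultiexactBasic

/-! ### Multiexact functors preserve cofibrant systems -/

section Desc

variable {C : WaldCat.{u}} {P : Type} [PartialOrder P]

/-- The value of a cofibrant system at `A` is the colimit of its values on the principal lower
subsets of `A`. -/
theorem CofSystem.existsUnique_desc_of_mem [Finite P] (S : CofSystem C P) {Z : C}
    (A : LowerSet P) (f : ∀ p ∈ A, S.obj (LowerSet.Iic p) ⟶ Z)
    (hf : ∀ p q (h : p ≤ q) (hq : q ∈ A),
      S.m (iic_mono h) ≫ f q hq = f p (A.lower h hq)) :
    ∃! g : S.obj A ⟶ Z, ∀ p (hp : p ∈ A), S.m (LowerSet.Iic_le.2 hp) ≫ g = f p hp := by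
  classical
  induction A using WellFoundedLT.induction with
  | ind A ih =>
  by_cases hA : A = ⊥
  · subst hA
    refine ⟨S.bot.to_ Z, fun p hp => absurd hp (by simp), fun g _ => S.bot.eq_of_src _ _⟩
  · obtain ⟨p, hp, hmax⟩ := exists_maximal_of_ne_bot hA
    -- Removing a maximal element writes the value at `A` as a pushout of values at smaller lower
    -- sets and at a principal one.
    have hsup : A = A.erase p ⊔ LowerSet.Iic p := (LowerSet.erase_sup_Iic hp hmax).symm
    have hlt : A.erase p < A := LowerSet.erase_lt.2 hp
    have hlt' : A.erase p ⊓ LowerSet.Iic p < A := lt_of_le_of_lt inf_le_left hlt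
    obtain ⟨g, hg, hg'⟩ := ih _ hlt (fun q hq => f q (hlt.le hq)) fun q q' h hq => hf q q' h _
    obtain ⟨t, ht, ht'⟩ := ih _ hlt' (fun q hq => f q (hlt'.le hq)) fun q q' h hq => hf q q' h _
    have po := S.isPushout (rfl : A.erase p ⊓ LowerSet.Iic p = _) hsup inf_le_left inf_le_right
      hlt.le (LowerSet.Iic_le.2 hp)
    -- Both sides restrict to the same compatible family on the intersection, so they agree by the
    -- uniqueness part of the induction hypothesis there.
    have hcomm : S.m (inf_le_left : A.erase p ⊓ LowerSet.Iic p ≤ A.erase p) ≫ g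
        = S.m (inf_le_right : A.erase p ⊓ LowerSet.Iic p ≤ LowerSet.Iic p) ≫ f p hp := by
      refine (ht' _ (fun r hr => ?_)).trans (ht' _ (fun r hr => ?_)).symm
      · rw [S.m_comp_assoc]; exact hg r hr.1
      · rw [S.m_comp_assoc]; exact hf r p hr.2 hp
    refine ⟨po.desc g (f p hp) hcomm, fun r hr => ?_, fun g' hg₁ => ?_⟩
    · by_cases hrp : r = p
      · subst hrp; exact po.inr_desc _ _ _
      · have hr' : r ∈ A.erase p := ⟨hr, fun h : p ≤ r => hrp (hmax r hr h)⟩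
        have := po.inl_desc g (f p hp) hcomm
        rw [← hg r hr']
        conv_rhs => rw [← this]
        rw [S.m_comp_assoc]
    · apply po.hom_ext
      · rw [po.inl_desc]
        refine hg' _ (fun r hr => ?_)
        rw [S.m_comp_assoc]; exact hg₁ r _
      · rw [po.inr_desc]; exact hg₁ p hp

end Desc

/-! ### Values of a multiexact functor on boxes of lower sets, as colimits over points -/

section Box

variable {k : ℕ} {C : Fin k → WaldCat.{u}} {D : WaldCat.{u}} {P : Fin k → Type}
  [∀ i, PartialOrder (P i)]

/-- The value of a functor of several variables on the values of cofibrant systems. -/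
def boxObj (S : ∀ i, CofSystem (C i) (P i)) (F : (∀ i, C i) ⥤ D) (A : ∀ i, LowerSet (P i)) : D :=
  F.obj fun i => (S i).obj (A i)

/-- The transition maps of `boxObj`. -/
def boxMap (S : ∀ i, CofSystem (C i) (P i)) (F : (∀ i, C i) ⥤ D) {A B : ∀ i, LowerSet (P i)}
    (h : A ≤ B) : boxObj S F A ⟶ boxObj S F B :=
  F.map (X := fun i => (S i).obj (A i)) (Y := fun i => (S i).obj (B i)) fun i => (S i).m (h i)

variable {S : ∀ i, CofSystem (C i) (P i)} {F : (∀ i, C i) ⥤ D}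

theorem boxMap_comp {A B E : ∀ i, LowerSet (P i)} (h : A ≤ B) (h' : B ≤ E) :
    boxMap S F h ≫ boxMap S F h' = boxMap S F (h.trans h') := by
  refine (F.map_comp _ _).symm.trans (congrArg F.map ?_)
  exact funext fun i => (S i).m_comp _ _

theorem boxMap_comp_assoc {A B E : ∀ i, LowerSet (P i)} (h : A ≤ B) (h' : B ≤ E) {Z : D}
    (f : boxObj S F E ⟶ Z) :
    boxMap S F h ≫ boxMap S F h' ≫ f = boxMap S F (h.trans h') ≫ f := by
  rw [← Category.assoc, boxMap_comp]

theorem boxMap_refl {A : ∀ i, LowerSet (P i)} (h : A ≤ A) : boxMap S F h = 𝟙 _ := by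
  refine Eq.trans (congrArg F.map ?_) (F.map_id _)
  exact funext fun i => (S i).m_refl _

/-- `boxObj` is a colimit in each variable. -/
theorem IsMultiexact.existsUnique_box_update [∀ i, Finite (P i)] (hF : IsMultiexact F)
    (A : ∀ i, LowerSet (P i)) (r : Fin k) {Z : D}
    (f : ∀ B ≤ A, (∃ p, B r = LowerSet.Iic p) → (∀ j, j ≠ r → B j = A j) → (boxObj S F B ⟶ Z))
    (hf : ∀ B B' (h : B ≤ B') h₁ h₂ h₃ h₁' h₂' h₃',
      boxMap S F h ≫ f B' h₁ h₂ h₃ = f B h₁' h₂' h₃') :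
    ∃! g : boxObj S F A ⟶ Z, ∀ B h₁ h₂ h₃, boxMap S F h₁ ≫ g = f B h₁ h₂ h₃ := by
  classical
  let X : ∀ i, C i := fun i => (S i).obj (A i)
  let U : LowerSet (P r) → ∀ i, LowerSet (P i) := fun E => Function.update A r E
  have hUr : ∀ E, U E r = E := fun E => Function.update_self _ _ _
  have hUj : ∀ E j, j ≠ r → U E j = A j := fun E j h => Function.update_of_ne h _ _
  have hU : ∀ {E E'}, E ≤ E' → U E ≤ U E' := fun h => Function.update_mono h
  have hUA : ∀ {E}, E ≤ A r → U E ≤ A := fun {E} h i => by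
    by_cases hi : i = r
    · subst hi; rw [hUr]; exact h
    · rw [hUj E i hi]
  -- With the other variables frozen the functor is exact, so it carries `S r` to a cofibrant system
  -- `T`, whose values are colimits over principal lower sets.
  let G := insertAt X r ⋙ F
  let T := (S r).mapExact G (hF.exact X r)
  -- Inserting an object into a tuple and updating the tuple of lower sets do not agree
  -- definitionally; `φ` is the natural isomorphism between the two resulting systems.
  let φ : ∀ E, T.obj E ⟶ boxObj S F (U E) := fun E =>
    F.map (insertAtDesc X r (Y := fun i => (S i).obj (U E i)) ((S r).m (hUr E).ge)
      fun j h => (S j).m (hUj E j h).ge)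
  have hφi : ∀ E, IsIso (φ E) := fun E => by
    have : IsIso (insertAtDesc X r (Y := fun i => (S i).obj (U E i)) ((S r).m (hUr E).ge)
        fun j h => (S j).m (hUj E j h).ge) := by
      have := ((S r).isoOfEq (hUr E).symm).isIso_hom
      refine @isIso_insertAtDesc _ _ _ _ _ _ _ _ this fun j h =>
        ((S j).isoOfEq (hUj E j h).symm).isIso_hom
    exact Functor.map_isIso _ _
  have hφ : ∀ {E E' : LowerSet (P r)} (h : E ≤ E'),
      T.m h ≫ φ E' = φ E ≫ boxMap S F (hU h) := fun {E E'} h => by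
    refine (F.map_comp _ _).symm.trans (Eq.trans (congrArg F.map ?_) (F.map_comp _ _))
    rw [insertAt_map_desc, insertAtDesc_comp]
    congr 1
    · rw [(S r).m_comp, (S r).m_comp]
    · funext j hj
      rw [(S j).m_comp]
  have hAA : U (A r) = A := Function.update_eq_self _ _
  let ψ : T.obj (A r) ⟶ boxObj S F A := φ (A r) ≫ boxMap S F hAA.le
  have hψ : IsIso ψ := by
    have h1 := hφi (A r)
    have h2 : IsIso (boxMap S F hAA.le) := ⟨boxMap S F hAA.ge, by rw [boxMap_comp, boxMap_refl],
      by rw [boxMap_comp, boxMap_refl]⟩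
    exact IsIso.comp_isIso
  have hψφ : ∀ {E} (h : E ≤ A r), T.m h ≫ ψ = φ E ≫ boxMap S F (hUA h) := fun {E} h => by
    rw [← Category.assoc, hφ, Category.assoc, boxMap_comp]
  obtain ⟨g, hg, hg'⟩ := T.existsUnique_desc_of_mem (A r)
    (fun p hp => φ (LowerSet.Iic p) ≫ f (U (LowerSet.Iic p)) (hUA (LowerSet.Iic_le.2 hp))
      ⟨p, hUr _⟩ (hUj _))
    (fun p q h hq => by
      rw [← Category.assoc, hφ, Category.assoc]
      congr 1
      exact hf _ _ _ _ _ _ _ _ _)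
  refine ⟨inv ψ ≫ g, fun B h₁ h₂ h₃ => ?_, fun g' h => ?_⟩
  · obtain ⟨p, hp⟩ := h₂
    have hpA : p ∈ A r := h₁ r (by rw [hp]; exact le_rfl)
    -- A box that agrees with `A` off `r` and is principal in the direction `r` is one of the boxes
    -- `U (Iic p)` indexing the colimit.
    have hB : U (LowerSet.Iic p) = B := funext fun j => by
      by_cases hj : j = r
      · subst hj; rw [hUr, hp]
      · rw [hUj _ j hj, h₃ j hj]
    have h1 := hg p hpA
    have h2 : φ (LowerSet.Iic p) ≫ boxMap S F (hUA (LowerSet.Iic_le.2 hpA)) ≫ inv ψ ≫ g =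
        φ (LowerSet.Iic p) ≫ f (U (LowerSet.Iic p)) (hUA (LowerSet.Iic_le.2 hpA))
          ⟨p, hUr _⟩ (hUj _) := by
      rw [← h1, ← Category.assoc, ← hψφ, Category.assoc, IsIso.hom_inv_id_assoc]
    have h3 := (cancel_epi (φ (LowerSet.Iic p))).1 h2
    subst hB
    exact h3
  · rw [← cancel_epi ψ, IsIso.hom_inv_id_assoc]
    refine hg' _ fun p hp => ?_
    rw [← Category.assoc, hψφ, Category.assoc, h]

/-- Auxiliary: maps out of `boxObj` are determined by their restrictions to boxes which are
principal in the directions in `T`. -/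
theorem IsMultiexact.box_hom_ext_aux [∀ i, Finite (P i)] (hF : IsMultiexact F)
    (A : ∀ i, LowerSet (P i)) (T : Finset (Fin k)) {Z : D} {f g : boxObj S F A ⟶ Z}
    (h : ∀ B (hB : B ≤ A), (∀ i ∈ T, ∃ p, B i = LowerSet.Iic p) →
      boxMap S F hB ≫ f = boxMap S F hB ≫ g) : f = g := by
  induction T using Finset.induction_on with
  | empty =>
    have := h A le_rfl fun i hi => absurd hi (Finset.notMem_empty i)
    rwa [boxMap_refl, Category.id_comp, Category.id_comp] at this
  | insert r T hr ih =>
    refine ih fun B hB hT => ?_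
    -- Over the box `B` the two composites are compared through the colimit in the direction `r`.
    -- Its index boxes are also principal in the direction `r`, and there the hypothesis applies.
    refine (hF.existsUnique_box_update B r (fun E hE _ _ => boxMap S F (hE.trans hB) ≫ f)
      (fun E E' hE _ _ _ _ _ _ => boxMap_comp_assoc _ _ _)).unique
      (fun E hE _ _ => boxMap_comp_assoc _ _ _) (fun E hE h₂ h₃ => ?_)
    rw [boxMap_comp_assoc]
    refine (h E _ fun i hi => ?_).symm
    by_cases hir : i = r
    · subst hir; exact h₂
    · rw [h₃ i hir]
      exact hT i ((Finset.mem_insert.1 hi).resolve_left hir)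

/-- Auxiliary: construction of maps out of `boxObj` from boxes which are principal in the
directions in `T`. -/
theorem IsMultiexact.box_exists_desc_aux [∀ i, Finite (P i)] (hF : IsMultiexact F)
    (A : ∀ i, LowerSet (P i)) (T : Finset (Fin k)) {Z : D}
    (f : ∀ B ≤ A, (∀ i ∈ T, ∃ p, B i = LowerSet.Iic p) → (boxObj S F B ⟶ Z))
    (hf : ∀ B B' (h : B ≤ B') h₁ h₂ h₁' h₂', boxMap S F h ≫ f B' h₁ h₂ = f B h₁' h₂') :
    ∃ g : boxObj S F A ⟶ Z, ∀ B h₁ h₂, boxMap S F h₁ ≫ g = f B h₁ h₂ := by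
  induction T using Finset.induction_on with
  | empty =>
    exact ⟨f A le_rfl fun i hi => absurd hi (Finset.notMem_empty i), fun B h₁ h₂ => hf _ _ _ _ _ _ _⟩
  | insert r T hr ih =>
    have hP : ∀ (B : ∀ i, LowerSet (P i)) (_ : ∀ i ∈ T, ∃ p, B i = LowerSet.Iic p)
        (E : ∀ i, LowerSet (P i)) (_ : ∃ p, E r = LowerSet.Iic p) (_ : ∀ j, j ≠ r → E j = B j),
        ∀ i ∈ insert r T, ∃ p, E i = LowerSet.Iic p := fun B hT E h₂ h₃ i hi => by
      by_cases hir : i = r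
      · subst hir; exact h₂
      · rw [h₃ i hir]
        exact hT i ((Finset.mem_insert.1 hi).resolve_left hir)
    -- On each box principal in the directions of `T`, the given maps are glued along the direction
    -- `r`. This yields the family to which the induction hypothesis is applied.
    have key : ∀ B (hB : B ≤ A) (_ : ∀ i ∈ T, ∃ p, B i = LowerSet.Iic p),
        ∃ g : boxObj S F B ⟶ Z, ∀ E (hE : E ≤ B) (h : ∀ i ∈ insert r T, ∃ p, E i = LowerSet.Iic p),
          boxMap S F hE ≫ g = f E (hE.trans hB) h := fun B hB hT => by
      obtain ⟨g, hg, -⟩ := hF.existsUnique_box_update B r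
        (fun E hE h₂ h₃ => f E (hE.trans hB) (hP B hT E h₂ h₃))
        (fun E E' hE _ _ _ _ _ _ => hf _ _ _ _ _ _ _)
      refine ⟨g, fun E hE h => ?_⟩
      have hEr := h r (Finset.mem_insert_self _ _)
      classical
      -- The gluing controls only the boxes equal to `B` off `r`. An arbitrary `E ≤ B` is reached
      -- through `E ≤ E' ≤ B`, where `E'` is of that form.
      let E' : ∀ i, LowerSet (P i) := Function.update B r (E r)
      have hr' : E' r = E r := Function.update_self _ _ _
      have hj : ∀ j, j ≠ r → E' j = B j := fun j h => Function.update_of_ne h _ _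
      have hEE' : E ≤ E' := fun i => by
        by_cases hi : i = r
        · subst hi; exact hr'.ge
        · rw [hj i hi]; exact hE i
      have hE'B : E' ≤ B := fun i => by
        by_cases hi : i = r
        · subst hi; rw [hr']; exact hE i
        · exact (hj i hi).le
      have h2 : ∃ p, E' r = LowerSet.Iic p := by rw [hr']; exact hEr
      rw [← boxMap_comp hEE' hE'B, Category.assoc, hg E' hE'B h2 hj]
      exact hf _ _ _ _ _ _ _
    choose g hg using key
    -- The glued maps are compatible because maps out of a box are detected on boxes principal in
    -- all directions of `insert r T`.
    obtain ⟨t, ht⟩ := ih g (fun B B' h h₁ h₂ h₁' h₂' => by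
      refine hF.box_hom_ext_aux B (insert r T) fun E hE hT => ?_
      rw [boxMap_comp_assoc, hg _ _ _ _ _ hT, hg _ _ _ _ _ hT])
    refine ⟨t, fun B h₁ h₂ => ?_⟩
    have h3 : ∀ i ∈ T, ∃ p, B i = LowerSet.Iic p := fun i hi => h₂ i (Finset.mem_insert_of_mem hi)
    rw [ht B h₁ h3]
    have := hg B h₁ h3 B le_rfl h₂
    rwa [boxMap_refl, Category.id_comp] at this

theorem iic_le_box {A : ∀ i, LowerSet (P i)} {y : ∀ i, P i} (h : ∀ i, y i ∈ A i) :
    (fun i => LowerSet.Iic (y i)) ≤ A := fun i => LowerSet.Iic_le.2 (h i)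

theorem iic_le_iic {y z : ∀ i, P i} (h : y ≤ z) :
    (fun i => LowerSet.Iic (y i)) ≤ fun i => LowerSet.Iic (z i) := fun i => iic_mono (h i)

/-- The case of all directions: a box principal in every direction is given by a point. This is the
uniqueness half of the statement that the value on a box is a colimit over its points. -/
theorem IsMultiexact.box_hom_ext [∀ i, Finite (P i)] (hF : IsMultiexact F)
    (A : ∀ i, LowerSet (P i)) {Z : D} {f g : boxObj S F A ⟶ Z}
    (h : ∀ (y : ∀ i, P i) (hy : ∀ i, y i ∈ A i),
      boxMap S F (iic_le_box hy) ≫ f = boxMap S F (iic_le_box hy) ≫ g) : f = g := by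
  refine hF.box_hom_ext_aux A Finset.univ fun B hB hT => ?_
  choose y hy using fun i => hT i (Finset.mem_univ i)
  obtain rfl : B = fun i => LowerSet.Iic (y i) := funext hy
  exact h y fun i => hB i (show y i ≤ y i from le_rfl)

/-- The existence half of the same colimit property. The family is transported from points to boxes
principal in every direction, and the maps are then glued one direction at a time. -/
theorem IsMultiexact.box_exists_desc [∀ i, Finite (P i)] (hF : IsMultiexact F)
    (A : ∀ i, LowerSet (P i)) {Z : D}
    (f : ∀ y : ∀ i, P i, (∀ i, y i ∈ A i) → (boxObj S F (fun i => LowerSet.Iic (y i)) ⟶ Z))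
    (hf : ∀ y z (h : y ≤ z) hy hz, boxMap S F (iic_le_iic h) ≫ f z hz = f y hy) :
    ∃ g : boxObj S F A ⟶ Z, ∀ y hy, boxMap S F (iic_le_box hy) ≫ g = f y hy := by
  have key : ∀ B ≤ A, (∀ i ∈ Finset.univ, ∃ p, B i = LowerSet.Iic p) →
      ∃ y : ∀ i, P i, (∀ i, y i ∈ A i) ∧ B = fun i => LowerSet.Iic (y i) := fun B hB hT => by
    choose y hy using fun i => hT i (Finset.mem_univ i)
    exact ⟨y, fun i => hB i ((hy i).ge (show y i ≤ y i from le_rfl)), funext hy⟩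
  -- The generating points are chosen separately for each box, so the boxes agree with products of
  -- principal lower sets only propositionally. The extra `boxMap` in the family absorbs these
  -- equalities.
  choose y hyA hy using key
  obtain ⟨g, hg⟩ := hF.box_exists_desc_aux A Finset.univ
    (fun B h₁ h₂ => boxMap S F (hy B h₁ h₂).le ≫ f (y B h₁ h₂) (hyA B h₁ h₂))
    (fun B B' h h₁ h₂ h₁' h₂' => by
      have hle : y B h₁' h₂' ≤ y B' h₁ h₂ := fun i => by
        have h1 := (hy B h₁' h₂').ge.trans (h.trans (hy B' h₁ h₂).le) i
        exact LowerSet.Iic_le.1 h1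
      rw [← hf _ _ hle (hyA B h₁' h₂') (hyA B' h₁ h₂), boxMap_comp_assoc, boxMap_comp_assoc])
  refine ⟨g, fun z hz => ?_⟩
  have hT : ∀ i ∈ (Finset.univ : Finset (Fin k)), ∃ p, LowerSet.Iic (z i) = LowerSet.Iic p :=
    fun i _ => ⟨_, rfl⟩
  rw [hg _ (iic_le_box hz) hT]
  refine hf _ _ (fun i => ?_) _ _
  exact LowerSet.Iic_le.1 ((hy _ (iic_le_box hz) hT).le i)

end Box

/-! ### The strict lower set of a point in a product of posets, as a union of boxes -/

/-- The product of a family of posets. -/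
def PosetPi {k : ℕ} (P : Fin k → Type) : Type := ∀ i, P i

section PosetPi

variable {k : ℕ} {P : Fin k → Type} [∀ i, PartialOrder (P i)]

instance : PartialOrder (PosetPi P) := inferInstanceAs (PartialOrder (∀ i, P i))

instance [∀ i, Finite (P i)] : Finite (PosetPi P) := inferInstanceAs (Finite (∀ i, P i))

/-- The box of the elements of `∏ P i` whose `i`-th coordinate is less than `p i` if `ε i = 0`, and
at most `p i` if `ε i = 1`. -/
def cornerBox (p : ∀ i, P i) (ε : Grid fun _ : Fin k => 1) (i : Fin k) : LowerSet (P i) :=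
  if ε i = 0 then LowerSet.Iio (p i) else LowerSet.Iic (p i)

theorem cornerBox_zero (p : ∀ i, P i) (ε : Grid fun _ : Fin k => 1) {i : Fin k} (h : ε i = 0) :
    cornerBox p ε i = LowerSet.Iio (p i) := if_pos h

theorem cornerBox_one (p : ∀ i, P i) (ε : Grid fun _ : Fin k => 1) {i : Fin k} (h : ε i = 1) :
    cornerBox p ε i = LowerSet.Iic (p i) := if_neg fun h' => fin2_ne h' h

theorem cornerBox_mono (p : ∀ i, P i) {ε ε' : Grid fun _ : Fin k => 1} (h : ε ≤ ε') :
    cornerBox p ε ≤ cornerBox p ε' := fun i => by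
  rcases fin2_cases (ε' i) with h' | h'
  · rw [cornerBox_zero p ε' h', cornerBox_zero p ε (fin2_eq_zero (h i) h')]
  · rw [cornerBox_one p ε' h']
    rcases fin2_cases (ε i) with h'' | h''
    · rw [cornerBox_zero p ε h'']; exact iio_le _
    · rw [cornerBox_one p ε h'']

open Classical in
/-- The smallest corner of a box which contains `y`. -/
noncomputable def cornerOf (p y : ∀ i, P i) : Grid fun _ : Fin k => 1 :=
  fun i => if y i = p i then 1 else 0

theorem mem_cornerBox_cornerOf {p y : ∀ i, P i} (h : y ≤ p) (i : Fin k) :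
    y i ∈ cornerBox p (cornerOf p y) i := by
  by_cases hy : y i = p i
  · rw [cornerBox_one p _ (if_pos hy)]; exact h i
  · rw [cornerBox_zero p _ (if_neg hy)]; exact lt_of_le_of_ne (h i) hy

theorem cornerOf_le {p y : ∀ i, P i} {ε : Grid fun _ : Fin k => 1}
    (h : ∀ i, y i ∈ cornerBox p ε i) : cornerOf p y ≤ ε := fun i => by
  rcases fin2_cases (ε i) with h' | h'
  · have h1 := h i
    rw [cornerBox_zero p ε h'] at h1
    exact (if_neg (ne_of_lt h1)).trans_le (Fin.zero_le _)
  · rw [h']; exact Fin.le_last _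

/-- A point strictly below `p` differs from it in some coordinate. With `mem_cornerBox_cornerOf`, it
follows that the boxes of the corners `ε < ⊤` cover the points below `p`. -/
theorem cornerOf_lt_top {p y : ∀ i, P i} (h : y < p) : cornerOf p y < ⊤ := by
  refine lt_of_le_of_ne le_top fun h' => h.ne (funext fun i => ?_)
  by_contra hy
  have h1 : cornerOf p y i = 0 := if_neg hy
  rw [h'] at h1
  exact fin2_ne h1 rfl

/-- The opposite inclusion: some coordinate of `ε` is `0`, and it forces a strict inequality. These
boxes thus cover exactly the points that index the latching object at `p`. -/
theorem lt_of_mem_cornerBox {p y : ∀ i, P i} {ε : Grid fun _ : Fin k => 1} (hε : ε < ⊤)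
    (h : ∀ i, y i ∈ cornerBox p ε i) : y < p := by
  have hle : y ≤ p := fun i => by
    rcases fin2_cases (ε i) with h' | h'
    · have h1 := h i; rw [cornerBox_zero p ε h'] at h1; exact le_of_lt h1
    · have h1 := h i; rw [cornerBox_one p ε h'] at h1; exact h1
  refine lt_of_le_of_ne hle fun hy => hε.ne (funext fun i => ?_)
  rcases fin2_cases (ε i) with h' | h'
  · have h1 := h i
    rw [cornerBox_zero p ε h', hy] at h1
    exact (lt_irrefl _ h1).elim
  · exact h'

theorem cornerBox_top (p : ∀ i, P i) : cornerBox p ⊤ = fun i => LowerSet.Iic (p i) :=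
  funext fun _ => cornerBox_one p _ rfl

end PosetPi

/-! ### Latching maps of products, and the resulting cofibrant systems -/

section BoxSystem

variable {k : ℕ} {C : Fin k → WaldCat.{u}} {D : WaldCat.{u}} {P : Fin k → Type}
  [∀ i, PartialOrder (P i)] {S : ∀ i, CofSystem (C i) (P i)} {F : (∀ i, C i) ⥤ D}

/-- The diagram given by a monotone family of boxes. -/
def boxFunctor (S : ∀ i, CofSystem (C i) (P i)) (F : (∀ i, C i) ⥤ D) {T : Type} [PartialOrder T]
    (B : T → ∀ i, LowerSet (P i)) (hB : Monotone B) : T ⥤ D where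
  obj t := boxObj S F (B t)
  map h := boxMap S F (hB (leOfHom h))
  map_id _ := boxMap_refl _
  map_comp _ _ := (boxMap_comp _ _).symm

/-- Up to isomorphism this diagram is the image under `F` of the cube spanned by the cofibrations `φ
i`, which the cube axiom makes cubically cofibrant. This is where that axiom enters the construction
of latching maps. -/
theorem IsMultiexact.isSystem_cornerBox (hF : IsMultiexact F) (p : ∀ i, P i) :
    IsSystem (boxFunctor S F (cornerBox p) fun _ _ h => cornerBox_mono p h) := by
  let φ : ∀ i, (S i).obj (LowerSet.Iio (p i)) ⟶ (S i).obj (LowerSet.Iic (p i)) := fun i =>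
    (S i).m (iio_le (p i))
  have hX := (hF.cube φ fun i => (S i).cof _).isSystem
  -- For a variable vertex `a`, neither the arrow `φ i` viewed as a functor nor the `if` in
  -- `cornerBox` reduces. They are identified at `0` and at `1` separately, and naturality is then
  -- checked on the possible pairs of vertices.
  have key : ∀ (i : Fin k) (a : Fin 2), ∃ e : (ComposableArrows.mk₁ (φ i)).obj a ≅
      (S i).obj (if a = 0 then LowerSet.Iio (p i) else LowerSet.Iic (p i)),
      (∀ h : a = 0, e.hom = eqToHom (by subst h; rfl)) ∧
      (∀ h : a = 1, e.hom = eqToHom (by subst h; rfl)) := fun i a => by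
    rcases fin2_cases a with h | h
    · subst h
      exact ⟨eqToIso rfl, fun _ => rfl, fun h => absurd h (by decide)⟩
    · subst h
      exact ⟨eqToIso rfl, fun h => absurd h (by decide), fun _ => rfl⟩
  choose e he₀ he₁ using key
  have hnat : ∀ (i : Fin k) (a b : Fin 2) (h : a ≤ b) (h' : (if a = 0 then LowerSet.Iio (p i) else
      LowerSet.Iic (p i)) ≤ if b = 0 then LowerSet.Iio (p i) else LowerSet.Iic (p i)),
      (ComposableArrows.mk₁ (φ i)).map (homOfLE h) ≫ (e i b).hom = (e i a).hom ≫ (S i).m h' := by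
    intro i a b h h'
    rcases fin2_cases a with ha | ha <;> rcases fin2_cases b with hb | hb
    · subst ha hb
      rw [he₀ i 0 rfl, show (homOfLE h : (0 : Fin 2) ⟶ 0) = 𝟙 _ from rfl,
        CategoryTheory.Functor.map_id]
      refine (Category.id_comp _).trans ?_
      exact ((congrArg _ ((S i).m_refl _)).trans (Category.comp_id _)).symm
    · subst ha hb
      rw [he₀ i 0 rfl, he₁ i 1 rfl]
      exact (Category.comp_id _).trans (Category.id_comp _).symm
    · subst ha hb; exact absurd h (by decide)
    · subst ha hb
      rw [he₁ i 1 rfl, show (homOfLE h : (1 : Fin 2) ⟶ 1) = 𝟙 _ from rfl,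
        CategoryTheory.Functor.map_id]
      refine (Category.id_comp _).trans ?_
      exact ((congrArg _ ((S i).m_refl _)).trans (Category.comp_id _)).symm
  refine hX.reindex OrderHom.id (fun x x' => ⟨x ⊓ x', inf_le_left, inf_le_right,
    fun y h h' => le_inf h h'⟩) _ (fun x => F.mapIso (Pi.isoMk fun i => e i (x i))) ?_
  intro x y h
  refine (F.map_comp _ _).symm.trans (Eq.trans (congrArg F.map ?_) (F.map_comp _ _))
  exact funext fun i => hnat i _ _ (h i) _

/-- The latching maps of the values of a multiexact functor on cofibrant systems. -/
theorem IsMultiexact.exists_latching [∀ i, Finite (P i)] (hF : IsMultiexact F) (p : ∀ i, P i) :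
    ∃ (L : D) (ι : ∀ y : ∀ i, P i, y < p → (boxObj S F (fun i => LowerSet.Iic (y i)) ⟶ L))
      (t : L ⟶ boxObj S F fun i => LowerSet.Iic (p i)),
      (∀ (y z : ∀ i, P i) (h : y ≤ z) (hz : z < p),
        boxMap S F (iic_le_iic h) ≫ ι z hz = ι y (lt_of_le_of_lt h hz)) ∧
      (∀ {Z : D} (f : ∀ y : ∀ i, P i, y < p → (boxObj S F (fun i => LowerSet.Iic (y i)) ⟶ Z)),
        (∀ (y z : ∀ i, P i) (h : y ≤ z) (hz : z < p),
          boxMap S F (iic_le_iic h) ≫ f z hz = f y (lt_of_le_of_lt h hz)) →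
        ∃ g : L ⟶ Z, ∀ y hy, ι y hy ≫ g = f y hy) ∧
      (∀ {Z : D} {f g : L ⟶ Z}, (∀ y hy, ι y hy ≫ f = ι y hy ≫ g) → f = g) ∧
      (∀ y hy, ι y hy ≫ t = boxMap S F (iic_le_iic hy.le)) ∧ D.cof t := by
  -- The latching object will be `K.obj (Iio ⊤)`, the colimit of the corner cube without its last
  -- vertex.
  obtain ⟨K, ⟨E⟩⟩ := hF.isSystem_cornerBox (S := S) p
  obtain ⟨e, he⟩ : ∃ e : ∀ ε, K.obj (LowerSet.Iic ε) ≅ boxObj S F (cornerBox p ε),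
      ∀ {ε ε' : Grid fun _ : Fin k => 1} (h : ε ≤ ε'),
        K.m (iic_mono h) ≫ (e ε').hom = (e ε).hom ≫ boxMap S F (cornerBox_mono p h) :=
    ⟨fun ε => E.e ε, fun h => E.he h⟩
  have he' : ∀ {ε ε' : Grid fun _ : Fin k => 1} (h : ε ≤ ε'),
      boxMap S F (cornerBox_mono p h) ≫ (e ε').inv = (e ε).inv ≫ K.m (iic_mono h) :=
    fun {ε ε'} h => by
      rw [← cancel_epi (e ε).hom, ← Category.assoc, ← he h]
      simp
  have hlt : ∀ {ε : Grid fun _ : Fin k => 1}, ε < ⊤ → LowerSet.Iic ε ≤ LowerSet.Iio ⊤ :=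
    fun h => LowerSet.Iic_le.2 h
  let j : ∀ (y : ∀ i, P i) (ε : Grid fun _ : Fin k => 1) (_ : ε < ⊤)
      (_ : ∀ i, y i ∈ cornerBox p ε i), boxObj S F (fun i => LowerSet.Iic (y i)) ⟶
        K.obj (LowerSet.Iio ⊤) :=
    fun y ε hε hy => boxMap S F (iic_le_box hy) ≫ (e ε).inv ≫ K.m (hlt hε)
  -- Enlarging the corner does not change the map. It follows that a map to `K.obj (Iio ⊤)` defined
  -- through the smallest corner agrees with the one through any other admissible corner.
  have hj : ∀ (y : ∀ i, P i) {ε ε' : Grid fun _ : Fin k => 1} (h : ε ≤ ε') hε hε' hy hy',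
      j y ε hε hy = j y ε' hε' hy' := fun y ε ε' h hε hε' hy hy' => by
    change _ = boxMap S F (iic_le_box hy') ≫ (e ε').inv ≫ K.m (hlt hε')
    rw [← boxMap_comp (iic_le_box hy) (cornerBox_mono p h), Category.assoc,
      ← Category.assoc (boxMap S F (cornerBox_mono p h)), he' h, Category.assoc, K.m_comp]
  let ι : ∀ y : ∀ i, P i, y < p →
      (boxObj S F (fun i => LowerSet.Iic (y i)) ⟶ K.obj (LowerSet.Iio ⊤)) := fun y hy =>
    j y (cornerOf p y) (cornerOf_lt_top hy) (mem_cornerBox_cornerOf hy.le)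
  have hι : ∀ (y : ∀ i, P i) (hy : y < p) ε hε hyε, ι y hy = j y ε hε hyε :=
    fun y hy ε hε hyε => hj y (cornerOf_le hyε) (cornerOf_lt_top hy) hε
      (mem_cornerBox_cornerOf hy.le) hyε
  refine ⟨_, ι, K.m (iio_le ⊤) ≫ (e ⊤).hom ≫ boxMap S F (cornerBox_top p).le, ?_, ?_, ?_, ?_, ?_⟩
  · intro y z h hz
    have hyz : ∀ i, y i ∈ cornerBox p (cornerOf p z) i := fun i =>
      (cornerBox p (cornerOf p z) i).lower (h i) (mem_cornerBox_cornerOf hz.le i)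
    rw [hι y (lt_of_le_of_lt h hz) _ (cornerOf_lt_top hz) hyz]
    exact boxMap_comp_assoc _ _ _
  · intro Z f hf
    -- The descent has two stages: first from points to each corner box, by the colimit property of
    -- boxes, and then from corner boxes to the punctured cube, by the colimit property of `K`.
    have key : ∀ ε : Grid fun _ : Fin k => 1, ε < ⊤ → ∃ g : boxObj S F (cornerBox p ε) ⟶ Z,
        ∀ (y : ∀ i, P i) hy (h : y < p), boxMap S F (iic_le_box hy) ≫ g = f y h :=
      fun ε hε => by
        obtain ⟨g, hg⟩ := hF.box_exists_desc (S := S) (cornerBox p ε)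
          (fun y hy => f y (lt_of_mem_cornerBox hε hy)) (fun y z h hy hz => hf y z h _)
        exact ⟨g, fun y hy _ => hg y hy⟩
    choose g hg using key
    obtain ⟨t, ht, -⟩ := K.existsUnique_desc_of_mem (LowerSet.Iio ⊤)
      (fun ε hε => (e ε).hom ≫ g ε hε) (fun ε ε' h hε => by
        rw [← Category.assoc, he h, Category.assoc]
        congr 1
        refine hF.box_hom_ext (S := S) (cornerBox p ε) fun y hy => ?_
        have h1 := lt_of_mem_cornerBox (lt_of_le_of_lt h hε) hy
        exact (boxMap_comp_assoc _ _ _).trans ((hg ε' hε y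
          (fun i => cornerBox_mono p h i (hy i)) h1).trans (hg ε _ y hy h1).symm))
    refine ⟨t, fun y hy => ?_⟩
    change (_ ≫ _ ≫ _) ≫ t = _
    rw [Category.assoc, Category.assoc, ht _ (cornerOf_lt_top hy), Iso.inv_hom_id_assoc]
    exact hg _ _ y (mem_cornerBox_cornerOf hy.le) hy
  · intro Z f g h
    -- Uniqueness uses the same two stages: equality is tested on each corner, and then at the
    -- points of its box.
    refine (K.existsUnique_desc_of_mem (LowerSet.Iio ⊤) (fun ε hε => K.m (hlt hε) ≫ f)
      (fun ε ε' h hε => K.m_comp_assoc _ _ _)).unique (fun ε hε => rfl) fun ε hε => ?_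
    rw [← cancel_epi (e ε).inv]
    refine hF.box_hom_ext (S := S) (cornerBox p ε) fun y hy => ?_
    have h1 := h y (lt_of_mem_cornerBox hε hy)
    rw [hι y (lt_of_mem_cornerBox hε hy) ε hε hy] at h1
    simp only [j, Category.assoc] at h1
    exact h1.symm
  · intro y hy
    change (_ ≫ _ ≫ _) ≫ _ ≫ _ = _
    rw [Category.assoc, Category.assoc, K.m_comp_assoc, ← Category.assoc (K.m _),
      he (le_top : cornerOf p y ≤ ⊤), Category.assoc, Iso.inv_hom_id_assoc, boxMap_comp,
      boxMap_comp]
  · have h2 : IsIso (boxMap S F (cornerBox_top p).le) := ⟨boxMap S F (cornerBox_top p).ge,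
      by rw [boxMap_comp, boxMap_refl], by rw [boxMap_comp, boxMap_refl]⟩
    exact D.cof_comp _ _ (K.cof _) (D.cof_comp _ _ (D.cof_of_isIso _) (D.cof_of_isIso _))

/-- This repackages `IsMultiexact.exists_latching` as a `Col` over the points strictly below `p`,
whose comparison map with the value at `p` is the cofibration `t`. -/
theorem IsMultiexact.latching [∀ i, Finite (P i)] (hF : IsMultiexact F) :
    Latching (boxFunctor S F (T := PosetPi P) (fun y i => LowerSet.Iic (y i))
      fun _ _ h => iic_le_iic h) := by
  intro p
  obtain ⟨L, ι, t, h₁, h₂, h₃, h₄, h₅⟩ := hF.exists_latching (S := S) p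
  let c : Col (boxFunctor S F (T := PosetPi P) (fun y i => LowerSet.Iic (y i))
      fun _ _ h => iic_le_iic h) (LowerSet.Iio p) :=
    { pt := L
      ι := ι
      w := fun {y z} h hz => h₁ y z h hz
      exists_desc := fun f hf => h₂ f fun _ _ h hz => hf h hz
      hom_ext := fun h => h₃ h }
  refine ⟨c, ?_⟩
  have : c.m (Col.iic _ p) (iio_le p) = t := c.hom_ext fun y hy => by
    rw [Col.ι_m]
    exact (h₄ y hy).symm
  rw [this]
  exact h₅

/-- A multiexact functor takes diagrams which extend to cofibrant systems to such a diagram. -/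
theorem IsMultiexact.isSystem [∀ i, Finite (P i)] (hF : IsMultiexact F) {X : ∀ i, P i ⥤ C i}
    (hX : ∀ i, IsSystem (X i)) {Q : Type} [PartialOrder Q] (π : Q →o PosetPi P) (hπ : MeetPres π) :
    IsSystem (Functor.pi' (fun i => Monotone.functor (f := fun y => π y i)
      (fun _ _ h => π.monotone h i) ⋙ X i) ⋙ F) := by
  choose S hS using hX
  let E : ∀ i, (S i).Extends (X i) := fun i => (hS i).some
  -- The diagram on the full product satisfies the latching condition and hence extends to a
  -- cofibrant system; this passes to `Q` along the meet preserving map `π`.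
  refine (Latching.isSystem (hF.latching (S := S))).reindex π hπ _
    (fun y => F.mapIso (Pi.isoMk fun i => (E i).e (π y i))) fun {x y} h => ?_
  refine (F.map_comp _ _).symm.trans (Eq.trans (congrArg F.map ?_) (F.map_comp _ _))
  exact funext fun i => (E i).he _

/-! ### Multiexact functors and the iterated S-construction -/

/-- The projection of `Ar[m]ⁿ` onto the factors indexed by `f`. -/
def ArGrid.proj {n q m : ℕ} (f : Fin q → Fin n) :
    (ArGrid fun _ : Fin n => m) →o ArGrid fun _ : Fin q => m where
  toFun y l := y (f l)
  monotone' _ _ h l := h (f l)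

/-- Multiexact functors preserve the objects of the iterated S-construction. -/
theorem IsMultiexact.inS (hF : IsMultiexact F) {q : Fin k → ℕ} {n m : ℕ}
    (e : (Σ i, Fin (q i)) ≃ Fin n) (A : ∀ i, (ArGrid fun _ : Fin (q i) => m) ⥤ C i)
    (hA : ∀ i, InS (A i)) :
    InS (Functor.pi' (fun i => (ArGrid.proj fun l => e ⟨i, l⟩).monotone.functor ⋙ A i) ⋙ F) where
  zero y := fun ⟨r, hr⟩ => by
    obtain ⟨⟨i, l⟩, rfl⟩ := e.surjective r
    exact hF.zero _ ⟨i, (hA i).zero _ ⟨l, hr⟩⟩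
  cof := by
    -- The bijection `e` splits the coordinates of the grid into `k` groups, so `π` regards the grid
    -- as a product of grids. It preserves meets because they are taken coordinatewise.
    let π : Grid (fun _ : Fin n => m) →o PosetPi fun i => Grid fun _ : Fin (q i) => m :=
      ⟨fun y i l => y (e ⟨i, l⟩), fun _ _ h i l => h (e ⟨i, l⟩)⟩
    have hπ : MeetPres π := fun x x' => ⟨x ⊓ x', inf_le_left, inf_le_right,
      fun y h h' i l => le_inf (h i l) (h' i l)⟩
    exact (hF.isSystem (fun i => (hA i).cof.isSystem) π hπ).isCubicallyCofibrant
  pushout y r i j l hij hjl := by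
    obtain ⟨⟨s, r⟩, rfl⟩ := e.surjective r
    have h : ∀ a, ArGrid.proj (fun l => e ⟨s, l⟩) (y.set (e ⟨s, r⟩) a) =
        (ArGrid.proj (fun l => e ⟨s, l⟩) y).set r a := fun a =>
      ArGrid.eq_set (ArGrid.set_self y _ _) fun l hl => ArGrid.set_ne _ (fun h => hl (by
        have := e.injective h
        simpa using this)) _
    -- Changing the coordinate `e ⟨s, r⟩` does not affect the arguments other than the `s`-th, so
    -- those components of the square are isomorphisms.
    have h' : ∀ t, t ≠ s → ∀ a b, ArGrid.proj (fun l => e ⟨t, l⟩) (y.set (e ⟨s, r⟩) a) =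
        ArGrid.proj (fun l => e ⟨t, l⟩) (y.set (e ⟨s, r⟩) b) := fun t ht a b => by
      have : ∀ a, ArGrid.proj (fun l => e ⟨t, l⟩) (y.set (e ⟨s, r⟩) a) =
          ArGrid.proj (fun l => e ⟨t, l⟩) y := fun a => funext fun l =>
        ArGrid.set_ne _ (fun h => ht (congrArg Sigma.fst (e.injective h))) _
      rw [this, this]
    refine hF.isPushout s (funext fun t => (map_comp_le (A t) _ _).trans (map_comp_le (A t) _ _).symm)
      (fun t ht => (isoOfEq (A t) (h' t ht _ _)).isIso_hom)
      (fun t ht => (isoOfEq (A t) (h' t ht _ _)).isIso_hom)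
      (fun t ht => (isoOfEq (A t) (h' t ht _ _)).isIso_hom)
      (isPushout_congr (A s) (h _) (h _) (h _) (h _)
        ((hA s).pushout (ArGrid.proj (fun l => e ⟨s, l⟩) y) r i j l hij hjl) _ _ _ _)
      -- The edge `(i, j) → (i, l)` does not move first coordinates, so it is a cofibration, as
      -- exactness in the variable `s` requires.
      ((hA s).cof_map _ fun t => ?_)
    refine (congrArg (fun z : ArGrid fun _ : Fin (q s) => m => (z t).fst) (h _)).trans (Eq.trans ?_
      (congrArg (fun z : ArGrid fun _ : Fin (q s) => m => (z t).fst) (h _)).symm)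
    by_cases ht : t = r
    · subst ht; rw [ArGrid.set_self, ArGrid.set_self]; rfl
    · rw [ArGrid.set_ne _ ht, ArGrid.set_ne _ ht]

end BoxSystem

/-! ### The action on K-theory -/

/-- Equality of the endpoints is needed in addition to the `HEq` of the components: only after
identifying them can the components be compared as an equality of morphisms. -/
theorem pi_hom_heq {k : ℕ} {C : Fin k → WaldCat.{u}} {A A' B B' : ∀ i, C i} (hA : A = A')
    (hB : B = B') {f : A ⟶ B} {g : A' ⟶ B'} (h : ∀ i, HEq (f i) (g i)) : HEq f g := by
  subst hA hB
  exact heq_of_eq (funext fun i => eq_of_heq (h i))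

theorem IsExtZero.congr {C : WaldCat.{u}} {T : Type} [PartialOrder T] {F X X' : T ⥤ C}
    {U U' : Set T} (h : IsExtZero F X U) (hX : X = X') (hU : U = U') : IsExtZero F X' U' := by
  subst hX hU; exact h

/-! ### Evaluation of an algebra on diagrams -/

section Ev

variable {M : SymMulticat.{v, u}} (C : WaldAlgebraData M) {k : ℕ} {x : Fin k → M.Ob} {y : M.Ob}

theorem WaldAlgebraData.ev_map {T : Type} [SmallCategory T] (f : T ⥤ M.Hom x y)
    (Z : ∀ i, T ⥤ C.obj (x i)) {s t : T} (h : s ⟶ t) :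
    (C.ev f Z).map h = ((C.act x y).map (f.map h)).1.app (fun i => (Z i).obj s) ≫
      ((C.act x y).obj (f.obj t)).F.map (X := fun i => (Z i).obj s) (Y := fun i => (Z i).obj t)
        (fun i => (Z i).map h) := rfl

/-- Outside the intersection of the supports some argument is `*`, and a multiexact functor then
takes the value `*` exactly. This strictness makes the action compatible with suspensions on the
nose. -/
theorem IsExtZero.ev {T : Type} [PartialOrder T] (f : T ⥤ M.Hom x y)
    {Z Y : ∀ i, T ⥤ C.obj (x i)} {U : Fin k → Set T} (h : ∀ i, IsExtZero (Z i) (Y i) (U i)) :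
    IsExtZero (C.ev f Z) (C.ev f Y) {a | ∀ i, a ∈ U i} where
  pos a ha := congrArg ((C.act x y).obj (f.obj a)).F.obj (funext fun i => (h i).pos a (ha i))
  neg a ha := by
    obtain ⟨i, hi⟩ := not_forall.1 ha
    exact ((C.act x y).obj (f.obj a)).isMultiexact.zero _ ⟨i, (h i).neg a hi⟩
  map {a b} t ha hb := by
    have hZ : ∀ a, (∀ i, a ∈ U i) → (fun i => (Z i).obj a) = fun i => (Y i).obj a :=
      fun a ha => funext fun i => (h i).pos a (ha i)
    -- The endpoints are generalized because the values of `Z` and `Y` agree only propositionally;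
    -- after substitution the claim is trivial.
    have key : ∀ {A A' B B' : ∀ i, C.obj (x i)} (hA : A = A') (hB : B = B') (φ : A ⟶ B)
        (φ' : A' ⟶ B'), HEq φ φ' →
        HEq (((C.act x y).map (f.map t)).1.app A ≫ ((C.act x y).obj (f.obj b)).F.map φ)
          (((C.act x y).map (f.map t)).1.app A' ≫ ((C.act x y).obj (f.obj b)).F.map φ') := by
      intro A A' B B' hA hB φ φ' hφ
      subst hA hB
      cases hφ
      rfl
    exact key (hZ a ha) (hZ b hb) _ _
      (pi_hom_heq (hZ a ha) (hZ b hb) fun i => (h i).map t (ha i) (hb i))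

/-- The diagram `(t, u) ↦ f_t (Z₁ (t, u ∘ e₁), …, Z_k (t, u ∘ e_k))`. -/
def smashDiagram {q : Fin k → ℕ} {n m : ℕ} (ν : Fin (m + 1) ⥤ M.Hom x y)
    (e : (Σ i, Fin (q i)) → Fin n) (Z : ∀ i, KShape (q i) m ⥤ C.obj (x i)) :
    KShape n m ⥤ C.obj y :=
  C.ev (KShape.fst.monotone.functor ⋙ ν) fun i =>
    (KShape.map OrderHom.id fun l => e ⟨i, l⟩).monotone.functor ⋙ Z i

/-- The simplex `ν ∧ X₁ ∧ ⋯ ∧ X_k`, shuffled by a bijection. -/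
def KSimp.smash {q : Fin k → ℕ} {n m : ℕ} (ν : Fin (m + 1) ⥤ M.Hom x y)
    (e : (Σ i, Fin (q i)) ≃ Fin n) (X : ∀ i, KSimp (C.obj (x i)) (q i) m) :
    KSimp (C.obj y) n m where
  F := smashDiagram C ν e fun i => (X i).F
  inS t := by
    have h := ((C.act x y).obj (ν.obj t)).isMultiexact.inS e
      (fun i => (KShape.slice t).monotone.functor ⋙ (X i).F) fun i => (X i).inS t
    -- On the slice at `t` the operation does not vary: the transformation coming from `ν` is the
    -- image of an identity, so the slice is the fixed functor `f_t` applied to the slices of the `X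
    -- i`.
    convert h using 1
    refine Functor.hext (fun _ => rfl) fun a b f => heq_of_eq ?_
    refine (C.ev_map _ _ _).trans ?_
    have h1 : (C.act x y).map (ν.map (𝟙 t)) = 𝟙 _ := by
      rw [CategoryTheory.Functor.map_id, CategoryTheory.Functor.map_id]
    have h2 : ∀ α : (C.act x y).obj (ν.obj t) ⟶ (C.act x y).obj (ν.obj t), α = 𝟙 _ →
        ∀ {A B : ∀ i, C.obj (x i)} (φ : A ⟶ B), α.1.app A ≫ ((C.act x y).obj (ν.obj t)).F.map φ =
          ((C.act x y).obj (ν.obj t)).F.map φ := by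
      rintro _ rfl A B φ
      exact Category.id_comp _
    exact h2 _ h1 _
  weq t t' h a := by
    -- A step in the direction of `t` is a component of a natural weak equivalence followed by
    -- `f_{t'}` applied to a tuple of weak equivalences.
    refine (C.obj y).weq_comp _ _ (((C.act x y).map _).2 _) ?_
    exact ((C.act x y).obj (ν.obj t')).isMultiexact.weq _ fun i => (X i).weq t t' h _

end Ev

/-! ### The action on simplices of the smash product -/

section Action

variable {M : SymMulticat.{v, u}} (C : WaldAlgebra M) {k : ℕ} {x : Fin k → M.Ob} {y : M.Ob}
  {n : ℕ} {m : SimplexCategoryᵒᵖ}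

/-- The set of indices at which the circle coordinates `s` outside the image of `e` take the value
`(0, 1)`. -/
def smashSet {J : Type} {m : ℕ} (e : J → Fin n) (s : Fin n → Fin (m + 1) →o Fin 2) :
    Set (KShape n m) :=
  {a | ∀ l ∉ Set.range e, s l (a.2 l).fst = 0 ∧ s l (a.2 l).snd = 1}

/-- The indices outside the image of `e` are suspension coordinates. The simplex is obtained from
the unshuffled `X₁ ∧ ⋯ ∧ X_k` by suspending once for each of them and then permuting, so membership
in the iterated S-construction is inherited. -/
theorem exists_smash_extZero {q : Fin k → ℕ} (ν : Fin (m.unop.len + 1) ⥤ M.Hom x y)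
    (e : (Σ i, Fin (q i)) → Fin n) (he : Function.Injective e) (s : Fin n → IntervalSimplex m)
    (X : ∀ i, KSimp (C.obj (x i)) (q i) m.unop.len) :
    ∃ Y : KSimp (C.obj y) n m.unop.len,
      IsExtZero Y.F (smashDiagram C.toWaldAlgebraData ν e fun i => (X i).F) (smashSet e s) := by
  classical
  let w := Fintype.equivFin ((Set.range e)ᶜ : Set (Fin n))
  -- `β` sends the first block of indices to the image of `e`, in the order of concatenation, and
  -- the last block to the complement, enumerated by `w`.
  let β : Fin (∑ i, q i + Fintype.card ((Set.range e)ᶜ : Set (Fin n))) ≃ Fin n :=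
    finSumFinEquiv.symm.trans (((finSigmaFinEquiv.symm.trans (Equiv.ofInjective e he)).sumCongr
      w.symm).trans (Equiv.Set.sumCompl (Set.range e)))
  have hβ₁ : ∀ a, β (Fin.castAdd _ (finSigmaFinEquiv a)) = e a := fun a => by simp [β]
  have hβ₂ : ∀ l, β (Fin.natAdd _ l) = w.symm l := fun l => by simp [β]
  let Y : ((kSpectrumData (C.obj y)).level (∑ i, q i)).S m :=
    KSimp.smash C.toWaldAlgebraData ν finSigmaFinEquiv X
  refine ⟨KSimp.act ((kSpectrumData (C.obj y)).suspIter _ Y fun l => s (w.symm l)) β, ?_⟩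
  refine ((isExtZero_suspIter (C.obj y) _ Y fun l => s (w.symm l)).precomp
    (KShape.map OrderHom.id β)).congr ?_ ?_
  · change smashDiagram C.toWaldAlgebraData ν
      (fun a => β (Fin.castAdd _ (finSigmaFinEquiv a))) _ = _
    simp only [hβ₁]
  · ext a
    let W : Fin n → Fin n → Prop := fun j l => s j (a.2 l).fst = 0 ∧ s j (a.2 l).snd = 1
    have hw : ∀ l hl, (w.symm (w ⟨l, hl⟩) : Fin n) = l := fun l hl =>
      congrArg Subtype.val (w.symm_apply_apply _)
    exact ⟨fun h l hl => Eq.mp (congrArg₂ W (hw l hl) ((hβ₂ _).trans (hw l hl))) (h (w ⟨l, hl⟩)),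
      fun h l => Eq.mp (congrArg (W _) (hβ₂ l).symm) (h _ (w.symm l).2)⟩

/-- The action on representatives of simplices of the smash product. -/
noncomputable def smashAction (ν : (nerve (M.Hom x y)).obj m) :
    Option (SmashGen (fun i => KTheory.obj (C.obj (x i))) n m) → KSimp (C.obj y) n m.unop.len
  | none => KSimp.pt _ _ _
  | some g => (exists_smash_extZero C (simplexFunctor ν) g.e g.inj g.s g.a).choose

theorem isExtZero_smashAction (ν : (nerve (M.Hom x y)).obj m)
    (g : SmashGen (fun i => KTheory.obj (C.obj (x i))) n m) :
    IsExtZero (smashAction C ν (some g)).F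
      (smashDiagram C.toWaldAlgebraData (simplexFunctor ν) g.e fun i => kDiagram (g.a i))
      (smashSet g.e g.s) :=
  (exists_smash_extZero C (simplexFunctor ν) g.e g.inj g.s g.a).choose_spec

theorem KSimp.isExtZero_pt (C : WaldCat.{u}) (q m : ℕ) (X : KShape q m ⥤ C) :
    IsExtZero (KSimp.pt C q m).F X ∅ :=
  ⟨fun _ h => h.elim, fun _ _ => rfl, fun _ h => h.elim⟩

/-- An extension by zero is unique, so the arbitrary choice in `smashAction` is harmless. For each
relation it suffices to match underlying diagrams and supports, or to see that both simplices are
the base point. -/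
theorem smashAction_rel (ν : (nerve (M.Hom x y)).obj m)
    (a b : Option (SmashGen (fun i => KTheory.obj (C.obj (x i))) n m)) (h : SmashRel a b) :
    smashAction C ν a = smashAction C ν b := by
  cases h with
  | sphere q e he s s' a h =>
    refine KSimp.ext ((isExtZero_smashAction C ν _).unique
      ((isExtZero_smashAction C ν _).congr rfl ?_))
    ext z
    exact forall₂_congr fun l hl => (iff_of_eq (congrArg (fun t : IntervalSimplex m =>
      t (z.2 l).fst = 0 ∧ t (z.2 l).snd = 1) (h l hl))).symm
  | perm q q' θ e he s a =>
    refine KSimp.ext ((isExtZero_smashAction C ν _).unique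
      ((isExtZero_smashAction C ν _).congr ?_ ?_))
    -- Permuting the coordinates of `X_i` by `θ i` cancels against the inverse permutation in the
    -- injection.
    · change smashDiagram C.toWaldAlgebraData (simplexFunctor ν)
        (fun z : Σ i, Fin (q i) => e ⟨z.1, (θ z.1).symm (θ z.1 z.2)⟩) (fun i => kDiagram (a i)) = _
      simp only [Equiv.symm_apply_apply]
    · have : Set.range (fun z : Σ i, Fin (q' i) => e ⟨z.1, (θ z.1).symm z.2⟩) = Set.range e :=
        (Equiv.sigmaCongrRight fun i => (θ i).symm).surjective.range_comp e
      change {z : KShape n m.unop.len | ∀ l ∉ Set.range (fun z : Σ i, Fin (q' i) =>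
        e ⟨z.1, (θ z.1).symm z.2⟩), _} = _
      rw [this]; rfl
  | susp q r e he s a =>
    -- The right-hand representative is an extension by zero twice over: the suspended arguments
    -- give one by `IsExtZero.ev`, and the remaining circle coordinates give another. It remains to
    -- see that the supports intersect in that of the left-hand one.
    refine KSimp.ext (((isExtZero_smashAction C ν _).unique
      (((isExtZero_smashAction C ν _).trans (IsExtZero.ev C.toWaldAlgebraData _ fun i =>
        (isExtZero_suspIter (C.obj (x i)) (r i) (a i) fun l => s (e ⟨i, Fin.natAdd (q i) l⟩)).precomp
          (KShape.map OrderHom.id fun l => e ⟨i, l⟩))).congr rfl ?_)))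
    ext z
    constructor
    · rintro ⟨h₁, h₂⟩ l hl
      -- An index missed by the restricted injection is either missed by `e` or is a suspension
      -- coordinate `e ⟨i, Fin.natAdd (q i) b⟩` of some argument.
      by_cases hle : l ∈ Set.range e
      · obtain ⟨⟨i, b⟩, rfl⟩ := hle
        induction b using Fin.addCases with
        | left b => exact (hl ⟨⟨i, b⟩, rfl⟩).elim
        | right b => exact h₁ i b
      · exact h₂ l hle
    · intro h
      refine ⟨fun i b => h _ ?_, fun l hl => h l fun ⟨z, hz⟩ => hl ⟨_, hz⟩⟩
      rintro ⟨⟨i', b'⟩, hb⟩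
      have := he hb
      simp only [Sigma.mk.injEq] at this
      obtain ⟨rfl, hb⟩ := this
      -- By injectivity of `e`, a suspension coordinate in the smaller range would force a position
      -- at least `q i` to equal one below `q i`.
      have h1 := congrArg Fin.val (eq_of_heq hb)
      have h2 := b'.2
      simp only [Fin.val_castAdd, Fin.val_natAdd] at h1
      omega
  | pt g i h =>
    -- If one argument is the base point then the diagram vanishes everywhere, whatever the support.
    have hz : ∀ z, (smashDiagram C.toWaldAlgebraData (simplexFunctor ν) g.e
        fun i => kDiagram (g.a i)).obj z = (C.obj y).zero := fun z =>
      ((C.act x y).obj _).isMultiexact.zero _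
        ⟨i, congrArg (fun X : KSimp _ _ _ => X.F.obj _) h⟩
    have h1 := isExtZero_smashAction C ν g
    refine KSimp.ext (IsExtZero.unique (U := ∅) ⟨fun _ h => h.elim, fun z _ => ?_,
      fun _ h => h.elim⟩ (KSimp.isExtZero_pt _ _ _ ((Functor.const _).obj (C.obj y).zero)))
    by_cases hU : z ∈ smashSet g.e g.s
    · exact (h1.pos z hU).trans (hz z)
    · exact h1.neg z hU
  | sphere_pt g l hl h =>
    refine KSimp.ext ((isExtZero_smashAction C ν g).unique
      ((KSimp.isExtZero_pt _ _ _ _).congr rfl ?_))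
    refine (Set.eq_empty_iff_forall_notMem.2 fun z hz => ?_).symm
    -- A constant circle coordinate cannot take both values `0` and `1`, so the support is empty.
    exact fin2_ne (hz l hl).1 ((h _ _).trans (hz l hl).2)

/-- The action of `N(M(x; y))` on K-theory, as a function on the simplices of the smash product. -/
noncomputable def smashActionFun (n : ℕ) (m : SimplexCategoryᵒᵖ) :
    ((tensor (nerve (M.Hom x y)) (smash fun i => KTheory.obj (C.obj (x i)))).level n).S m →
      ((KTheory.obj (C.obj y)).level n).S m :=
  -- The outer quotient collapses `ν ∧ *`, and the inner one is the smash product; in both the base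
  -- point is sent to `KSimp.pt`.
  Quot.lift (fun z => z.elim (KSimp.pt _ _ _ : KSimp (C.obj y) n m.unop.len) fun z =>
      Quot.lift (smashAction C z.1) (smashAction_rel C z.1) z.2) (by rintro _ _ ⟨ν⟩; rfl)

/-- A pair `(ν, *)` is already the base point of the tensor, so the two nested quotients leave only
two cases. -/
theorem smash_tensor_cases
    (z : ((tensor (nerve (M.Hom x y)) (smash fun i => KTheory.obj (C.obj (x i)))).level n).S m) :
    z = ((tensor (nerve (M.Hom x y)) (smash fun i => KTheory.obj (C.obj (x i)))).level n).pt m ∨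
      ∃ (ν : (nerve (M.Hom x y)).obj m)
        (g : SmashGen (fun i => KTheory.obj (C.obj (x i))) n m),
        z = tensorMk (A := smash fun i => KTheory.obj (C.obj (x i))) ν (Quot.mk _ (some g)) := by
  obtain rfl | ⟨ν, z, rfl⟩ := tensor_cases z
  · exact Or.inl rfl
  · obtain ⟨z | g, rfl⟩ := Quot.exists_rep z
    · exact Or.inl (Quot.sound (TensorRel.some_pt _ rfl))
    · exact Or.inr ⟨ν, g, rfl⟩

/-- The action of `N(M(x; y))` on K-theory. -/
noncomputable def kAction (x : Fin k → M.Ob) (y : M.Ob) :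
    tensor (nerve (M.Hom x y)) (smash fun i => KTheory.obj (C.obj (x i))) ⟶
      KTheory.obj (C.obj y) :=
  SymSpectrum.Hom.mk (smashActionFun C)
    (fun {n m m'} θ z => by
      obtain rfl | ⟨ν, g, rfl⟩ := smash_tensor_cases C z
      · rfl
      -- Restriction along a simplicial operator preserves extensions by zero, and here diagram and
      -- support match definitionally.
      · exact KSimp.ext ((isExtZero_smashAction C ((nerve _).map θ ν) (g.map θ)).unique
          ((isExtZero_smashAction C ν g).precomp (KShape.map (simpOp θ) id))))
    rfl
    (fun {p q} e m z => by
      obtain rfl | ⟨ν, g, rfl⟩ := smash_tensor_cases C z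
      · rfl
      -- The diagrams agree definitionally; the supports correspond under `l ↦ e l` because the
      -- circle coordinates are moved by the inverse of `e`.
      · refine KSimp.ext ((isExtZero_smashAction C ν
          (g.push e.toEmbedding fun s l => s (e.symm l))).unique
          (((isExtZero_smashAction C ν g).precomp (KShape.map OrderHom.id e)).congr rfl ?_))
        ext a
        refine ⟨fun h l hl => ?_, fun h l hl => ?_⟩
        · have := h (e.symm l) fun ⟨b, hb⟩ => hl ⟨b, (congrArg e hb).trans (e.apply_symm_apply l)⟩
          change g.s (e.symm l) (a.2 (e (e.symm l))).fst = 0 ∧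
            g.s (e.symm l) (a.2 (e (e.symm l))).snd = 1 at this
          rw [e.apply_symm_apply] at this
          exact this
        · have := h (e l) fun ⟨b, hb⟩ => hl ⟨b, e.injective hb⟩
          change g.s (e.symm (e l)) (a.2 (e l)).fst = 0 ∧
            g.s (e.symm (e l)) (a.2 (e l)).snd = 1 at this
          rw [e.symm_apply_apply] at this
          exact this)
    (fun {n m} z s => by
      obtain rfl | ⟨ν, g, rfl⟩ := smash_tensor_cases C z
      · exact ((KTheory.obj (C.obj y)).susp_pt s).symm
      -- Suspending adds one index outside the image of the injection. The support is the old
      -- condition together with the condition on the last coordinate, matching the appended circle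
      -- coordinate `s`.
      · refine KSimp.ext ((isExtZero_smashAction C ν (g.push Fin.castSuccEmb
          fun t => Fin.snoc (α := fun _ => IntervalSimplex m) t s)).unique
          (((isExtZero_extZero _ _ (KSimp.suspSet_ordConnected s)).trans
            ((isExtZero_smashAction C ν g).precomp
              (KShape.map OrderHom.id Fin.castSucc))).congr rfl ?_))
        ext a
        have h₁ : ∀ l, Fin.snoc (α := fun _ => IntervalSimplex m) g.s s (Fin.castSucc l) = g.s l :=
          fun l => Fin.snoc_castSucc (α := fun _ => IntervalSimplex m) s g.s l
        have h₂ : Fin.snoc (α := fun _ => IntervalSimplex m) g.s s (Fin.last n) = s :=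
          Fin.snoc_last (α := fun _ => IntervalSimplex m) s g.s
        refine ⟨fun h l hl => ?_, fun h => ⟨fun l hl => ?_, ?_⟩⟩
        · change Fin.snoc (α := fun _ => IntervalSimplex m) g.s s l _ = 0 ∧
            Fin.snoc (α := fun _ => IntervalSimplex m) g.s s l _ = 1
          induction l using Fin.lastCases with
          | last => rw [h₂]; exact h.2
          | cast l =>
            rw [h₁]
            exact h.1 l fun ⟨b, hb⟩ => hl ⟨b, congrArg Fin.castSucc hb⟩
        · have := h (Fin.castSucc l) fun ⟨b, hb⟩ => hl ⟨b, Fin.castSucc_injective _ hb⟩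
          change Fin.snoc (α := fun _ => IntervalSimplex m) g.s s (Fin.castSucc l) _ = 0 ∧
            Fin.snoc (α := fun _ => IntervalSimplex m) g.s s (Fin.castSucc l) _ = 1 at this
          rw [h₁] at this
          exact this
        · have := h (Fin.last n) fun ⟨b, hb⟩ => (Fin.castSucc_lt_last (g.e b)).ne hb
          change Fin.snoc (α := fun _ => IntervalSimplex m) g.s s (Fin.last n) _ = 0 ∧
            Fin.snoc (α := fun _ => IntervalSimplex m) g.s s (Fin.last n) _ = 1 at this
          rw [h₂] at this
          exact this)

end Action

/-- Every functor is its own extension by zero from full support, so this is an instance of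
uniqueness. -/
theorem IsExtZero.eq_of_univ {C : WaldCat.{u}} {T : Type} [PartialOrder T] {F X : T ⥤ C}
    (h : IsExtZero F X Set.univ) : F = X :=
  h.unique ⟨fun _ _ => rfl, fun _ h => (h trivial).elim, fun _ _ _ => HEq.rfl⟩

/-! ### The algebra structure and its naturality -/

section Algebra

variable {M : SymMulticat.{v, u}} (C : WaldAlgebra M)

/-- The data of the algebra structure on the K-theory spectra. -/
noncomputable def kAlgebraData : SpectrumAlgebraData M fun x => KTheory.obj (C.obj x) where
  act x y := kAction C x y

/-- This formula determines the components and turns each algebra axiom into an identity between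
diagrams in `C`. -/
theorem kDiagram_component {k : ℕ} {x : Fin k → M.Ob} {y : M.Ob} {q : Fin k → ℕ} {n : ℕ}
    {m : SimplexCategoryᵒᵖ} (ν : (nerve (M.Hom x y)).obj m) (e : (Σ i, Fin (q i)) ≃ Fin n)
    (X : ∀ i, ((KTheory.obj (C.obj (x i))).level (q i)).S m) :
    kDiagram ((kAlgebraData C).component ν e X) =
      smashDiagram C.toWaldAlgebraData (simplexFunctor ν) e fun i => kDiagram (X i) := by
  refine IsExtZero.eq_of_univ ((isExtZero_smashAction C ν
    ⟨q, e, e.injective, fun _ => OrderHom.const _ 0, X⟩).congr rfl ?_)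
  -- The constant circle coordinates in `smashMk` are placeholders: `e` is surjective, so none of
  -- them is consulted.
  exact Set.eq_univ_of_forall fun a l hl => (hl (e.surjective l)).elim

/-- The algebra structure on the K-theory spectra. -/
noncomputable def kAlgebra : SpectrumAlgebra M fun x => KTheory.obj (C.obj x) where
  toSpectrumAlgebraData := kAlgebraData C
  act_one x {q n m} e e' he a := by
    refine KSimp.ext ((kDiagram_component C _ e a).trans ?_)
    refine (C.ev_one x _).trans ?_
    simp only [he]
    rfl
  act_comp {n j x y z m} ν μ {q r N} e ε ε' hε a := by
    refine KSimp.ext ((kDiagram_component C _ ε' a).trans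
      (Eq.trans ?_ (kDiagram_component C ν ε _).symm))
    -- The axiom is used on the shape `KShape N m`, with `ν` and the `μ i` pulled back along the
    -- first projection. Pulling back the composite operation gives definitionally the composite of
    -- the pullbacks.
    refine (C.ev_comp (KShape.fst.monotone.functor ⋙ simplexFunctor ν)
      (fun i => KShape.fst.monotone.functor ⋙ simplexFunctor (μ i)) _).trans ?_
    refine congrArg (C.ev _) (funext fun i => ?_)
    refine Eq.trans ?_ (congrArg ((KShape.map OrderHom.id fun l => ε ⟨i, l⟩).monotone.functor ⋙ ·)
      (kDiagram_component C (μ i) (e i) fun c => a (place j i c))).symm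
    simp only [hε]
    rfl
  act_perm {k l} σ {x y m} ν {q n} e e' he a := by
    refine KSimp.ext ((kDiagram_component C _ e' fun i => a (σ i)).trans
      (Eq.trans ?_ (kDiagram_component C ν e a).symm))
    -- Permuting the inputs needs no further reindexing, since `he` says that `e'` is `e` with its
    -- blocks relabelled by `σ`.
    refine Eq.trans ?_ (C.ev_perm σ (KShape.fst.monotone.functor ⋙ simplexFunctor ν) _)
    refine congrArg (C.ev _) (funext fun i => ?_)
    simp only [he]

/-- Postcomposition with the exact functor `H.app y` is evaluated by the component formula on both
sides, and the strict compatibility `app_ev` compares the results. -/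
theorem kAlgebra_isHom {C D : WaldAlgebra M} (H : C.Hom D) :
    (kAlgebra C).IsHom (kAlgebra D) fun x => KTheory.map (H.app x) := by
  intro k x y q n m ν e a
  refine KSimp.ext (Eq.trans ?_ (kDiagram_component D ν e _).symm)
  refine (congrArg (· ⋙ (H.app y).functor) (kDiagram_component C ν e a)).trans ?_
  exact H.app_ev _ _

end Algebra

theorem mainTheorem9 (M : SymMulticat.{v, u}) :
    ∃ Φ : ∀ C : WaldAlgebra M, SpectrumAlgebra M (fun x => KTheory.obj (C.obj x)),
      (∀ (C : WaldAlgebra M) {k : ℕ} {x : Fin k → M.Ob} {y : M.Ob} {q : Fin k → ℕ} {n : ℕ}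
        {m : SimplexCategoryᵒᵖ} (ν : (nerve (M.Hom x y)).obj m) (e : (Σ i, Fin (q i)) ≃ Fin n)
        (X : ∀ i, ((KTheory.obj (C.obj (x i))).level (q i)).S m),
        kDiagram ((Φ C).component ν e X) =
          C.ev (KShape.fst.monotone.functor ⋙ simplexFunctor ν)
            (fun i => (KShape.map OrderHom.id fun l => e ⟨i, l⟩).monotone.functor ⋙
              kDiagram (X i))) ∧
      (∀ (C D : WaldAlgebra M) (H : C.Hom D),
        (Φ C).IsHom (Φ D) fun x => KTheory.map (H.app x)) :=
  ⟨kAlgebra, fun C _ _ _ _ _ _ ν e X => kDiagram_component C ν e X, fun _ _ H => kAlgebra_isHom H⟩
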